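/- All groups and graphs are finite, and graphs are simple and undirected. For a group $G$ and a subset $S\subseteq G\setminus\{1\}$ with $S=S^{-1}$, the Cayley graph $\mathrm{Cay}(G,S)$ has vertex set $G$, and $a,b\in G$ are adjacent if and only if $ab^{-1}\in S$. The spectrum $\mathrm{Spec}(\Gamma)$ of a graph $\Gamma$ is the multiset of eigenvalues of its adjacency matrix. A group $G$ is called DS if, for every Cayley graph $\Gamma$ over $G$ and every graph $\Gamma'$, $\mathrm{Spec}(\Gamma)=\mathrm{Spec}(\Gamma')$ implies $\Gamma\cong\Gamma'$. It is called Cay-DS if, for every Cayley graph $\Gamma$ over $G$ and every Cayley graph $\Gamma'$ over any finite group, $\mathrm{Spec}(\Gamma)=\mathrm{Spec}(\Gamma')$ implies $\Gamma\cong\Gamma'$. Let $C_n$ denote the cyclic group of order $n$. **Theorem.** 1. Every Sylow $p$-subgroup of a finite Cay-DS group is cyclic for every prime $p>5$. Every Sylow $5$-subgroup of a finite DS group is cyclic. 2. Every Sylow $2$-subgroup of a finite Cay-DS group has order at most $16$. 3. Every Sylow $3$-subgroup of a finite Cay-DS group is either cyclic or isomorphic to $C_3\times C_3$. -/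

import Mathlib

open Classical in
/-- The adjacency spectrum of a finite graph: the multiset of eigenvalues of its (real symmetric)
adjacency matrix, i.e. the roots of the characteristic polynomial, with multiplicity. -/
noncomputable def adjSpectrum {V : Type*} [Fintype V] (Γ : SimpleGraph V) : Multiset ℝ :=
  (Γ.adjMatrix ℝ).charpoly.roots

open Classical in
/-- The adjacency spectrum is the list of eigenvalues given by the spectral theorem; in particular
it has as many members, with multiplicity, as the graph has vertices. -/
theorem adjSpectrum_eq_eigenvalues {V : Type*} [Fintype V] (Γ : SimpleGraph V)
    (h : (Γ.adjMatrix ℝ).IsHermitian) :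
    adjSpectrum Γ = Finset.univ.val.map h.eigenvalues :=
  h.roots_charpoly_eq_eigenvalues

/-- A Cayley (connection) set: a subset `S` of `G \ {1}` with `S = S⁻¹`. -/
structure IsConnectionSet {G : Type*} [Group G] (S : Set G) : Prop where
  one_notMem : (1 : G) ∉ S
  inv_eq : S⁻¹ = S

/-- The undirected Cayley graph `Cay(G, S)`: its vertices are the elements of `G`, and `a`, `b`
are adjacent whenever `a * b⁻¹ ∈ S`. -/
def cayleyGraph {G : Type*} [Group G] (S : Set G) (hS : IsConnectionSet S) : SimpleGraph G where
  Adj a b := a * b⁻¹ ∈ S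
  symm := ⟨fun a b h => by
    rw [← hS.inv_eq, Set.mem_inv]
    simpa using h⟩
  loopless := ⟨fun a h => hS.one_notMem (by simpa using h)⟩

/-- A finite group is DS if every Cayley graph over it is isomorphic to every finite graph with
the same spectrum. (Every finite graph is isomorphic to one whose vertex type lives in `Type`.) -/
def IsDSGroup (G : Type*) [Group G] [Fintype G] : Prop :=
  ∀ (S : Set G) (hS : IsConnectionSet S) (W : Type) [Fintype W] (Γ' : SimpleGraph W),
    adjSpectrum (cayleyGraph S hS) = adjSpectrum Γ' → Nonempty (cayleyGraph S hS ≃g Γ')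

/-- A finite group is Cay-DS if every Cayley graph over it is isomorphic to every Cayley graph,
over an arbitrary finite group, with the same spectrum. (Every finite group is isomorphic to one
whose underlying type lives in `Type`.) -/
def IsCayDSGroup (G : Type*) [Group G] [Fintype G] : Prop :=
  ∀ (S : Set G) (hS : IsConnectionSet S) (K : Type) [Group K] [Fintype K] (T : Set K)
    (hT : IsConnectionSet T),
    adjSpectrum (cayleyGraph S hS) = adjSpectrum (cayleyGraph T hT) →
      Nonempty (cayleyGraph S hS ≃g cayleyGraph T hT)

/-! Let H be a subgroup of G and Γ a Cayley graph of H. The disjoint union of [G : H] copies of Γ is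
a Cayley graph of G. If Δ is cospectral to Γ, then as many copies of Δ are cospectral to this union,
and they form a Cayley graph of K × C_m when Δ is a Cayley graph of K and m = [G : H]. If Γ is
connected, the copies can be cancelled from an isomorphism. By `IsCayDSGroup.nonempty_iso` and
`IsDSGroup.nonempty_iso` it is therefore enough to find, inside each forbidden Sylow subgroup, a
connected Cayley graph of some subgroup with a nonisomorphic cospectral mate.

For odd p a noncyclic p-group contains C_p × C_p (`IsPGroup.exists_commute_of_not_isCyclic`). Lines
of k parallel classes in the affine plane give a Cayley graph of it, and the spectrum of the
collinearity graph of a net depends only on k and the order (`IsNet.cospectral`). For p > 5, four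
directions with harmonic cross-ratio and four without give nonisomorphic graphs: only a harmonic net
contains a parallelogram whose sides and diagonals all belong to it. For p = 5, three directions are
compared with a Latin square having a subsquare of order two; this mate is not exhibited as a Cayley
graph, so the conclusion is about DS groups.

For p = 3, every group of order 27 containing C_3 × C_3 has as a Cayley graph the Hamming graph
H(3,3), a mate of it, or a graph with a mate on C_9 × C_3 (`isCayleyOnSubgroup_of_card_eq`).

For p = 2, the noncyclic and cyclic groups of order 16 with an element of order 8 are excluded one
by one (`IsCayDSGroup.orderOf_ne_eight`). A group of order 32 then has exponent dividing 4, and it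
contains two subgroups whose cosets form a 4 by 4 board (`hasRookSubgroups_of_card`). A blow-up of
the rook graph on this board is cospectral to a blow-up of the Shrikhande graph, which has no
4-clique. -/

/-! ### Closed walks and the spectrum -/

open Classical in
/-- The number of closed walks of length `k`, as a trace. -/
noncomputable def closedWalks {V : Type*} [Fintype V] (Γ : SimpleGraph V) (k : ℕ) : ℝ :=
  ((Γ.adjMatrix ℝ) ^ k).trace

/-- Two graphs are cospectral if they have the same number of closed walks of each length. -/
def Cospectral {V W : Type*} [Fintype V] [Fintype W] (Γ : SimpleGraph V) (Δ : SimpleGraph W) :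
    Prop :=
  ∀ k, closedWalks Γ k = closedWalks Δ k

section Basic
variable {U V W : Type*} [Fintype U] [Fintype V] [Fintype W]

theorem Cospectral.symm {Γ : SimpleGraph V} {Δ : SimpleGraph W} (h : Cospectral Γ Δ) :
    Cospectral Δ Γ := fun k => (h k).symm

theorem Cospectral.trans {Γ : SimpleGraph U} {Δ : SimpleGraph V} {Θ : SimpleGraph W}
    (h : Cospectral Γ Δ) (h' : Cospectral Δ Θ) : Cospectral Γ Θ := fun k => (h k).trans (h' k)

theorem closedWalks_zero (Γ : SimpleGraph V) : closedWalks Γ 0 = Fintype.card V := by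
  simp [closedWalks]

theorem Cospectral.card_eq {Γ : SimpleGraph V} {Δ : SimpleGraph W} (h : Cospectral Γ Δ) :
    Fintype.card V = Fintype.card W := by
  have := h 0
  rw [closedWalks_zero, closedWalks_zero] at this
  exact_mod_cast this

end Basic

theorem Multiset.sum_map_eval_eq_of_power_sums {s t : Multiset ℝ}
    (h : ∀ k : ℕ, (s.map (· ^ k)).sum = (t.map (· ^ k)).sum) (p : Polynomial ℝ) :
    (s.map fun x => p.eval x).sum = (t.map fun x => p.eval x).sum := by
  induction p using Polynomial.induction_on' with
  | add p q hp hq => simp only [Polynomial.eval_add, Multiset.sum_map_add, hp, hq]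
  | monomial n c => simp only [Polynomial.eval_monomial, Multiset.sum_map_mul_left, h n]

/-- Power sums determine the sum of any polynomial over the multiset. The Lagrange polynomial that
is 1 at `a` and 0 at all other members of `s` and `t` turns this sum into the multiplicity of `a`.
-/
theorem Multiset.eq_of_power_sums {s t : Multiset ℝ}
    (h : ∀ k : ℕ, (s.map (· ^ k)).sum = (t.map (· ^ k)).sum) : s = t := by
  classical
  have hp := Multiset.sum_map_eval_eq_of_power_sums h
  ext a
  set F : Finset ℝ := insert a (s.toFinset ∪ t.toFinset) with hF
  have key : ∀ u : Multiset ℝ, u.toFinset ⊆ F →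
      (u.map fun x => (Lagrange.basis F id a).eval x).sum = u.count a := by
    intro u hu
    rw [Finset.sum_multiset_map_count, Finset.sum_eq_single a]
    · have : (Lagrange.basis F id a).eval (id a) = 1 :=
        Lagrange.eval_basis_self (Set.injOn_id _) (Finset.mem_insert_self _ _)
      rw [id] at this
      simp [this]
    · intro b hb hba
      have : (Lagrange.basis F id a).eval (id b) = 0 := Lagrange.eval_basis_of_ne hba.symm (hu hb)
      rw [id] at this
      simp [this]
    · intro ha
      rw [Multiset.mem_toFinset, ← Multiset.count_eq_zero] at ha
      simp [ha]
  have := hp (Lagrange.basis F id a)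
  rw [key s (by grind), key t (by grind)] at this
  exact_mod_cast this

open Classical in
theorem trace_pow_eq_sum_adjSpectrum {V : Type*} [Fintype V] (Γ : SimpleGraph V) (k : ℕ) :
    closedWalks Γ k = ((adjSpectrum Γ).map (· ^ k)).sum := by
  have h : (Γ.adjMatrix ℝ).IsHermitian := by
    rw [Matrix.IsHermitian, Matrix.conjTranspose_eq_transpose_of_trivial]
    exact Γ.isSymm_adjMatrix
  rw [adjSpectrum_eq_eigenvalues Γ h, closedWalks]
  conv_lhs => rw [h.spectral_theorem]
  rw [← map_pow, Unitary.conjStarAlgAut_apply, Matrix.trace_mul_comm, ← mul_assoc]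
  simp [Matrix.diagonal_pow]

theorem Cospectral.adjSpectrum_eq {V W : Type*} [Fintype V] [Fintype W] {Γ : SimpleGraph V}
    {Δ : SimpleGraph W} (h : Cospectral Γ Δ) : adjSpectrum Γ = adjSpectrum Δ :=
  Multiset.eq_of_power_sums fun k => by
    rw [← trace_pow_eq_sum_adjSpectrum, ← trace_pow_eq_sum_adjSpectrum, h k]

theorem SimpleGraph.Iso.cospectral {V W : Type*} [Fintype V] [Fintype W] {Γ : SimpleGraph V}
    {Δ : SimpleGraph W} (f : Γ ≃g Δ) : Cospectral Γ Δ := by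
  classical
  intro k
  have : Γ.adjMatrix ℝ = (Δ.adjMatrix ℝ).submatrix f f := by
    ext u v
    simp [SimpleGraph.adjMatrix_apply, f.map_adj_iff]
  have h2 : ∀ k, (Γ.adjMatrix ℝ) ^ k = ((Δ.adjMatrix ℝ) ^ k).submatrix f f := by
    intro k
    induction k with
    | zero => simpa using (Matrix.submatrix_one_equiv f.toEquiv).symm
    | succ k ih =>
      rw [pow_succ, pow_succ, ih, this]
      exact Matrix.submatrix_mul_equiv _ _ f f.toEquiv f
  unfold closedWalks
  convert congrArg Matrix.trace (h2 k) using 1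
  simp only [Matrix.trace, Matrix.diag_apply, Matrix.submatrix_apply]
  exact (Equiv.sum_comp f.toEquiv fun i => ((Δ.adjMatrix ℝ) ^ k) i i).symm

/-! ### Disjoint copies and blow-ups -/

/-- The disjoint union of copies of a graph, indexed by a type. -/
def copies {V : Type*} (Γ : SimpleGraph V) (I : Type*) : SimpleGraph (V × I) where
  Adj a b := Γ.Adj a.1 b.1 ∧ a.2 = b.2
  symm := ⟨fun _ _ h => ⟨h.1.symm, h.2.symm⟩⟩
  loopless := ⟨fun _ h => Γ.irrefl h.1⟩

@[simp]
theorem copies_adj {V I : Type*} (Γ : SimpleGraph V) (a b : V × I) :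
    (copies Γ I).Adj a b ↔ Γ.Adj a.1 b.1 ∧ a.2 = b.2 := Iff.rfl

theorem closedWalks_copies {V I : Type*} [Fintype V] [Fintype I] (Γ : SimpleGraph V) (k : ℕ) :
    closedWalks (copies Γ I) k = Fintype.card I * closedWalks Γ k := by
  classical
  have : (copies Γ I).adjMatrix ℝ = Matrix.blockDiagonal fun _ : I => Γ.adjMatrix ℝ := by
    ext ⟨u, i⟩ ⟨v, j⟩
    by_cases h : i = j <;>
      simp [SimpleGraph.adjMatrix_apply, Matrix.blockDiagonal_apply, h]
  unfold closedWalks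
  calc _ = ((Matrix.blockDiagonal fun _ : I => Γ.adjMatrix ℝ) ^ k).trace := by
        rw [← this]; congr!
    _ = _ := by
        rw [← Matrix.blockDiagonal_pow, Matrix.trace_blockDiagonal]
        simp only [Pi.pow_apply, Finset.sum_const, Finset.card_univ, nsmul_eq_mul]

theorem Cospectral.copies {V W I J : Type*} [Fintype V] [Fintype W] [Fintype I] [Fintype J]
    {Γ : SimpleGraph V} {Δ : SimpleGraph W} (h : Cospectral Γ Δ)
    (hIJ : Fintype.card I = Fintype.card J) : Cospectral (copies Γ I) (copies Δ J) := by
  intro k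
  rw [closedWalks_copies, closedWalks_copies, h k, hIJ]

/-- A connected graph embeds into any graph whose copies contain copies of it; if the orders
agree, then the two graphs are isomorphic. -/
theorem nonempty_iso_of_copies {V W I J : Type*} [Fintype V] [Fintype W] [Nonempty I]
    {Γ : SimpleGraph V} {Δ : SimpleGraph W} (hΓ : Γ.Connected)
    (hcard : Fintype.card V = Fintype.card W) (f : copies Γ I ≃g copies Δ J) :
    Nonempty (Γ ≃g Δ) := by
  obtain ⟨i⟩ := ‹Nonempty I›
  have hadj : ∀ u v, Γ.Adj u v ↔ Δ.Adj (f (u, i)).1 (f (v, i)).1 ∧ (f (u, i)).2 = (f (v, i)).2 := by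
    intro u v
    have : (copies Γ I).Adj (u, i) (v, i) ↔ Γ.Adj u v := by simp
    rw [← this, ← f.map_adj_iff]
    rfl
  -- Adjacent vertices land in the same copy of Δ, so connectedness puts the whole image of one copy
  -- of Γ into a single copy.
  have hsnd : ∀ u v, (f (u, i)).2 = (f (v, i)).2 := by
    intro u v
    obtain ⟨p⟩ := hΓ.preconnected u v
    induction p with
    | nil => rfl
    | cons h _ ih => exact ((hadj _ _).1 h).2.trans ih
  have hinj : Function.Injective fun u => (f (u, i)).1 := by
    intro u v huv
    have := f.injective (Prod.ext huv (hsnd u v))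
    exact congrArg Prod.fst this
  refine ⟨⟨Equiv.ofBijective _ ((Fintype.bijective_iff_injective_and_card _).2 ⟨hinj, hcard⟩), ?_⟩⟩
  intro u v
  rw [hadj u v]
  exact ⟨fun h => ⟨h, hsnd u v⟩, fun h => h.1⟩

/-- Each intermediate vertex of a walk lifts in `n` ways, so positive powers of the adjacency matrix
of the blow-up are pulled back from below up to a power of `n`. The zeroth power is not pulled back,
hence the shift of the exponent. -/
theorem closedWalks_comap {V W : Type*} [Fintype V] [Fintype W] (Δ : SimpleGraph W) (π : V → W)
    (n : ℕ) (hπ : ∀ w, Nat.card {v // π v = w} = n) (k : ℕ) :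
    closedWalks (Δ.comap π) (k + 1) = n ^ (k + 1) * closedWalks Δ (k + 1) := by
  classical
  have hA : (Δ.comap π).adjMatrix ℝ = (Δ.adjMatrix ℝ).submatrix π π := by
    ext u v
    simp [SimpleGraph.adjMatrix_apply]
  have hsum : ∀ g : W → ℝ, ∑ v, g (π v) = n * ∑ w, g w := by
    intro g
    rw [← Finset.sum_fiberwise (s := Finset.univ) (g := π), Finset.mul_sum]
    refine Finset.sum_congr rfl fun w _ => ?_
    rw [Finset.sum_congr rfl (g := fun _ => g w) fun v hv => by rw [(Finset.mem_filter.1 hv).2],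
      Finset.sum_const, nsmul_eq_mul, ← hπ w, Nat.card_eq_fintype_card, Fintype.card_subtype]
  have hpow : ∀ k, ((Δ.comap π).adjMatrix ℝ) ^ (k + 1) =
      (n : ℝ) ^ k • ((Δ.adjMatrix ℝ) ^ (k + 1)).submatrix π π := by
    intro k
    induction k with
    | zero => simp [hA]
    | succ k ih =>
      rw [pow_succ, ih, hA]
      ext u v
      rw [Matrix.smul_mul, Matrix.smul_apply, Matrix.mul_apply, Matrix.smul_apply,
        Matrix.submatrix_apply, pow_succ (Δ.adjMatrix ℝ) (k + 1),
        Matrix.mul_apply]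
      simp only [Matrix.submatrix_apply]
      rw [hsum fun w => (Δ.adjMatrix ℝ ^ (k + 1)) (π u) w * Δ.adjMatrix ℝ w (π v), smul_eq_mul,
        smul_eq_mul]
      ring
  have h1 : closedWalks (Δ.comap π) (k + 1) = (((Δ.comap π).adjMatrix ℝ) ^ (k + 1)).trace := by
    unfold closedWalks; congr!
  have h2 : closedWalks Δ (k + 1) = ((Δ.adjMatrix ℝ) ^ (k + 1)).trace := by
    unfold closedWalks; congr!
  rw [h1, h2, hpow, Matrix.trace_smul, Matrix.trace]
  simp only [Matrix.diag_apply, Matrix.submatrix_apply]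
  rw [hsum fun w => (Δ.adjMatrix ℝ ^ (k + 1)) w w, Matrix.trace, smul_eq_mul]
  simp only [Matrix.diag_apply]
  ring

theorem card_eq_mul_of_fibers {V W : Type*} [Fintype V] [Fintype W] (π : V → W) (n : ℕ)
    (hπ : ∀ w, Nat.card {v // π v = w} = n) : Fintype.card V = Fintype.card W * n := by
  classical
  rw [← Fintype.card_congr (Equiv.sigmaFiberEquiv π), Fintype.card_sigma]
  simp only [← Nat.card_eq_fintype_card, hπ]
  simp

theorem Cospectral.comap {V V' W W' : Type*} [Fintype V] [Fintype W] [Fintype V'] [Fintype W']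
    {Δ : SimpleGraph W} {Δ' : SimpleGraph W'} (h : Cospectral Δ Δ') (n : ℕ) (π : V → W)
    (π' : V' → W') (hπ : ∀ w, Nat.card {v // π v = w} = n)
    (hπ' : ∀ w, Nat.card {v // π' v = w} = n) :
    Cospectral (Δ.comap π) (Δ'.comap π') := by
  intro k
  cases k with
  | zero =>
    rw [closedWalks_zero, closedWalks_zero, card_eq_mul_of_fibers π n hπ,
      card_eq_mul_of_fibers π' n hπ', h.card_eq]
  | succ k => rw [closedWalks_comap Δ π n hπ, closedWalks_comap Δ' π' n hπ', h]

/-! ### Criteria for cospectrality -/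

/-- The automorphism group of the graph is transitive on the vertices. -/
def IsVertexTransitive {V : Type*} (Γ : SimpleGraph V) : Prop := ∀ u v, ∃ f : Γ ≃g Γ, f u = v

theorem adjMatrix_pow_apply_iso {V : Type*} [Fintype V] [DecidableEq V] {Γ : SimpleGraph V}
    [DecidableRel Γ.Adj] (f : Γ ≃g Γ) (k : ℕ) (u v : V) :
    ((Γ.adjMatrix ℝ) ^ k) (f u) (f v) = ((Γ.adjMatrix ℝ) ^ k) u v := by
  induction k generalizing u v with
  | zero => simp [Matrix.one_apply]
  | succ k ih =>
    rw [pow_succ, Matrix.mul_apply, Matrix.mul_apply, ← f.toEquiv.sum_comp]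
    refine Finset.sum_congr rfl fun w _ => ?_
    have : (f.toEquiv w) = f w := rfl
    rw [this, ih]
    simp [SimpleGraph.adjMatrix_apply, f.map_adj_iff]

/-- A certificate for the closed walk counts at a vertex: the successive images of the indicator
function of the vertex `u` under the adjacency operator, together with a linear recurrence. -/
structure WalkCertificate {V : Type*} [Fintype V] [DecidableEq V] (Γ : SimpleGraph V)
    [DecidableRel Γ.Adj] (u : V) (m : ℕ) (c w : ℕ → ℤ) where
  vec : ℕ → V → ℤ
  vec_zero : ∀ v, vec 0 v = if v = u then 1 else 0
  vec_succ : ∀ i < m, ∀ v, ∑ x, (if Γ.Adj v x then vec i x else 0) = vec (i + 1) v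
  recurrence : ∀ v, vec m v = ∑ i ∈ Finset.range m, c i * vec i v
  closed : ∀ i < m, vec i u = w i

/-- The certificate says that a polynomial in A kills the indicator vector of `u`. Multiplying by A
^ k and reading the coordinate at `u` gives the recurrence for all later walk counts. -/
theorem WalkCertificate.recurrence_pow {V : Type*} [Fintype V] [DecidableEq V]
    {Γ : SimpleGraph V} [DecidableRel Γ.Adj] {u : V} {m : ℕ} {c w : ℕ → ℤ}
    (C : WalkCertificate Γ u m c w) :
    (∀ k < m, ((Γ.adjMatrix ℝ) ^ k) u u = w k) ∧
    ∀ k, ((Γ.adjMatrix ℝ) ^ (k + m)) u u =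
      ∑ i ∈ Finset.range m, (c i : ℝ) * ((Γ.adjMatrix ℝ) ^ (k + i)) u u := by
  have hvec : ∀ k ≤ m, ∀ v, ((Γ.adjMatrix ℝ) ^ k) v u = C.vec k v := by
    intro k
    induction k with
    | zero => intro _ v; rw [C.vec_zero]; simp [Matrix.one_apply]
    | succ k ih =>
      intro hk v
      rw [pow_succ', Matrix.mul_apply, ← C.vec_succ k hk]
      push_cast
      refine Finset.sum_congr rfl fun x _ => ?_
      rw [ih (by omega), SimpleGraph.adjMatrix_apply]
      simp
  refine ⟨fun k hk => by rw [hvec k hk.le, C.closed k hk], fun k => ?_⟩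
  rw [pow_add, Matrix.mul_apply]
  simp_rw [hvec m le_rfl, C.recurrence, pow_add, Matrix.mul_apply]
  push_cast
  simp_rw [Finset.mul_sum]
  rw [Finset.sum_comm]
  refine Finset.sum_congr rfl fun i hi => Finset.sum_congr rfl fun x _ => ?_
  rw [hvec i (Finset.mem_range.1 hi).le]
  ring

theorem IsVertexTransitive.closedWalks_eq {V : Type*} [Fintype V] [DecidableEq V]
    {Γ : SimpleGraph V} [DecidableRel Γ.Adj] (h : IsVertexTransitive Γ) (u : V) (k : ℕ) :
    closedWalks Γ k = Fintype.card V * ((Γ.adjMatrix ℝ) ^ k) u u := by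
  have h1 : closedWalks Γ k = ((Γ.adjMatrix ℝ) ^ k).trace := by
    unfold closedWalks; congr!
  rw [h1, Matrix.trace, Finset.sum_congr rfl (g := fun _ => ((Γ.adjMatrix ℝ) ^ k) u u)]
  · simp
  · intro v _
    obtain ⟨f, hf⟩ := h u v
    rw [Matrix.diag_apply, ← hf, adjMatrix_pow_apply_iso]

/-- By transitivity the trace is the order times one diagonal entry, and the diagonal entries of
both graphs obey the same recurrence with the same initial values. -/
theorem WalkCertificate.cospectral {V W : Type*} [Fintype V] [DecidableEq V] [Fintype W]
    [DecidableEq W] {Γ : SimpleGraph V} [DecidableRel Γ.Adj] {Δ : SimpleGraph W}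
    [DecidableRel Δ.Adj] {u : V} {v : W} {m : ℕ} {c w : ℕ → ℤ} (C : WalkCertificate Γ u m c w)
    (D : WalkCertificate Δ v m c w) (hΓ : IsVertexTransitive Γ) (hΔ : IsVertexTransitive Δ)
    (hcard : Fintype.card V = Fintype.card W) : Cospectral Γ Δ := by
  intro k
  rw [hΓ.closedWalks_eq u, hΔ.closedWalks_eq v, hcard]
  congr 1
  induction k using Nat.strong_induction_on with
  | _ k ih =>
    by_cases hk : k < m
    · rw [C.recurrence_pow.1 k hk, D.recurrence_pow.1 k hk]
    · obtain ⟨j, rfl⟩ := Nat.exists_eq_add_of_le' (not_lt.1 hk)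
      rw [C.recurrence_pow.2, D.recurrence_pow.2]
      refine Finset.sum_congr rfl fun i hi => ?_
      rw [ih _ (by have := Finset.mem_range.1 hi; omega)]

/-- Two graphs of the same order whose adjacency matrices satisfy the same quadratic equation
modulo the all-ones matrix are cospectral. -/
theorem cospectral_of_quadratic {V W : Type*} [Fintype V] [DecidableEq V] [Fintype W]
    [DecidableEq W] {Γ : SimpleGraph V} [DecidableRel Γ.Adj] {Δ : SimpleGraph W}
    [DecidableRel Δ.Adj] {a b c d : ℝ} (hcard : Fintype.card V = Fintype.card W)
    (hΓ : Γ.adjMatrix ℝ * Γ.adjMatrix ℝ =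
      a • Γ.adjMatrix ℝ + b • 1 + c • Matrix.of fun _ _ => 1)
    (hΔ : Δ.adjMatrix ℝ * Δ.adjMatrix ℝ =
      a • Δ.adjMatrix ℝ + b • 1 + c • Matrix.of fun _ _ => 1)
    (hΓ' : Γ.adjMatrix ℝ * (Matrix.of fun _ _ => 1) = d • Matrix.of fun _ _ => 1)
    (hΔ' : Δ.adjMatrix ℝ * (Matrix.of fun _ _ => 1) = d • Matrix.of fun _ _ => 1) :
    Cospectral Γ Δ := by
  intro k
  have h1 : closedWalks Γ k = ((Γ.adjMatrix ℝ) ^ k).trace := by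
    unfold closedWalks; congr!
  have h2 : closedWalks Δ k = ((Δ.adjMatrix ℝ) ^ k).trace := by
    unfold closedWalks; congr!
  -- The span of A, 1 and the all-ones matrix J is stable under multiplication by A, with the same
  -- structure constants for both graphs; the traces of A, 1 and J depend only on the order.
  have key : ∃ x y z : ℝ, (Γ.adjMatrix ℝ) ^ k =
      x • Γ.adjMatrix ℝ + y • 1 + z • Matrix.of (fun _ _ => 1) ∧ (Δ.adjMatrix ℝ) ^ k =
      x • Δ.adjMatrix ℝ + y • 1 + z • Matrix.of (fun _ _ => 1) := by
    clear h1 h2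
    induction k with
    | zero => exact ⟨0, 1, 0, by simp, by simp⟩
    | succ k ih =>
      obtain ⟨x, y, z, hx, hy⟩ := ih
      refine ⟨x * a + y, x * b, x * c + z * d, ?_, ?_⟩
      · rw [pow_succ', hx, mul_add, mul_add, mul_smul_comm, hΓ, mul_smul_comm, mul_one,
          mul_smul_comm, hΓ']
        module
      · rw [pow_succ', hy, mul_add, mul_add, mul_smul_comm, hΔ, mul_smul_comm, mul_one,
          mul_smul_comm, hΔ']
        module
  obtain ⟨x, y, z, hx, hy⟩ := key
  rw [h1, h2, hx, hy]
  simp only [Matrix.trace_add, Matrix.trace_smul, SimpleGraph.trace_adjMatrix, Matrix.trace_one,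
    hcard]
  simp [Matrix.trace, hcard]

/-! ### Cayley graphs of subgroups and the transfer to the whole group -/

/-- The graph is a Cayley graph of a subgroup of `G`, up to a labelling of the vertices by the
elements of this subgroup. -/
def IsCayleyOnSubgroup (G : Type*) [Group G] {ι : Type*} (Γ : SimpleGraph ι) : Prop :=
  ∃ (H : Subgroup G) (e : ι ≃ H) (S : Set G),
    ∀ u v, Γ.Adj u v ↔ (e u : G) * (e v : G)⁻¹ ∈ S

/-- A nonempty set closed under (a, b) ↦ ab⁻¹ is a subgroup, so an explicit division rule on labels
is all that is required. For concrete label types the condition on adjacency then becomes a finite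
check. -/
theorem IsCayleyOnSubgroup.of_coordinates {G ι : Type*} [Group G] [Nonempty ι]
    {Γ : SimpleGraph ι} (e : ι → G) (he : Function.Injective e) (d : ι → ι → ι)
    (hd : ∀ u v, e u * (e v)⁻¹ = e (d u v)) (T : Set ι) (hT : ∀ u v, Γ.Adj u v ↔ d u v ∈ T) :
    IsCayleyOnSubgroup G Γ := by
  have h1 : (1 : G) ∈ Set.range e := by
    obtain ⟨u⟩ := ‹Nonempty ι›
    exact ⟨d u u, by rw [← hd, mul_inv_cancel]⟩
  have hinv : ∀ g ∈ Set.range e, g⁻¹ ∈ Set.range e := by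
    rintro _ ⟨u, rfl⟩
    obtain ⟨o, ho⟩ := h1
    exact ⟨d o u, by rw [← hd, ho, one_mul]⟩
  let H : Subgroup G :=
    { carrier := Set.range e
      one_mem' := h1
      inv_mem' := fun {g} hg => hinv g hg
      mul_mem' := by
        rintro _ _ ⟨u, rfl⟩ hb
        obtain ⟨v, hv⟩ := hinv _ hb
        exact ⟨d u v, by rw [← hd, hv, inv_inv]⟩ }
  refine ⟨H, Equiv.ofInjective e he, e '' T, fun u v => ?_⟩
  rw [hT, Equiv.ofInjective_apply, Equiv.ofInjective_apply, hd, he.mem_set_image]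

theorem IsCayleyOnSubgroup.of_iso {G ι κ : Type*} [Group G] {Γ : SimpleGraph ι}
    {Δ : SimpleGraph κ} (h : IsCayleyOnSubgroup G Γ) (f : Δ ≃g Γ) : IsCayleyOnSubgroup G Δ := by
  obtain ⟨H, e, S, hS⟩ := h
  exact ⟨H, f.toEquiv.trans e, S, fun u v => by rw [← f.map_adj_iff, hS]; rfl⟩

/-- The connection set can be chosen inside the subgroup, symmetric and without the identity. -/
theorem IsCayleyOnSubgroup.exists_connectionSet {G ι : Type*} [Group G] {Γ : SimpleGraph ι}
    (h : IsCayleyOnSubgroup G Γ) : ∃ (H : Subgroup G) (e : ι ≃ H) (S : Set H),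
      IsConnectionSet S ∧ ∀ u v, Γ.Adj u v ↔ e u * (e v)⁻¹ ∈ S := by
  obtain ⟨H, e, S, hS⟩ := h
  refine ⟨H, e, {g | ∃ u v, Γ.Adj u v ∧ g = e u * (e v)⁻¹}, ⟨?_, ?_⟩, fun u v => ⟨?_, ?_⟩⟩
  · rintro ⟨u, v, huv, h⟩
    rw [eq_comm, mul_inv_eq_one, e.apply_eq_iff_eq] at h
    exact Γ.irrefl (h ▸ huv)
  · ext g
    constructor
    · rintro ⟨u, v, huv, h⟩
      exact ⟨v, u, huv.symm, by rw [← inv_inv g, h]; simp⟩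
    · rintro ⟨u, v, huv, rfl⟩
      exact ⟨v, u, huv.symm, by simp⟩
  · exact fun h => ⟨u, v, h, rfl⟩
  · rintro ⟨a, b, hab, h⟩
    rw [hS] at hab ⊢
    have := congrArg Subtype.val h
    push_cast at this
    rwa [this]

theorem IsCayleyOnSubgroup.isVertexTransitive {G ι : Type*} [Group G] {Γ : SimpleGraph ι}
    (h : IsCayleyOnSubgroup G Γ) : IsVertexTransitive Γ := by
  obtain ⟨H, e, S, hS⟩ := h
  intro u v
  refine ⟨⟨(e.trans (Equiv.mulRight ((e u)⁻¹ * e v))).trans e.symm, ?_⟩, ?_⟩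
  · intro a b
    rw [hS, hS]
    simp [mul_assoc]
  · simp

theorem isConnectionSet_image {G : Type*} [Group G] {H : Subgroup G} {S : Set H}
    (hS : IsConnectionSet S) : IsConnectionSet (Subtype.val '' S : Set G) := by
  refine ⟨?_, ?_⟩
  · rintro ⟨g, hg, h⟩
    rw [OneMemClass.coe_eq_one] at h
    exact hS.one_notMem (h ▸ hg)
  · have : (Subtype.val '' S : Set G) = H.subtype '' S := rfl
    rw [this, ← Set.image_inv, hS.inv_eq]

/-- Since ab⁻¹ ∈ S ⊆ H, edges stay inside the right cosets of H, and each of these carries a copy of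
Γ. Inverses of representatives of left cosets represent the right cosets. -/
theorem nonempty_iso_copies {G ι : Type*} [Group G] {H : Subgroup G} (e : ι ≃ H) {S : Set H}
    (hS : IsConnectionSet S) {Γ : SimpleGraph ι} (h : ∀ u v, Γ.Adj u v ↔ e u * (e v)⁻¹ ∈ S) :
    Nonempty (copies Γ (G ⧸ H) ≃g cayleyGraph _ (isConnectionSet_image hS)) := by
  let F : ι × (G ⧸ H) → G := fun a => e a.1 * (a.2.out)⁻¹
  have hF : Function.Bijective F := by
    constructor
    · rintro ⟨u, q⟩ ⟨v, r⟩ huv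
      simp only [F] at huv
      have hqr : q = r := by
        rw [← Quotient.out_eq' q, ← Quotient.out_eq' r, QuotientGroup.eq]
        have : q.out⁻¹ * r.out = (e u : G)⁻¹ * e v := by
          rw [eq_inv_mul_iff_mul_eq, ← mul_assoc, huv]; simp
        rw [this]
        exact H.mul_mem (H.inv_mem (e u).2) (e v).2
      subst hqr
      simpa using huv
    · intro g
      have hg : ((g⁻¹ : G) : G ⧸ H).out⁻¹ * g⁻¹ ∈ H := by
        rw [← QuotientGroup.eq, QuotientGroup.out_eq']
      refine ⟨(e.symm ⟨_, hg⟩⁻¹, ((g⁻¹ : G) : G ⧸ H)), ?_⟩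
      simp [F]
  refine ⟨⟨Equiv.ofBijective F hF, ?_⟩⟩
  rintro ⟨u, q⟩ ⟨v, r⟩
  change (e u * q.out⁻¹ : G) * (e v * r.out⁻¹ : G)⁻¹ ∈ Subtype.val '' S ↔ _
  rw [copies_adj, h]
  constructor
  · rintro ⟨s, hs, hsuv⟩
    have hqr : q = r := by
      rw [← Quotient.out_eq' q, ← Quotient.out_eq' r, QuotientGroup.eq]
      have : q.out⁻¹ * r.out = (e u : G)⁻¹ * s * e v := by rw [hsuv]; group
      rw [this]
      exact H.mul_mem (H.mul_mem (H.inv_mem (e u).2) s.2) (e v).2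
    subst hqr
    refine ⟨?_, rfl⟩
    convert hs
    ext
    rw [hsuv]
    push_cast
    group
  · rintro ⟨hs, hqr⟩
    simp only at hqr
    subst hqr
    refine ⟨_, hs, ?_⟩
    push_cast
    group

theorem card_quotient_ne_zero {G : Type*} [Group G] [Fintype G] (H : Subgroup G) :
    NeZero (Nat.card (G ⧸ H)) := ⟨Nat.card_pos.ne'⟩

/-- In a Cay-DS group, connected Cayley graphs of subgroups are determined by their spectra among
Cayley graphs. -/
theorem IsCayDSGroup.nonempty_iso {G : Type*} [Group G] [Fintype G] (hG : IsCayDSGroup G)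
    {ι : Type*} [Fintype ι] {Γ : SimpleGraph ι} (hΓ : IsCayleyOnSubgroup G Γ)
    {K : Type} [Group K] [Fintype K] {κ : Type*} [Fintype κ] {Δ : SimpleGraph κ}
    (hΔ : IsCayleyOnSubgroup K Δ) (hconn : Γ.Connected) (hspec : Cospectral Γ Δ) :
    Nonempty (Γ ≃g Δ) := by
  classical
  obtain ⟨H, e, S, hS, hadj⟩ := hΓ.exists_connectionSet
  obtain ⟨H', e', S', hS', hadj'⟩ := hΔ.exists_connectionSet
  obtain ⟨f⟩ := nonempty_iso_copies e hS hadj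
  have := card_quotient_ne_zero H
  have : Fintype (G ⧸ H) := Fintype.ofFinite _
  set m := Nat.card (G ⧸ H) with hm
  let M := Multiplicative (ZMod m)
  -- With trivial second component the connection set never leaves a coset of the first factor, so
  -- the graph on H' × C_m consists of m copies of Δ.
  let T : Set (H' × M) := {a | a.1 ∈ S' ∧ a.2 = 1}
  have hT : IsConnectionSet T := by
    refine ⟨fun h => hS'.one_notMem h.1, ?_⟩
    ext ⟨a, b⟩
    have : a⁻¹ ∈ S' ↔ a ∈ S' := by rw [← Set.mem_inv, hS'.inv_eq]
    simp [T, this]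
  have : Fintype H' := Fintype.ofFinite _
  let f' : copies Δ M ≃g cayleyGraph T hT :=
    ⟨e'.prodCongr (Equiv.refl M), by
      rintro ⟨a, b⟩ ⟨c, d⟩
      rw [copies_adj, hadj']
      change _ ∧ b * d⁻¹ = 1 ↔ _
      rw [mul_inv_eq_one]
      rfl⟩
  have hcard : Fintype.card (G ⧸ H) = Fintype.card M := by
    rw [Fintype.card_multiplicative, ZMod.card, hm, Nat.card_eq_fintype_card]
  have hc : Cospectral (cayleyGraph _ (isConnectionSet_image hS)) (cayleyGraph T hT) :=
    f.symm.cospectral.trans ((hspec.copies hcard).trans f'.cospectral)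
  obtain ⟨g⟩ := hG _ (isConnectionSet_image hS) _ T hT hc.adjSpectrum_eq
  exact nonempty_iso_of_copies hconn hspec.card_eq ((f.trans g).trans f'.symm)

/-- In a DS group, connected Cayley graphs of subgroups are determined by their spectra. -/
theorem IsDSGroup.nonempty_iso {G : Type*} [Group G] [Fintype G] (hG : IsDSGroup G)
    {ι : Type*} [Fintype ι] {Γ : SimpleGraph ι} (hΓ : IsCayleyOnSubgroup G Γ)
    {W : Type} [Fintype W] {Δ : SimpleGraph W} (hconn : Γ.Connected) (hspec : Cospectral Γ Δ) :
    Nonempty (Γ ≃g Δ) := by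
  classical
  obtain ⟨H, e, S, hS, hadj⟩ := hΓ.exists_connectionSet
  obtain ⟨f⟩ := nonempty_iso_copies e hS hadj
  have : Fintype (G ⧸ H) := Fintype.ofFinite _
  have hc := f.symm.cospectral.trans
    (hspec.copies (I := G ⧸ H) (J := Fin (Fintype.card (G ⧸ H))) (Fintype.card_fin _).symm)
  obtain ⟨g⟩ := hG _ (isConnectionSet_image hS) _ _ hc.adjSpectrum_eq
  exact nonempty_iso_of_copies hconn hspec.card_eq (f.trans g)

theorem connected_of_common_neighbor {V : Type*} [Nonempty V] {Γ : SimpleGraph V}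
    (h : ∀ u v, ∃ w, Γ.Adj u w ∧ Γ.Adj w v) : Γ.Connected := by
  refine ⟨fun u v => ?_⟩
  obtain ⟨w, h1, h2⟩ := h u v
  exact h1.reachable.trans h2.reachable

/-- The Cayley graph of an abelian group, written additively, with respect to the symmetric
closure of a set of nonzero elements. -/
def addCayleyGraph {A : Type*} [AddCommGroup A] (S : Finset A) : SimpleGraph A where
  Adj a b := a ≠ b ∧ (a - b ∈ S ∨ b - a ∈ S)
  symm := ⟨fun _ _ h => ⟨h.1.symm, h.2.symm⟩⟩
  loopless := ⟨fun _ h => h.1 rfl⟩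

instance {A : Type*} [AddCommGroup A] [DecidableEq A] (S : Finset A) :
    DecidableRel (addCayleyGraph S).Adj :=
  fun a b => inferInstanceAs (Decidable (a ≠ b ∧ (a - b ∈ S ∨ b - a ∈ S)))

theorem IsCayleyOnSubgroup.addCayleyGraph {G A : Type*} [Group G] [AddCommGroup A]
    (φ : Multiplicative A →* G) (hφ : Function.Injective φ) (S : Finset A) :
    IsCayleyOnSubgroup G (addCayleyGraph S) :=
  .of_coordinates (fun a => φ (.ofAdd a)) (hφ.comp Multiplicative.ofAdd.injective)
    (fun a b => a - b) (by simp [← div_eq_mul_inv]) {x | x ≠ 0 ∧ (x ∈ S ∨ -x ∈ S)} fun a b => by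
      simp [_root_.addCayleyGraph, sub_eq_zero]

theorem IsCayleyOnSubgroup.addCayleyGraph_self {A : Type*} [AddCommGroup A] (S : Finset A) :
    IsCayleyOnSubgroup (Multiplicative A) (_root_.addCayleyGraph S) :=
  .addCayleyGraph (MonoidHom.id _) Function.injective_id S

/-! ### The rook graph and the Shrikhande graph -/

/-- The rook graph `K₄ □ K₄`. -/
def rookGraph : SimpleGraph (ZMod 4 × ZMod 4) := addCayleyGraph {(1, 0), (2, 0), (0, 1), (0, 2)}

/-- The Shrikhande graph. -/
def shrikhandeGraph : SimpleGraph (ZMod 4 × ZMod 4) := addCayleyGraph {(1, 0), (0, 1), (1, 1)}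

instance : DecidableRel rookGraph.Adj := inferInstanceAs (DecidableRel (addCayleyGraph _).Adj)

instance : DecidableRel shrikhandeGraph.Adj :=
  inferInstanceAs (DecidableRel (addCayleyGraph _).Adj)

theorem rookGraph_adj : ∀ a b : ZMod 4 × ZMod 4, rookGraph.Adj a b ↔
    (a.1 = b.1 ∨ a.2 = b.2) ∧ ¬(a.1 = b.1 ∧ a.2 = b.2) := by
  decide +kernel

theorem rookGraph_common_neighbor : ∀ a b, ∃ c, rookGraph.Adj a c ∧ rookGraph.Adj c b := by
  decide +kernel

/-- This separates the two graphs, because the rows of the rook graph are 4-cliques. -/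
theorem shrikhandeGraph_no_clique : ∀ a b, shrikhandeGraph.Adj a b → ∀ c,
    shrikhandeGraph.Adj a c → shrikhandeGraph.Adj b c → ∀ d, shrikhandeGraph.Adj a d →
    shrikhandeGraph.Adj b d → ¬shrikhandeGraph.Adj c d := by
  decide +kernel

/-- The vectors of a table, indexed through a numbering of the vertices. -/
def tableVec {V : Type*} (idx : V → ℕ) (t : List (List ℤ)) (i : ℕ) (v : V) : ℤ :=
  (t.getD i []).getD (idx v) 0

/-- The eigenvalues are 6, 2 and -2, and the recurrence is read off from (x - 6)(x - 2)(x + 2). The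
Shrikhande graph has the same one. -/
def rookGraph_walkCertificate : WalkCertificate rookGraph 0 3 (fun i => [-24, 4, 6].getD i 0)
    (fun i => [1, 0, 6].getD i 0) where
  vec := tableVec (fun v => v.1.val * 4 + v.2.val)
    [[1, 0, 0, 0, 0, 0, 0, 0, 0, 0, 0, 0, 0, 0, 0, 0],
    [0, 1, 1, 1, 1, 0, 0, 0, 1, 0, 0, 0, 1, 0, 0, 0],
    [6, 2, 2, 2, 2, 2, 2, 2, 2, 2, 2, 2, 2, 2, 2, 2],
    [12, 16, 16, 16, 16, 12, 12, 12, 16, 12, 12, 12, 16, 12, 12, 12]]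
  vec_zero := by decide +kernel
  vec_succ := by decide +kernel
  recurrence := by decide +kernel
  closed := by decide +kernel

def shrikhandeGraph_walkCertificate : WalkCertificate shrikhandeGraph 0 3
    (fun i => [-24, 4, 6].getD i 0) (fun i => [1, 0, 6].getD i 0) where
  vec := tableVec (fun v => v.1.val * 4 + v.2.val)
    [[1, 0, 0, 0, 0, 0, 0, 0, 0, 0, 0, 0, 0, 0, 0, 0],
    [0, 1, 0, 1, 1, 1, 0, 0, 0, 0, 0, 0, 1, 0, 0, 1],
    [6, 2, 2, 2, 2, 2, 2, 2, 2, 2, 2, 2, 2, 2, 2, 2],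
    [12, 16, 12, 16, 16, 16, 12, 12, 12, 12, 12, 12, 16, 12, 12, 16]]
  vec_zero := by decide +kernel
  vec_succ := by decide +kernel
  recurrence := by decide +kernel
  closed := by decide +kernel

theorem cospectral_rookGraph_shrikhandeGraph : Cospectral rookGraph shrikhandeGraph :=
  rookGraph_walkCertificate.cospectral shrikhandeGraph_walkCertificate
    (IsCayleyOnSubgroup.addCayleyGraph_self _).isVertexTransitive
    (IsCayleyOnSubgroup.addCayleyGraph_self _).isVertexTransitive rfl

/-- A finite group with two subgroups of order `4n` in a subgroup of order `16n`, meeting in a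
subgroup of order `n`, has a Cayley graph cospectral to a blow-up of the Shrikhande graph. -/
theorem IsCayDSGroup.false_of_subgroups {G : Type*} [Group G] [Fintype G] (hG : IsCayDSGroup G)
    (n : ℕ) [NeZero n] (L H₁ H₂ : Subgroup G) (h₁ : H₁ ≤ L) (h₂ : H₂ ≤ L)
    (c₁ : Nat.card H₁ = 4 * n) (c₂ : Nat.card H₂ = 4 * n)
    (c : Nat.card (H₁ ⊓ H₂ : Subgroup G) = n) (cL : Nat.card L = 16 * n) : False := by
  classical
  have hn : 0 < n := Nat.pos_of_ne_zero (NeZero.ne n)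
  have index : ∀ H ≤ L, Nat.card H = 4 * n → Nonempty (L ⧸ H.subgroupOf L ≃ ZMod 4) := by
    intro H hH hc
    have hi : Nat.card (L ⧸ H.subgroupOf L) = 4 := by
      have := Subgroup.card_eq_card_quotient_mul_card_subgroup (H.subgroupOf L)
      rw [cL, Nat.card_congr (Subgroup.subgroupOfEquivOfLe hH).toEquiv, hc] at this
      have : 4 * n * Nat.card (L ⧸ H.subgroupOf L) = 4 * n * 4 := by linarith
      exact Nat.eq_of_mul_eq_mul_left (by omega) this
    exact Finite.card_eq.1 (by rw [hi, Nat.card_zmod])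
  obtain ⟨e₁⟩ := index H₁ h₁ c₁
  obtain ⟨e₂⟩ := index H₂ h₂ c₂
  -- The label of `u` is its pair of right cosets H₁u, H₂u, written as left cosets of u⁻¹.
  let π : L → ZMod 4 × ZMod 4 := fun u =>
    (e₁ ((u⁻¹ : L) : L ⧸ H₁.subgroupOf L), e₂ ((u⁻¹ : L) : L ⧸ H₂.subgroupOf L))
  have π₁ : ∀ u v, (π u).1 = (π v).1 ↔ (u * (v : G)⁻¹ : G) ∈ H₁ := by
    intro u v
    simp [π, QuotientGroup.eq, Subgroup.mem_subgroupOf]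
  have π₂ : ∀ u v, (π u).2 = (π v).2 ↔ (u * (v : G)⁻¹ : G) ∈ H₂ := by
    intro u v
    simp [π, QuotientGroup.eq, Subgroup.mem_subgroupOf]
  have fiber : ∀ u, Nat.card {v // π v = π u} = n := by
    intro u
    rw [← c]
    refine Nat.card_congr ⟨fun v => ⟨v.1 * (u : G)⁻¹, ?_, ?_⟩, fun g =>
      ⟨⟨g.1 * u, L.mul_mem (h₁ g.2.1) u.2⟩, ?_⟩, ?_, ?_⟩
    · exact (π₁ _ _).1 (congrArg Prod.fst v.2)
    · exact (π₂ _ _).1 (congrArg Prod.snd v.2)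
    · exact Prod.ext ((π₁ _ _).2 (by simpa using g.2.1)) ((π₂ _ _).2 (by simpa using g.2.2))
    · intro v; simp
    · intro g; simp
  have fiber_le : ∀ w, Nat.card {v // π v = w} ≤ n := by
    intro w
    by_cases hw : ∃ u, π u = w
    · obtain ⟨u, rfl⟩ := hw
      exact (fiber u).le
    · have : IsEmpty {v // π v = w} := ⟨fun v => hw ⟨v.1, v.2⟩⟩
      simp
  -- The 16 fibres have at most `n` elements each and 16n in total, so each has exactly `n`.
  have hsum : ∑ w, Nat.card {v // π v = w} = ∑ _w : ZMod 4 × ZMod 4, n := by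
    rw [← Nat.card_sigma, Nat.card_congr (Equiv.sigmaFiberEquiv π), cL]
    simp [ZMod.card]
  have hfib : ∀ w, Nat.card {v // π v = w} = n := fun w =>
    (Finset.sum_eq_sum_iff_of_le fun w _ => fiber_le w).1 hsum w (Finset.mem_univ w)
  have hsurj : Function.Surjective π := by
    intro w
    have : 0 < Nat.card {v // π v = w} := by rw [hfib]; exact hn
    obtain ⟨⟨v, hv⟩⟩ := (Nat.card_pos_iff.1 this).1
    exact ⟨v, hv⟩
  have hΓ : IsCayleyOnSubgroup G (rookGraph.comap π) := by
    refine ⟨L, Equiv.refl _, {g | (g ∈ H₁ ∨ g ∈ H₂) ∧ ¬(g ∈ H₁ ∧ g ∈ H₂)}, fun u v => ?_⟩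
    rw [SimpleGraph.comap_adj, rookGraph_adj, π₁, π₂]
    rfl
  have hΔ : IsCayleyOnSubgroup (Multiplicative ((ZMod 4 × ZMod 4) × ZMod n))
      (shrikhandeGraph.comap (Prod.fst : (ZMod 4 × ZMod 4) × ZMod n → _)) := by
    refine .of_coordinates Multiplicative.ofAdd Multiplicative.ofAdd.injective
      (fun a b => a - b) (by simp [← div_eq_mul_inv]) {x | shrikhandeGraph.Adj x.1 0} fun u v => ?_
    simp [shrikhandeGraph, addCayleyGraph, sub_eq_zero]
  have hspec : Cospectral (rookGraph.comap π)
      (shrikhandeGraph.comap (Prod.fst : (ZMod 4 × ZMod 4) × ZMod n → _)) := by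
    refine cospectral_rookGraph_shrikhandeGraph.comap n _ _ hfib fun w => ?_
    rw [Nat.card_congr (β := ZMod n) ⟨fun v => v.1.2, fun z => ⟨(w, z), rfl⟩, ?_, fun _ => rfl⟩,
      Nat.card_zmod]
    rintro ⟨⟨a, z⟩, rfl⟩
    rfl
  have hconn : (rookGraph.comap π).Connected := by
    refine connected_of_common_neighbor fun u v => ?_
    obtain ⟨w, hw⟩ := rookGraph_common_neighbor (π u) (π v)
    obtain ⟨x, rfl⟩ := hsurj w
    exact ⟨x, hw⟩
  obtain ⟨f⟩ := hG.nonempty_iso hΓ hΔ hconn hspec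
  choose σ hσ using hsurj
  have hf : ∀ a b, rookGraph.Adj a b → shrikhandeGraph.Adj (f (σ a)).1 (f (σ b)).1 := by
    intro a b hab
    have : (rookGraph.comap π).Adj (σ a) (σ b) := by rwa [SimpleGraph.comap_adj, hσ, hσ]
    exact f.map_adj_iff.2 this
  -- A row of the board, lifted to L, would give a 4-clique in the Shrikhande graph.
  exact shrikhandeGraph_no_clique _ _ (hf (0, 0) (0, 1) (by decide +kernel)) _
    (hf (0, 0) (0, 2) (by decide +kernel)) (hf (0, 1) (0, 2) (by decide +kernel)) _
    (hf (0, 0) (0, 3) (by decide +kernel)) (hf (0, 1) (0, 3) (by decide +kernel))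
    (hf (0, 2) (0, 3) (by decide +kernel))

/-! ### Groups of order 16 with an element of order 8 -/

/-- The homomorphism from `ℤ/n` sending `1` to an element of order dividing `n`. -/
def zmodPow {G : Type*} [Group G] (n : ℕ) [NeZero n] (a : G) (h : a ^ n = 1) :
    Multiplicative (ZMod n) →* G where
  toFun i := a ^ i.toAdd.val
  map_one' := by simp
  map_mul' i j := by
    rw [toAdd_mul, ZMod.val_add, ← pow_eq_pow_mod _ h, pow_add]

theorem zmodPow_natCast {G : Type*} [Group G] (n : ℕ) [NeZero n] (a : G) (h : a ^ n = 1)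
    (k : ℕ) : zmodPow n a h (.ofAdd k) = a ^ k := by
  change a ^ (k : ZMod n).val = a ^ k
  rw [ZMod.val_natCast, ← pow_eq_pow_mod _ h]

theorem zmodPow_one {G : Type*} [Group G] (n : ℕ) [NeZero n] (a : G) (h : a ^ n = 1) :
    zmodPow n a h (.ofAdd 1) = a := by
  simpa using zmodPow_natCast n a h 1

theorem zmodPow_injective {G : Type*} [Group G] (n : ℕ) [NeZero n] (a : G) (h : a ^ n = 1)
    (ho : orderOf a = n) : Function.Injective (zmodPow n a h) := by
  intro i j hij
  have := pow_injOn_Iio_orderOf (x := a) (by simpa [ho] using ZMod.val_lt i.toAdd)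
    (by simpa [ho] using ZMod.val_lt j.toAdd) hij
  exact Multiplicative.toAdd.injective (ZMod.val_injective n this)

theorem exists_zmodPow_eq {G : Type*} [Group G] [Finite G] (n : ℕ) [NeZero n] {a g : G}
    (h : a ^ n = 1) (hg : g ∈ Subgroup.zpowers a) : ∃ i, zmodPow n a h (.ofAdd i) = g := by
  obtain ⟨k, rfl⟩ := (mem_powers_iff_mem_zpowers (x := a)).2 hg
  exact ⟨k, zmodPow_natCast n a h k⟩

theorem zmodPow_mem_zpowers {G : Type*} [Group G] (n : ℕ) [NeZero n] (a : G) (h : a ^ n = 1)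
    (i : Multiplicative (ZMod n)) : zmodPow n a h i ∈ Subgroup.zpowers a :=
  Subgroup.npow_mem_zpowers _ _

theorem conj_zmodPow {G : Type*} [Group G] (n : ℕ) [NeZero n] {a x : G} (h : a ^ n = 1)
    {r : ZMod n} (hr : x * a * x⁻¹ = zmodPow n a h (.ofAdd r)) (i : ZMod n) :
    x * zmodPow n a h (.ofAdd i) * x⁻¹ = zmodPow n a h (.ofAdd (r * i)) := by
  obtain ⟨k, rfl⟩ : ∃ k : ℕ, (k : ZMod n) = i := ⟨i.val, ZMod.natCast_zmod_val i⟩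
  rw [zmodPow_natCast, ← conj_pow, hr, ← map_pow, ← ofAdd_nsmul, nsmul_eq_mul, mul_comm]

/-- Division in the group `⟨a, x | a⁸ = 1, xax⁻¹ = aʳ, x² = aᵗ⟩`, in terms of the normal form
`aⁱxʲ`, provided that `r² = 1`. -/
def metacyclicDiv (r t : ZMod 8) (u v : ZMod 8 × ZMod 2) : ZMod 8 × ZMod 2 :=
  if u.2 = v.2 then (u.1 - v.1, 0) else
    if u.2 = 0 then (u.1 - r * v.1 - t, 1) else (u.1 - r * v.1, 1)

/-- From xaⁱ = aʳⁱx, r² = 1 and x⁻¹ = a⁻ᵗx, the elements aⁱxʲ with j < 2 are closed under division;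
they are distinct because x lies outside ⟨a⟩. -/
theorem IsCayleyOnSubgroup.of_metacyclic {G : Type*} [Group G] {a x : G} (h : a ^ 8 = 1)
    (ho : orderOf a = 8) (hx : x ∉ Subgroup.zpowers a) {r t : ZMod 8}
    (hr : x * a * x⁻¹ = zmodPow 8 a h (.ofAdd r)) (ht : x ^ 2 = zmodPow 8 a h (.ofAdd t))
    (hrr : r * r = 1) {Γ : SimpleGraph (ZMod 8 × ZMod 2)} (T : Finset (ZMod 8 × ZMod 2))
    (hT : ∀ u v, Γ.Adj u v ↔ metacyclicDiv r t u v ∈ T) : IsCayleyOnSubgroup G Γ := by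
  obtain ⟨P, hP⟩ : ∃ P : ZMod 8 → G, ∀ i, P i = zmodPow 8 a h (.ofAdd i) := ⟨_, fun _ => rfl⟩
  have Pinj : Function.Injective P := by
    intro i j hij
    rw [hP, hP] at hij
    exact Multiplicative.ofAdd.injective (zmodPow_injective 8 a h ho hij)
  have Padd : ∀ i j, P (i + j) = P i * P j := by
    intro i j; rw [hP, hP, hP, ofAdd_add, map_mul]
  have Pneg : ∀ j, (P j)⁻¹ = P (-j) := by
    intro j; rw [hP, hP, ofAdd_neg, map_inv]
  have Pmem : ∀ i, P i ∈ Subgroup.zpowers a := fun i => by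
    rw [hP]; exact zmodPow_mem_zpowers 8 a h _
  have Pconj : ∀ i, x * P i * x⁻¹ = P (r * i) := fun i => by
    rw [hP, hP]; exact conj_zmodPow 8 h hr i
  have Pconj' : ∀ i, x * P i = P (r * i) * x := fun i => by rw [← Pconj]; group
  have Pconj_inv : ∀ i, x⁻¹ * P i = P (r * i) * x⁻¹ := fun i => by
    have := Pconj (r * i)
    rw [← mul_assoc, hrr, one_mul] at this
    rw [← this]; group
  have hxi : x⁻¹ = P (-t) * x := by
    rw [← Pneg, eq_inv_mul_iff_mul_eq, hP, ← ht, pow_two, mul_inv_cancel_right]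
  have two : ∀ j : ZMod 2, j = 0 ∨ j = 1 := by decide
  refine .of_coordinates (fun u => P u.1 * if u.2 = 0 then 1 else x) ?_ (metacyclicDiv r t) ?_
    (T : Set _) hT
  · rintro ⟨i, j⟩ ⟨i', j'⟩ he
    rcases two j with rfl | rfl <;> rcases two j' with rfl | rfl <;>
      simp only [if_true, one_ne_zero, if_false, mul_one, mul_left_inj] at he
    · rw [Pinj he]
    · exact absurd ((Subgroup.mul_mem_cancel_left _ (Pmem i')).1 (he ▸ Pmem i)) hx
    · exact absurd ((Subgroup.mul_mem_cancel_left _ (Pmem i)).1 (he ▸ Pmem i')) hx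
    · rw [Pinj he]
  · rintro ⟨i, j⟩ ⟨i', j'⟩
    rcases two j with rfl | rfl <;> rcases two j' with rfl | rfl <;>
      simp only [metacyclicDiv, if_true, one_ne_zero, zero_ne_one, if_false, mul_one]
    · rw [sub_eq_add_neg, Padd, Pneg]
    · rw [mul_inv_rev, Pneg, Pconj_inv, hxi, sub_eq_add_neg, sub_eq_add_neg, Padd, Padd,
        mul_neg, mul_assoc, mul_assoc]
    · rw [Pneg, mul_assoc, Pconj', mul_neg, sub_eq_add_neg, Padd, mul_assoc]
    · rw [mul_inv_rev, Pneg, sub_eq_add_neg, Padd]; group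

theorem nonempty_iso_comap {V W : Type*} [Fintype V] [Fintype W] (Δ : SimpleGraph W) (f : V → W)
    (hf : Function.Injective f) (hcard : Fintype.card V = Fintype.card W) :
    Nonempty (Δ ≃g Δ.comap f) :=
  ⟨SimpleGraph.Iso.symm ⟨Equiv.ofBijective f
    ((Fintype.bijective_iff_injective_and_card f).2 ⟨hf, hcard⟩), Iff.rfl⟩⟩

theorem connected_of_walk_three {V : Type*} [Nonempty V] {Γ : SimpleGraph V}
    (h : ∀ u v, ∃ w, Γ.Adj u w ∧ ∃ x, Γ.Adj w x ∧ Γ.Adj x v) : Γ.Connected := by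
  refine ⟨fun u v => ?_⟩
  obtain ⟨w, h1, x, h2, h3⟩ := h u v
  exact h1.reachable.trans (h2.reachable.trans h3.reachable)

/-- Any two distinct vertices have fewer than `n` common neighbours. -/
def CodegreeLT {V : Type*} (Γ : SimpleGraph V) (n : ℕ) : Prop :=
  ∀ u v, u ≠ v → Nat.card {w // Γ.Adj u w ∧ Γ.Adj v w} < n

theorem CodegreeLT.of_iso {V W : Type*} {Γ : SimpleGraph V} {Δ : SimpleGraph W} {n : ℕ}
    (h : CodegreeLT Δ n) (f : Γ ≃g Δ) : CodegreeLT Γ n := by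
  intro u v huv
  rw [Nat.card_congr (f.toEquiv.subtypeEquiv (q := fun w => Δ.Adj (f u) w ∧ Δ.Adj (f v) w)
    fun w => (and_congr f.map_adj_iff f.map_adj_iff).symm)]
  exact h _ _ (f.injective.ne huv)

/-- The lexicographic product of the Wagner graph with an edge, as a circulant graph. -/
def wagnerBlowup : SimpleGraph (ZMod 16) := addCayleyGraph {3, 4, 5, 8}

/-- A Cayley graph of `C₈ × C₂`, cospectral to `wagnerBlowup`. -/
def wagnerMate : SimpleGraph (ZMod 8 × ZMod 2) := addCayleyGraph {(1, 0), (1, 1), (2, 0), (4, 0)}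

instance : DecidableRel wagnerBlowup.Adj := inferInstanceAs (DecidableRel (addCayleyGraph _).Adj)

instance : DecidableRel wagnerMate.Adj := inferInstanceAs (DecidableRel (addCayleyGraph _).Adj)

/-- An eigenvalue λ of the Wagner graph contributes 2λ + 1, and the new eigenvalue is -1. This gives
7, 3, -1 and -1 ± 2√2, the roots of (x - 7)(x - 3)(x + 1)(x² + 2x - 7). -/
def wagnerBlowup_walkCertificate : WalkCertificate wagnerBlowup 0 5
    (fun i => [147, 35, -106, 14, 7].getD i 0) (fun i => [1, 0, 7, 18, 189].getD i 0) where
  vec := tableVec ZMod.val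
    [[1, 0, 0, 0, 0, 0, 0, 0, 0, 0, 0, 0, 0, 0, 0, 0],
    [0, 0, 0, 1, 1, 1, 0, 0, 1, 0, 0, 1, 1, 1, 0, 0],
    [7, 4, 2, 2, 2, 2, 2, 4, 6, 4, 2, 2, 2, 2, 2, 4],
    [18, 16, 18, 27, 31, 27, 18, 16, 19, 16, 18, 27, 31, 27, 18, 16],
    [189, 168, 140, 132, 132, 132, 140, 168, 188, 168, 140, 132, 132, 132, 140, 168],
    [980, 976, 1020, 1125, 1181, 1125, 1020, 976, 981, 976, 1020, 1125, 1181, 1125, 1020, 976]]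
  vec_zero := by decide +kernel
  vec_succ := by decide +kernel
  recurrence := by decide +kernel
  closed := by decide +kernel

def wagnerMate_walkCertificate : WalkCertificate wagnerMate 0 5
    (fun i => [147, 35, -106, 14, 7].getD i 0) (fun i => [1, 0, 7, 18, 189].getD i 0) where
  vec := tableVec (fun v => v.1.val * 2 + v.2.val)
    [[1, 0, 0, 0, 0, 0, 0, 0, 0, 0, 0, 0, 0, 0, 0, 0],
    [0, 0, 1, 1, 1, 0, 0, 0, 1, 0, 0, 0, 1, 0, 1, 1],
    [7, 4, 2, 2, 4, 2, 4, 4, 2, 0, 4, 4, 4, 2, 2, 2],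
    [18, 12, 27, 27, 25, 18, 16, 16, 31, 24, 16, 16, 25, 18, 27, 27],
    [189, 168, 132, 132, 160, 140, 168, 168, 132, 112, 168, 168, 160, 140, 132, 132],
    [980, 920, 1125, 1125, 1081, 1020, 976, 976, 1181, 1120, 976, 976, 1081, 1020, 1125, 1125]]
  vec_zero := by decide +kernel
  vec_succ := by decide +kernel
  recurrence := by decide +kernel
  closed := by decide +kernel

theorem cospectral_wagnerBlowup_wagnerMate : Cospectral wagnerBlowup wagnerMate :=
  wagnerBlowup_walkCertificate.cospectral wagnerMate_walkCertificate
    (IsCayleyOnSubgroup.addCayleyGraph_self _).isVertexTransitive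
    (IsCayleyOnSubgroup.addCayleyGraph_self _).isVertexTransitive rfl

theorem not_nonempty_iso_wagnerBlowup_wagnerMate : ¬Nonempty (wagnerBlowup ≃g wagnerMate) := by
  rintro ⟨f⟩
  have h1 : CodegreeLT wagnerMate 6 := by
    intro u v
    rw [Nat.card_eq_fintype_card]
    revert u v
    decide +kernel
  -- The vertices 0 and 8 are adjacent twins in a graph of valency 7, so they share six neighbours.
  have h2 := h1.of_iso f 0 8 (by decide +kernel)
  rw [Nat.card_eq_fintype_card] at h2
  revert h2
  decide +kernel

theorem wagnerBlowup_connected : wagnerBlowup.Connected :=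
  connected_of_common_neighbor (by decide +kernel)

theorem wagnerMate_connected : wagnerMate.Connected :=
  connected_of_walk_three (by decide +kernel)

/-- A description of `wagnerBlowup` as a Cayley graph of the groups `D₁₆`, `SD₁₆`, `Q₁₆`. -/
def dihedralWagnerBlowup : SimpleGraph (ZMod 8 × ZMod 2) :=
  wagnerBlowup.comap fun v =>
    [0, 3, 6, 5, 4, 7, 2, 1, 8, 11, 14, 13, 12, 15, 10, 9].getD (v.1.val * 2 + v.2.val) 0

instance : DecidableRel dihedralWagnerBlowup.Adj :=
  fun _ _ => inferInstanceAs (Decidable (wagnerBlowup.Adj _ _))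

/-- A description of the rook graph as a Cayley graph of the modular group of order 16. -/
def modularRookGraph : SimpleGraph (ZMod 8 × ZMod 2) :=
  rookGraph.comap fun v =>
    [(0, 0), (0, 1), (0, 2), (0, 3), (1, 2), (1, 3), (1, 1), (1, 0), (2, 1), (2, 0), (2, 3), (2, 2),
      (3, 3), (3, 2), (3, 0), (3, 1)].getD (v.1.val * 2 + v.2.val) (0, 0)

instance : DecidableRel modularRookGraph.Adj :=
  fun _ _ => inferInstanceAs (Decidable (rookGraph.Adj _ _))

theorem rookGraph_connected : rookGraph.Connected :=
  connected_of_common_neighbor rookGraph_common_neighbor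

theorem not_nonempty_iso_rookGraph_shrikhandeGraph :
    ¬Nonempty (rookGraph ≃g shrikhandeGraph) := by
  rintro ⟨f⟩
  have hf : ∀ a b, rookGraph.Adj a b → shrikhandeGraph.Adj (f a) (f b) :=
    fun a b h => f.map_adj_iff.2 h
  exact shrikhandeGraph_no_clique _ _ (hf (0, 0) (0, 1) (by decide +kernel)) _
    (hf (0, 0) (0, 2) (by decide +kernel)) (hf (0, 1) (0, 2) (by decide +kernel)) _
    (hf (0, 0) (0, 3) (by decide +kernel)) (hf (0, 1) (0, 3) (by decide +kernel))
    (hf (0, 2) (0, 3) (by decide +kernel))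

theorem IsCayDSGroup.not_rookGraph {G : Type*} [Group G] [Fintype G] (hG : IsCayDSGroup G) :
    ¬IsCayleyOnSubgroup G rookGraph := fun h =>
  not_nonempty_iso_rookGraph_shrikhandeGraph (hG.nonempty_iso h
    (IsCayleyOnSubgroup.addCayleyGraph_self _) rookGraph_connected
    cospectral_rookGraph_shrikhandeGraph)

theorem IsCayDSGroup.not_wagnerBlowup {G : Type*} [Group G] [Fintype G] (hG : IsCayDSGroup G) :
    ¬IsCayleyOnSubgroup G wagnerBlowup := fun h =>
  not_nonempty_iso_wagnerBlowup_wagnerMate (hG.nonempty_iso h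
    (IsCayleyOnSubgroup.addCayleyGraph_self _) wagnerBlowup_connected
    cospectral_wagnerBlowup_wagnerMate)

theorem IsCayDSGroup.not_wagnerMate {G : Type*} [Group G] [Fintype G] (hG : IsCayDSGroup G) :
    ¬IsCayleyOnSubgroup G wagnerMate := fun h =>
  not_nonempty_iso_wagnerBlowup_wagnerMate ((hG.nonempty_iso h
    (IsCayleyOnSubgroup.addCayleyGraph_self _) wagnerMate_connected
    cospectral_wagnerBlowup_wagnerMate.symm).map SimpleGraph.Iso.symm)

/-- By Sylow, ⟨a⟩ has index two in some subgroup M of order 16; it is normal there and contains all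
squares. Any element of M outside ⟨a⟩ will do. -/
theorem exists_zpowers_normalized {G : Type*} [Group G] [Finite G] {a : G} (h8 : orderOf a = 8)
    (h16 : 16 ∣ Nat.card G) : ∃ x ∉ Subgroup.zpowers a,
      x * a * x⁻¹ ∈ Subgroup.zpowers a ∧ x ^ 2 ∈ Subgroup.zpowers a := by
  have : Fact (Nat.Prime 2) := ⟨Nat.prime_two⟩
  obtain ⟨M, hM, haM⟩ := Sylow.exists_subgroup_card_pow_succ (p := 2) (n := 3) (G := G)
    (by simpa using h16) (H := Subgroup.zpowers a) (by rw [Nat.card_zpowers, h8]; rfl)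
  set A := (Subgroup.zpowers a).subgroupOf M with hA
  have hidx : A.index = 2 := by
    have h1 := A.card_mul_index
    rw [Nat.card_congr (Subgroup.subgroupOfEquivOfLe haM).toEquiv, Nat.card_zpowers, h8, hM] at h1
    omega
  have hnorm : A.Normal := Subgroup.normal_of_index_eq_two hidx
  obtain ⟨x, hx⟩ : ∃ x, x ∉ A := by
    by_contra! hall
    rw [(Subgroup.eq_top_iff' A).2 hall, Subgroup.index_top] at hidx
    omega
  refine ⟨x, hx, ?_, ?_⟩
  · exact hnorm.conj_mem ⟨a, haM (Subgroup.mem_zpowers a)⟩ (Subgroup.mem_zpowers a) x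
  · exact Subgroup.sq_mem_of_index_two hidx x

/-- Write xax⁻¹ = aʳ and x² = aᵗ, with exponents modulo 8. Up to a change of x the group ⟨a, x⟩ is
C₈ × C₂, the modular group, C₁₆, or one of the semidihedral, dihedral and generalized quaternion
groups. The first has `wagnerMate` as a Cayley graph, the second has the rook graph, and all the
others have `wagnerBlowup`. -/
theorem IsCayDSGroup.orderOf_ne_eight {G : Type*} [Group G] [Fintype G] (hG : IsCayDSGroup G)
    (h16 : 16 ∣ Nat.card G) (a : G) : orderOf a ≠ 8 := by
  intro h8
  have ha : a ^ 8 = 1 := by rw [← h8, pow_orderOf_eq_one]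
  obtain ⟨x, hx, hxa, hx2⟩ := exists_zpowers_normalized h8 h16
  obtain ⟨r, hr⟩ := exists_zmodPow_eq 8 ha hxa
  obtain ⟨t, ht⟩ := exists_zmodPow_eq 8 ha hx2
  set P := zmodPow 8 a ha with hP
  have Pinj : Function.Injective P := zmodPow_injective 8 a ha h8
  have Pconj : ∀ i, x * P (.ofAdd i) * x⁻¹ = P (.ofAdd (r * i)) := conj_zmodPow 8 ha hr.symm
  have hrt : r * t = t := by
    have := Pconj t
    rw [ht] at this
    exact Multiplicative.ofAdd.injective (Pinj (by rw [← this, ht]; group))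
  have hr4 : r * 4 ≠ 0 := by
    intro h
    have := Pconj 4
    rw [h, ofAdd_zero, map_one, conj_eq_one_iff, map_eq_one_iff _ Pinj] at this
    exact absurd this (by decide)
  -- `hrt` holds because x commutes with x², and `hr4` because a⁴ ≠ 1. The exponent r is then 1, 3,
  -- 5 or 7, and t matters only modulo s + rs.
  have cases : ∀ r t : ZMod 8, r * t = t → r * 4 ≠ 0 → (∃ s, t = s + r * s) ∧ r * r = 1 ∧
      (r = 1 ∨ r = 5) ∨ r = 1 ∧ (∃ s, t = s + r * s + 1) ∨
      ((r, t) = (3, 0) ∨ (r, t) = (3, 4) ∨ (r, t) = (7, 0) ∨ (r, t) = (7, 4)) := by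
    decide +kernel
  -- Replacing x by a⁻ˢx keeps r and lowers t by s + rs.
  have shift : ∀ s c, t = s + r * s + c → P (.ofAdd (-s)) * x ∉ Subgroup.zpowers a ∧
      P (.ofAdd (-s)) * x * a * (P (.ofAdd (-s)) * x)⁻¹ = P (.ofAdd r) ∧
      (P (.ofAdd (-s)) * x) ^ 2 = P (.ofAdd c) := by
    intro s c hs
    refine ⟨fun h => hx ?_, ?_, ?_⟩
    · exact (Subgroup.mul_mem_cancel_left _ (zmodPow_mem_zpowers 8 a ha _)).1 h
    · rw [show P (.ofAdd (-s)) * x * a * (P (.ofAdd (-s)) * x)⁻¹ =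
        P (.ofAdd (-s)) * (x * a * x⁻¹) * (P (.ofAdd (-s)))⁻¹ by group, ← hr, ← map_mul,
        mul_comm, map_mul, mul_inv_cancel_right]
    · rw [show (P (.ofAdd (-s)) * x) ^ 2 = P (.ofAdd (-s)) * (x * P (.ofAdd (-s)) * x⁻¹) * x ^ 2 by
        rw [pow_two, pow_two]; group, Pconj, ← ht, ← map_mul, ← map_mul, ← ofAdd_add, ← ofAdd_add,
        hs]
      congr 2
      ring
  rcases cases r t hrt hr4 with ⟨⟨s, hs⟩, hrr, hr15⟩ | ⟨rfl, s, hs⟩ | hcases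
  · obtain ⟨h1, h2, h3⟩ := shift s 0 (by rw [hs, add_zero])
    rcases hr15 with rfl | rfl
    · exact hG.not_wagnerMate (.of_metacyclic ha h8 h1 h2 h3 hrr
        {(1, 0), (7, 0), (1, 1), (7, 1), (2, 0), (6, 0), (4, 0)} (by decide +kernel))
    · have hm : IsCayleyOnSubgroup G modularRookGraph := .of_metacyclic ha h8 h1 h2 h3 hrr
        {(0, 1), (1, 0), (1, 1), (3, 1), (4, 1), (7, 0)} (by decide +kernel)
      obtain ⟨f⟩ : Nonempty (rookGraph ≃g modularRookGraph) :=
        nonempty_iso_comap _ _ (by decide +kernel) rfl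
      exact hG.not_rookGraph (hm.of_iso f)
  · obtain ⟨h1, h2, h3⟩ := shift s 1 hs
    set y := P (.ofAdd (-s)) * x
    rw [hP, zmodPow_one] at h3
    -- Here r = 1 and y² = a, so y generates C₁₆.
    have hy : orderOf y = 2 ^ (3 + 1) := by
      refine orderOf_eq_prime_pow ?_ ?_
      · rw [show (2 : ℕ) ^ 3 = 2 * 4 from rfl, pow_mul, h3]
        intro h
        have := orderOf_dvd_of_pow_eq_one h
        rw [h8] at this
        omega
      · rw [show (2 : ℕ) ^ (3 + 1) = 2 * 8 from rfl, pow_mul, h3, ha]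
    exact hG.not_wagnerBlowup (.addCayleyGraph
      (zmodPow 16 y (orderOf_dvd_iff_pow_eq_one.1 (by rw [hy]; rfl)))
      (zmodPow_injective 16 y _ hy) _)
  · have hrr : r * r = 1 := by
      rcases hcases with h | h | h | h <;> obtain ⟨rfl, rfl⟩ := Prod.mk.inj h <;> rfl
    have hm : IsCayleyOnSubgroup G dihedralWagnerBlowup := by
      refine .of_metacyclic ha h8 hx hr.symm ht.symm hrr
        {(2, 0), (4, 0), (6, 0), (0, 1), (1, 1), (4, 1), (5, 1)} ?_
      rcases hcases with h | h | h | h <;> obtain ⟨rfl, rfl⟩ := Prod.mk.inj h <;> decide +kernel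
    obtain ⟨f⟩ : Nonempty (wagnerBlowup ≃g dihedralWagnerBlowup) :=
      nonempty_iso_comap _ _ (by decide +kernel) rfl
    exact hG.not_wagnerBlowup (hm.of_iso f)

/-! ### Groups of order 32 and exponent dividing 4 -/

theorem exists_notMem_of_card_lt {G : Type*} [Finite G] (s : Finset G) (h : s.card < Nat.card G) :
    ∃ x, x ∉ s := by
  by_contra! hall
  have := Fintype.ofFinite G
  rw [Finset.eq_univ_of_forall hall, Finset.card_univ, Nat.card_eq_fintype_card] at h
  exact lt_irrefl _ h

/-- The subgroup generated by two commuting involutions. -/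
def kleinSubgroup {G : Type*} [Group G] (x y : G) (hx : x * x = 1) (hy : y * y = 1)
    (h : Commute x y) : Subgroup G where
  carrier := {1, x, y, x * y}
  one_mem' := by simp
  mul_mem' := by
    have h' : y * x = x * y := h.eq.symm
    have hx' : ∀ z, x * (x * z) = z := fun z => by rw [← mul_assoc, hx, one_mul]
    have hy' : y * (x * y) = x := by rw [← mul_assoc, h', mul_assoc, hy, mul_one]
    rintro a b (rfl | rfl | rfl | rfl) (rfl | rfl | rfl | rfl) <;>
      simp [mul_assoc, hx, hy, hx', hy', h']
  inv_mem' := by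
    have hx' : x⁻¹ = x := inv_eq_of_mul_eq_one_left hx
    have hy' : y⁻¹ = y := inv_eq_of_mul_eq_one_left hy
    rintro a (rfl | rfl | rfl | rfl) <;> simp [hx', hy', h.eq]

theorem mem_kleinSubgroup {G : Type*} [Group G] {x y : G} {hx : x * x = 1} {hy : y * y = 1}
    {h : Commute x y} {g : G} : g ∈ kleinSubgroup x y hx hy h ↔ g = 1 ∨ g = x ∨ g = y ∨ g = x * y :=
  Iff.rfl

theorem card_kleinSubgroup {G : Type*} [Group G] {x y : G} {hx : x * x = 1} {hy : y * y = 1}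
    {h : Commute x y} (hx1 : x ≠ 1) (hy1 : y ≠ 1) (hxy : x ≠ y) :
    Nat.card (kleinSubgroup x y hx hy h) = 4 := by
  classical
  have : ((kleinSubgroup x y hx hy h : Subgroup G) : Set G) = ({1, x, y, x * y} : Finset G) := by
    ext g
    simp [mem_kleinSubgroup]
  rw [← SetLike.coe_sort_coe, this, Nat.card_coe_set_eq, Set.ncard_coe_finset]
  have : x * y ≠ 1 := fun h => hxy (by rw [mul_eq_one_iff_eq_inv.1 h, inv_eq_of_mul_eq_one_left hy])
  rw [Finset.card_insert_of_notMem, Finset.card_insert_of_notMem, Finset.card_insert_of_notMem,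
    Finset.card_singleton]
  · simp [hx1]
  · simp [hxy, hy1]
  · simp [hx1.symm, hy1.symm, this.symm]

/-- A four-dimensional space over 𝔽₂ is the sum of two complementary planes. After the plane U,
choose c outside U and d outside U ∪ cU. -/
theorem exists_klein_complements {E : Type*} [CommGroup E] [Finite E] (hE : Nat.card E = 16)
    (h2 : ∀ x : E, x * x = 1) :
    ∃ U V : Subgroup E, Nat.card U = 4 ∧ Nat.card V = 4 ∧ U ⊓ V = ⊥ := by
  classical
  obtain ⟨a, ha⟩ := exists_notMem_of_card_lt ({1} : Finset E) (by rw [hE]; simp)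
  obtain ⟨b, hb⟩ := exists_notMem_of_card_lt ({1, a} : Finset E)
    (by rw [hE]; exact Finset.card_le_two.trans_lt (by norm_num))
  simp only [Finset.mem_insert, Finset.mem_singleton, not_or] at ha hb
  set U := kleinSubgroup a b (h2 a) (h2 b) (Commute.all a b)
  have hU : ∀ g, g ∈ U ↔ g ∈ ({1, a, b, a * b} : Finset E) := fun g => by
    rw [mem_kleinSubgroup]; simp
  have hc : ({1, a, b, a * b} : Finset E).card ≤ 4 := Finset.card_le_four
  obtain ⟨c, hcU⟩ := exists_notMem_of_card_lt ({1, a, b, a * b} : Finset E) (by omega)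
  obtain ⟨d, hd⟩ := exists_notMem_of_card_lt
    (({1, a, b, a * b} : Finset E) ∪ ({1, a, b, a * b} : Finset E).image (c * ·)) (by
      have := Finset.card_union_le ({1, a, b, a * b} : Finset E)
        (({1, a, b, a * b} : Finset E).image (c * ·))
      have := Finset.card_image_le (s := ({1, a, b, a * b} : Finset E)) (f := (c * ·))
      omega)
  rw [Finset.mem_union, not_or, Finset.mem_image, ← hU] at hd
  rw [← hU] at hcU
  obtain ⟨hdU, hd⟩ := hd
  have hd' : ∀ u ∈ U, c * u ≠ d := fun u hu h => hd ⟨u, (hU u).1 hu, h⟩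
  refine ⟨U, kleinSubgroup c d (h2 c) (h2 d) (Commute.all c d),
    card_kleinSubgroup ha hb.1 (Ne.symm hb.2), card_kleinSubgroup ?_ ?_ ?_, ?_⟩
  · rintro rfl; exact hcU U.one_mem
  · rintro rfl; exact hdU U.one_mem
  · rintro rfl; exact hd' 1 U.one_mem (mul_one c)
  · rw [eq_bot_iff]
    rintro g ⟨hg, rfl | rfl | rfl | rfl⟩
    · exact Subgroup.mem_bot.2 rfl
    · exact absurd hg hcU
    · exact absurd hg hdU
    · exact absurd (by rw [← mul_assoc, h2, one_mul]) (hd' _ hg)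

/-- A subgroup of order 8 all of whose elements are involutions contains a Klein four-group
avoiding a given nontrivial element. -/
theorem exists_klein_avoiding {G : Type*} [Group G] [Finite G] (D : Subgroup G)
    (hD : Nat.card D = 8) (h2 : ∀ x ∈ D, x * x = 1) (k : G) (hk : k ≠ 1) :
    ∃ B ≤ D, Nat.card B = 4 ∧ k ∉ B := by
  classical
  have hcomm : ∀ x ∈ D, ∀ y ∈ D, Commute x y := by
    intro x hx y hy
    have := h2 _ (D.mul_mem hx hy)
    rw [mul_eq_one_iff_eq_inv, mul_inv_rev, inv_eq_of_mul_eq_one_left (h2 x hx),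
      inv_eq_of_mul_eq_one_left (h2 y hy)] at this
    exact this
  have key : ∀ s : Finset G, s.card ≤ 4 → ∃ x ∈ D, x ∉ s := by
    intro s hs
    obtain ⟨x, hx⟩ := exists_notMem_of_card_lt
      (s.preimage ((↑) : D → G) Subtype.val_injective.injOn)
      (by
        rw [hD]
        refine (Finset.card_le_card_of_injOn Subtype.val (fun x hx => ?_)
          Subtype.val_injective.injOn).trans_lt (hs.trans_lt (by norm_num))
        simpa using hx)
    exact ⟨x, x.2, by simpa using hx⟩
  obtain ⟨y, hyD, hy⟩ := key {1, k} (Finset.card_le_two.trans (by norm_num))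
  obtain ⟨w, hwD, hw⟩ := key {1, k, y, y * k} Finset.card_le_four
  simp only [Finset.mem_insert, Finset.mem_singleton, not_or] at hy hw
  refine ⟨kleinSubgroup y w (h2 y hyD) (h2 w hwD) (hcomm y hyD w hwD), ?_,
    card_kleinSubgroup hy.1 hw.1 (Ne.symm hw.2.2.1), ?_⟩
  · rintro g (rfl | rfl | rfl | rfl)
    exacts [D.one_mem, hyD, hwD, D.mul_mem hyD hwD]
  · rintro (h | h | h | h)
    · exact hk h
    · exact hy.2 h.symm
    · exact hw.2.1 h.symm
    · refine hw.2.2.2 ?_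
      rw [h, ← mul_assoc, h2 y hyD, one_mul]

theorem eq_one_or_eq_sq_of_mem_zpowers {G : Type*} [Group G] [Finite G] {a g : G}
    (ha : orderOf a = 4) (hg : g ∈ Subgroup.zpowers a) (hg2 : g ^ 2 = 1) : g = 1 ∨ g = a ^ 2 := by
  obtain ⟨k, rfl⟩ := (mem_powers_iff_mem_zpowers (x := a)).2 hg
  simp only at hg2 ⊢
  rw [← pow_mul] at hg2
  have hk := orderOf_dvd_of_pow_eq_one hg2
  rw [ha] at hk
  have h4 : a ^ 4 = 1 := by rw [← ha, pow_orderOf_eq_one]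
  rw [pow_eq_pow_mod k h4]
  have : k % 4 = 0 ∨ k % 4 = 2 := by omega
  rcases this with h | h <;> simp [h]

/-- Subgroups `H₁, H₂` of order `4n` of a group `L` of order `16n` meeting in a subgroup of
order `n`: the Cayley graph of `L` with respect to `(H₁ ∪ H₂) \ (H₁ ∩ H₂)` is a blow-up of the
rook graph. -/
def HasRookSubgroups (G : Type*) [Group G] : Prop :=
  ∃ n ≠ 0, ∃ L H₁ H₂ : Subgroup G, H₁ ≤ L ∧ H₂ ≤ L ∧ Nat.card H₁ = 4 * n ∧ Nat.card H₂ = 4 * n ∧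
    Nat.card (H₁ ⊓ H₂ : Subgroup G) = n ∧ Nat.card L = 16 * n

theorem IsCayDSGroup.not_hasRookSubgroups {G : Type*} [Group G] [Fintype G]
    (hG : IsCayDSGroup G) (Q : Subgroup G) : ¬HasRookSubgroups Q := by
  rintro ⟨n, hn, L, H₁, H₂, h₁, h₂, c₁, c₂, c, cL⟩
  have : NeZero n := ⟨hn⟩
  have hcard : ∀ H : Subgroup Q, Nat.card (H.map Q.subtype) = Nat.card H := fun H =>
    (Nat.card_congr (H.equivMapOfInjective _ Q.subtype_injective).toEquiv).symm
  refine hG.false_of_subgroups n (L.map Q.subtype) (H₁.map Q.subtype) (H₂.map Q.subtype)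
    (Subgroup.map_mono h₁) (Subgroup.map_mono h₂) ?_ ?_ ?_ ?_
  · rw [hcard, c₁]
  · rw [hcard, c₂]
  · rw [← Subgroup.map_inf _ _ _ Q.subtype_injective, hcard, c]
  · rw [hcard, cL]

/-- The subgroup ⟨k⟩ is central of order two with elementary abelian quotient of order 16. The
preimages of two complementary planes of the quotient have order 8 and meet in ⟨k⟩, so n = 2. -/
theorem hasRookSubgroups_of_sq {Q : Type*} [Group Q] [Finite Q] (hQ : Nat.card Q = 32) {k : Q}
    (hk : k ≠ 1) (hsq : ∀ x : Q, x ^ 2 = 1 ∨ x ^ 2 = k) : HasRookSubgroups Q := by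
  have hk2 : k ^ 2 = 1 := (hsq k).resolve_right fun h => hk (by
    rw [pow_two] at h; simpa using h)
  -- If k = x², a conjugate of k is again a nontrivial square, hence equals k. If k is not a square,
  -- all squares are trivial and Q is abelian.
  have hcentral : ∀ g, g * k * g⁻¹ = k := by
    intro g
    by_cases h : ∃ x : Q, x ^ 2 = k
    · obtain ⟨x, rfl⟩ := h
      have h1 := hsq (g * x * g⁻¹)
      rw [conj_pow] at h1
      exact h1.resolve_left (by rwa [conj_eq_one_iff])
    · have h2 : ∀ x : Q, x ^ 2 = 1 := fun x => (hsq x).resolve_right fun hx => h ⟨x, hx⟩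
      have := h2 (g * k)
      have hg := h2 g
      rw [pow_two] at this hg hk2
      rw [mul_eq_one_iff_eq_inv, mul_inv_rev, inv_eq_of_mul_eq_one_left hg,
        inv_eq_of_mul_eq_one_left hk2] at this
      rw [this, inv_eq_of_mul_eq_one_left hg, mul_assoc, hg, mul_one]
  have hmem : ∀ x, x ∈ Subgroup.zpowers k ↔ x = 1 ∨ x = k := by
    intro x
    rw [← mem_powers_iff_mem_zpowers]
    constructor
    · rintro ⟨i, rfl⟩
      simp only
      rw [pow_eq_pow_mod i hk2]
      have : i % 2 = 0 ∨ i % 2 = 1 := by omega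
      rcases this with h | h <;> simp [h]
    · rintro (rfl | rfl)
      exacts [⟨0, pow_zero _⟩, ⟨1, pow_one _⟩]
  have hN : (Subgroup.zpowers k).Normal := ⟨fun x hx g => by
    rcases (hmem x).1 hx with rfl | rfl
    · simp
    · rw [hcentral]; exact hx⟩
  have hcN : Nat.card (Subgroup.zpowers k) = 2 := by
    rw [Nat.card_zpowers, orderOf_eq_prime hk2 hk]
  have hcE : Nat.card (Q ⧸ Subgroup.zpowers k) = 16 := by
    have := Subgroup.card_eq_card_quotient_mul_card_subgroup (Subgroup.zpowers k)
    rw [hQ, hcN] at this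
    omega
  have h2 : ∀ x : Q ⧸ Subgroup.zpowers k, x * x = 1 := by
    intro x
    induction x using QuotientGroup.induction_on with
    | H x =>
      rw [← QuotientGroup.mk_mul, QuotientGroup.eq_one_iff, hmem, ← pow_two]
      exact hsq x
  let _ : CommGroup (Q ⧸ Subgroup.zpowers k) :=
    { (inferInstance : Group (Q ⧸ Subgroup.zpowers k)) with
      mul_comm := fun x y => by
        have := h2 (x * y)
        rwa [mul_eq_one_iff_eq_inv, mul_inv_rev, inv_eq_of_mul_eq_one_left (h2 x),
          inv_eq_of_mul_eq_one_left (h2 y)] at this }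
  obtain ⟨U, V, hU, hV, hUV⟩ := exists_klein_complements hcE h2
  have hcomap : ∀ U : Subgroup (Q ⧸ Subgroup.zpowers k),
      Nat.card (U.comap (QuotientGroup.mk' (Subgroup.zpowers k))) = Nat.card U * 2 := by
    intro U
    have h1 := Subgroup.index_comap_of_surjective U
      (QuotientGroup.mk'_surjective (Subgroup.zpowers k))
    have h2 := U.card_mul_index
    have h3 := (U.comap (QuotientGroup.mk' (Subgroup.zpowers k))).card_mul_index
    rw [h1, hQ] at h3
    rw [hcE] at h2
    have h4 : U.index ≠ 0 := fun h => by rw [h] at h2; omega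
    refine Nat.eq_of_mul_eq_mul_right (Nat.pos_of_ne_zero h4) ?_
    rw [h3, mul_right_comm, h2, show 16 * 2 = 32 from rfl]
  refine ⟨2, two_ne_zero, ⊤, _, _, le_top, le_top, (hcomap U).trans (by rw [hU]),
    (hcomap V).trans (by rw [hV]), ?_, by rw [Subgroup.card_top, hQ]⟩
  rw [← Subgroup.comap_inf, hUV, hcomap, Subgroup.card_bot]

/-- Suppose there are no such subgroups. In a subgroup of order 16, two cyclic subgroups of order 4
with different squares would meet trivially and form a board with n = 1; so all nontrivial squares
in it agree. By `hasRookSubgroups_of_sq`, some a and b have distinct nontrivial squares. Let M ∋ a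
and M' ∋ b have order 16. A nontrivial square of an element of M ∩ M' would equal both a² and b², so
M ∩ M' is elementary abelian, of order 8. A Klein four-group in it that avoids a² meets ⟨a⟩
trivially, and the two form a board in M. -/
theorem hasRookSubgroups_of_card {Q : Type*} [Group Q] [Finite Q] (hQ : Nat.card Q = 32)
    (h4 : ∀ x : Q, x ^ 4 = 1) : HasRookSubgroups Q := by
  have : Fact (Nat.Prime 2) := ⟨Nat.prime_two⟩
  by_contra hcon
  have horder : ∀ a : Q, a ^ 2 ≠ 1 → orderOf a = 4 := fun a ha =>
    orderOf_eq_prime_pow (p := 2) (n := 1) (by simpa using ha) (h4 a)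
  have inf_eq_bot : ∀ (a : Q) (B : Subgroup Q), a ^ 2 ≠ 1 → a ^ 2 ∉ B →
      Subgroup.zpowers a ⊓ B = ⊥ := by
    intro a B ha haB
    have key : ∀ g ∈ Subgroup.zpowers a ⊓ B, g ^ 2 = 1 → g = 1 := by
      rintro g ⟨hga, hgB⟩ hg2
      exact (eq_one_or_eq_sq_of_mem_zpowers (horder a ha) hga hg2).resolve_right
        fun h => haB (h ▸ hgB)
    rw [eq_bot_iff]
    intro g hg
    refine Subgroup.mem_bot.2 (key g hg (key (g ^ 2) (Subgroup.pow_mem _ hg 2) ?_))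
    rw [← pow_mul, h4]
  have hsq : ∀ M : Subgroup Q, Nat.card M = 16 → ∀ a ∈ M, ∀ b ∈ M, a ^ 2 ≠ 1 → b ^ 2 ≠ 1 →
      a ^ 2 = b ^ 2 := by
    intro M hM a ha b hb ha2 hb2
    by_contra hab
    refine hcon ⟨1, one_ne_zero, M, Subgroup.zpowers a, Subgroup.zpowers b, by simpa using ha,
      by simpa using hb, ?_, ?_, ?_, by rw [hM]⟩
    · rw [Nat.card_zpowers, horder a ha2]
    · rw [Nat.card_zpowers, horder b hb2]
    · rw [inf_eq_bot a _ ha2, Subgroup.card_bot]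
      intro h
      rcases eq_one_or_eq_sq_of_mem_zpowers (horder b hb2) h (by rw [← pow_mul, h4]) with h | h
      exacts [ha2 h, hab h]
  have hall : ∀ k : Q, k ≠ 1 → ∃ x : Q, x ^ 2 ≠ 1 ∧ x ^ 2 ≠ k := by
    intro k hk
    by_contra! h
    exact hcon (hasRookSubgroups_of_sq hQ hk fun x => or_iff_not_imp_left.2 (h x))
  obtain ⟨k, hk⟩ := exists_notMem_of_card_lt ({1} : Finset Q) (by rw [hQ]; simp)
  obtain ⟨a, ha, -⟩ := hall k (by simpa using hk)
  obtain ⟨b, hb, hab⟩ := hall _ ha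
  have hmax : ∀ x : Q, x ^ 2 ≠ 1 → ∃ M : Subgroup Q, Nat.card M = 16 ∧ x ∈ M := by
    intro x hx
    obtain ⟨M, hM, hxM⟩ := Sylow.exists_subgroup_card_pow_prime_le (n := 2) (m := 4) 2
      (by rw [hQ]; norm_num) (Subgroup.zpowers x) (by rw [Nat.card_zpowers, horder x hx]; rfl)
      (by norm_num)
    exact ⟨M, hM, hxM (Subgroup.mem_zpowers x)⟩
  obtain ⟨M, hM, haM⟩ := hmax a ha
  obtain ⟨M', hM', hbM'⟩ := hmax b hb
  have hbM : b ∉ M := fun h => hab (hsq M hM b h a haM hb ha)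
  have hD2 : ∀ x ∈ M ⊓ M', x * x = 1 := by
    rintro x ⟨hx, hx'⟩
    rw [← pow_two]
    by_contra hne
    exact hab ((hsq M' hM' b hbM' x hx' hb hne).trans (hsq M hM x hx a haM hne ha))
  have hD : Nat.card (M ⊓ M' : Subgroup Q) = 8 := by
    have h1 := (M ⊓ M').card_mul_index
    have h2 : (M ⊓ M').index ≤ M.index * M'.index := Subgroup.index_inf_le
    have h3 := M.card_mul_index
    have h4 := M'.card_mul_index
    rw [hQ] at h1 h3 h4
    rw [hM] at h3
    rw [hM'] at h4
    have h5 : M.index = 2 := by omega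
    have h6 : M'.index = 2 := by omega
    rw [h5, h6] at h2
    have h7 : Nat.card (M ⊓ M' : Subgroup Q) ∣ 2 ^ 4 := by
      rw [show 2 ^ 4 = 16 from rfl, ← hM']
      exact Subgroup.card_dvd_of_le inf_le_right
    have h8 : Nat.card (M ⊓ M' : Subgroup Q) ≠ 16 := by
      intro h
      have : M ⊓ M' = M' := Subgroup.eq_of_le_of_card_ge inf_le_right (by rw [h, hM'])
      rw [← this] at hbM'
      exact hbM hbM'.1
    obtain ⟨i, hi, hi'⟩ := (Nat.dvd_prime_pow Nat.prime_two).1 h7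
    rw [hi'] at h1 h8 ⊢
    interval_cases i <;> simp at h1 h8 ⊢ <;> omega
  obtain ⟨B, hBD, hB, haB⟩ := exists_klein_avoiding _ hD hD2 _ ha
  refine hcon ⟨1, one_ne_zero, M, Subgroup.zpowers a, B, by simpa using haM,
    hBD.trans inf_le_left, ?_, hB, ?_, by rw [hM]⟩
  · rw [Nat.card_zpowers, horder a ha]
  · rw [inf_eq_bot a _ ha haB, Subgroup.card_bot]

theorem IsCayDSGroup.not_thirtyTwo_dvd {G : Type*} [Group G] [Fintype G] (hG : IsCayDSGroup G) :
    ¬32 ∣ Nat.card G := by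
  intro h32
  have : Fact (Nat.Prime 2) := ⟨Nat.prime_two⟩
  obtain ⟨Q, hQ⟩ := Sylow.exists_subgroup_card_pow_prime (G := G) 2 (n := 5) h32
  refine hG.not_hasRookSubgroups Q (hasRookSubgroups_of_card hQ fun x => ?_)
  have hx : orderOf x ∣ 2 ^ 5 := hQ ▸ orderOf_dvd_natCard x
  obtain ⟨i, hi, hi'⟩ := (Nat.dvd_prime_pow Nat.prime_two).1 hx
  have h16 : 16 ∣ Nat.card G := (by norm_num : 16 ∣ 32).trans h32
  by_cases hi2 : i ≤ 2
  · rw [← orderOf_dvd_iff_pow_eq_one, hi']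
    exact pow_dvd_pow 2 hi2
  -- An element of order 2ⁱ with i ≥ 3 has a power of order 8.
  · refine absurd ?_ (hG.orderOf_ne_eight h16 ((x : G) ^ 2 ^ (i - 3)))
    have hx' : orderOf (x : G) = 2 ^ i := by rw [Subgroup.orderOf_coe, hi']
    rw [orderOf_pow_of_dvd (by positivity) (by rw [hx']; exact pow_dvd_pow 2 (by omega)), hx',
      Nat.pow_div (by omega) (by norm_num), show i - (i - 3) = 3 by omega]

/-! ### Groups of order 27 -/

/-- Division in a group of order 27 generated by `x, y, z` with `z` central, `y³ = z³ = 1`,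
`xyx⁻¹ = yzˢ` and `x³ = zᵗ`, in terms of the normal form `xⁱyʲzᵏ`. -/
def order27Div (s t : ZMod 3) (u v : ZMod 3 × ZMod 3 × ZMod 3) : ZMod 3 × ZMod 3 × ZMod 3 :=
  (u.1 - v.1, u.2.1 - v.2.1, u.2.2 - v.2.2 + s * v.1 * (u.2.1 - v.2.1) -
    if u.1.val < v.1.val then t else 0)

/-- Moving xⁿ past yᴶ costs the central factor z to the power nsJ, and a borrow in the exponent of x
costs z⁻ᵗ. These are the two corrections in `order27Div`. -/
theorem IsCayleyOnSubgroup.of_order27 {G : Type*} [Group G] {x y z : G} (hy : y ^ 3 = 1)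
    (hz : z ^ 3 = 1) (hyz : Commute y z) (hxz : Commute x z) {s t : ZMod 3}
    (hxy : x * y * x⁻¹ = y * zmodPow 3 z hz (.ofAdd s)) (hx : x ^ 3 = zmodPow 3 z hz (.ofAdd t))
    (hz1 : z ≠ 1) (hy1 : y ∉ Subgroup.zpowers z)
    (hx1 : ∀ j k, x ≠ zmodPow 3 y hy j * zmodPow 3 z hz k)
    {Γ : SimpleGraph (ZMod 3 × ZMod 3 × ZMod 3)} (T : Finset (ZMod 3 × ZMod 3 × ZMod 3))
    (hT : ∀ u v, Γ.Adj u v ↔ order27Div s t u v ∈ T) : IsCayleyOnSubgroup G Γ := by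
  obtain ⟨Y, hY⟩ : ∃ Y : ZMod 3 → G, ∀ i, Y i = zmodPow 3 y hy (.ofAdd i) := ⟨_, fun _ => rfl⟩
  obtain ⟨Z, hZ⟩ : ∃ Z : ZMod 3 → G, ∀ i, Z i = zmodPow 3 z hz (.ofAdd i) := ⟨_, fun _ => rfl⟩
  have Yadd : ∀ i j, Y (i + j) = Y i * Y j := by
    intro i j; rw [hY, hY, hY, ofAdd_add, map_mul]
  have Zadd : ∀ i j, Z (i + j) = Z i * Z j := by
    intro i j; rw [hZ, hZ, hZ, ofAdd_add, map_mul]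
  have Yneg : ∀ j, (Y j)⁻¹ = Y (-j) := by intro j; rw [hY, hY, ofAdd_neg, map_inv]
  have Zneg : ∀ j, (Z j)⁻¹ = Z (-j) := by intro j; rw [hZ, hZ, ofAdd_neg, map_inv]
  have Y0 : Y 0 = 1 := by rw [hY, ofAdd_zero, map_one]
  have Z0 : Z 0 = 1 := by rw [hZ, ofAdd_zero, map_one]
  have Z_pow : ∀ k, Z k = z ^ k.val := fun k => by rw [hZ]; rfl
  have Y_pow : ∀ k, Y k = y ^ k.val := fun k => by rw [hY]; rfl
  have YZ : ∀ j k, Commute (Y j) (Z k) := fun j k => by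
    rw [Y_pow, Z_pow]; exact hyz.pow_pow _ _
  have XZ : ∀ n : ℕ, ∀ k, Commute (x ^ n) (Z k) := fun n k => by
    rw [Z_pow]; exact hxz.pow_pow _ _
  have conj1 : ∀ J, x * Y J * x⁻¹ = Y J * Z (s * J) := by
    intro J
    obtain ⟨n, rfl⟩ : ∃ n : ℕ, (n : ZMod 3) = J := ⟨J.val, ZMod.natCast_zmod_val J⟩
    rw [hY, zmodPow_natCast, ← conj_pow, hxy, ← hZ,
      Commute.mul_pow (by simpa [Y_pow, ZMod.val_one] using YZ 1 s), mul_comm s, hZ, hZ,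
      ← map_pow, ← ofAdd_nsmul, nsmul_eq_mul]
  have conjn : ∀ n : ℕ, ∀ J, x ^ n * Y J = Y J * Z (n * (s * J)) * x ^ n := by
    intro n J
    induction n with
    | zero => simp [Z0]
    | succ n ih =>
      have h1 : x * Y J = Y J * Z (s * J) * x := by rw [← conj1]; group
      have h2 := XZ n (s * J)
      rw [pow_succ, mul_assoc, h1, ← mul_assoc, ← mul_assoc, ih, mul_assoc _ (x ^ n), h2.eq,
        ← mul_assoc, mul_assoc (Y J), ← Zadd, mul_assoc _ (x ^ n)]
      push_cast
      rw [add_mul, one_mul]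
  have three : ∀ i : ZMod 3, i = 0 ∨ i = 1 ∨ i = 2 := by decide
  have hx3 : x ^ 3 = Z t := by rw [hZ, hx]
  -- Reducing i - i' modulo 3 adds 3 exactly when i < i', which is compensated by x⁻³ = z⁻ᵗ.
  have hxx : ∀ i i' : ZMod 3, x ^ i.val * (x ^ i'.val)⁻¹ =
      x ^ (i - i').val * Z (-(if i.val < i'.val then t else 0)) := by
    have v2 : (2 : ZMod 3).val = 2 := rfl
    have v1 : (1 : ZMod 3).val = 1 := rfl
    have e1 : (0 : ZMod 3) - 1 = 2 := rfl
    have e2 : (0 : ZMod 3) - 2 = 1 := rfl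
    have e3 : (1 : ZMod 3) - 2 = 2 := rfl
    have e4 : (2 : ZMod 3) - 1 = 1 := rfl
    intro i i'
    rcases three i with rfl | rfl | rfl <;> rcases three i' with rfl | rfl | rfl <;>
      simp only [v1, v2, e1, e2, e3, e4, ZMod.val_zero, sub_self, sub_zero, lt_self_iff_false,
        if_false, neg_zero, Z0, pow_zero, inv_one, mul_one, one_mul, mul_inv_cancel, zero_lt_one,
        zero_lt_two, if_true, Nat.one_lt_two, not_lt_zero, ← Zneg, ← hx3,
        show ¬2 < 1 by norm_num] <;> group
  obtain ⟨e, he⟩ : ∃ e : ZMod 3 × ZMod 3 × ZMod 3 → G,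
      ∀ i j k, e (i, j, k) = x ^ i.val * (Y j * Z k) :=
    ⟨fun u => x ^ u.1.val * (Y u.2.1 * Z u.2.2), fun _ _ _ => rfl⟩
  have hdiv : ∀ u v, e u * (e v)⁻¹ = e (order27Div s t u v) := by
    rintro ⟨i, j, k⟩ ⟨i', j', k'⟩
    simp only [order27Div, he]
    have h1 := conjn i'.val (j - j')
    rw [ZMod.natCast_zmod_val] at h1
    have h2 : Y (j - j') * (x ^ i'.val)⁻¹ =
        (x ^ i'.val)⁻¹ * (Y (j - j') * Z (i' * (s * (j - j')))) := by
      rw [eq_inv_mul_iff_mul_eq, ← mul_assoc, h1, mul_inv_cancel_right]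
    have h3 : Z k * (Z (-k') * (Y (-j') * (x ^ i'.val)⁻¹)) =
        Y (-j') * ((x ^ i'.val)⁻¹ * Z (k - k')) := by
      rw [← mul_assoc, ← Zadd, ← sub_eq_add_neg, ← mul_assoc, ← mul_assoc, ← (YZ _ _).eq, mul_assoc,
        mul_assoc, ((XZ i'.val (k - k')).inv_left).eq]
    have h4 : ∀ a b c, Z a * (Y (j - j') * (Z b * Z c)) = Y (j - j') * Z (c + b + a) := by
      intro a b c
      rw [← mul_assoc, ← (YZ _ a).eq, mul_assoc, ← Zadd, ← Zadd]
      congr 2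
      ring
    calc x ^ i.val * (Y j * Z k) * (x ^ i'.val * (Y j' * Z k'))⁻¹
        = x ^ i.val * (Y (j - j') * (x ^ i'.val)⁻¹) * Z (k - k') := by
          simp only [mul_inv_rev, Yneg, Zneg, mul_assoc]
          rw [h3, sub_eq_add_neg j, Yadd]
          simp only [mul_assoc]
      _ = _ := by
          rw [h2, ← mul_assoc, hxx]
          simp only [mul_assoc]
          rw [h4, sub_eq_add_neg _ (ite _ _ _), mul_left_comm i' s, ← mul_assoc s]
  have hYz : ∀ j k, Y j * Z k = 1 → j = 0 ∧ k = 0 := by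
    intro j k h
    have hj : Y j ∈ Subgroup.zpowers z := by
      rw [mul_eq_one_iff_eq_inv.1 h, Zneg, hZ]
      exact zmodPow_mem_zpowers 3 z hz _
    have hj0 : j = 0 := by
      rcases three j with rfl | rfl | rfl
      · rfl
      · exact absurd (by simpa [hY, zmodPow_one] using hj) hy1
      · refine absurd ?_ hy1
        have h22 : Y 2 * Y 2 = y := by
          rw [← Yadd, show (2 + 2 : ZMod 3) = 1 from rfl, hY, zmodPow_one]
        rw [← h22]
        exact Subgroup.mul_mem _ hj hj
    subst hj0
    refine ⟨rfl, ?_⟩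
    rw [Y0, one_mul, hZ] at h
    exact Multiplicative.ofAdd.injective (zmodPow_injective 3 z hz (orderOf_eq_prime hz hz1)
      (h.trans (map_one _).symm))
  have he1 : ∀ u, e u = 1 → u = 0 := by
    rintro ⟨i, j, k⟩ h
    rw [he] at h
    have hx1' : ∀ j k, x ≠ Y j * Z k := fun j k => by rw [hY, hZ]; exact hx1 _ _
    rcases three i with rfl | rfl | rfl
    · rw [ZMod.val_zero, pow_zero, one_mul] at h
      obtain ⟨rfl, rfl⟩ := hYz _ _ h
      rfl
    · rw [ZMod.val_one, pow_one, (YZ j k).eq, mul_eq_one_iff_eq_inv, mul_inv_rev, Yneg, Zneg] at h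
      exact absurd h (hx1' _ _)
    · refine absurd ?_ (hx1' j (k + t))
      rw [show (2 : ZMod 3).val = 2 from rfl, mul_eq_one_iff_inv_eq] at h
      rw [Zadd, ← mul_assoc, ← h, ← hx3]
      group
  refine .of_coordinates e ?_ (order27Div s t) hdiv (T : Set _) hT
  intro u v huv
  have h := he1 (order27Div s t u v) (by rw [← hdiv, huv, mul_inv_cancel])
  obtain ⟨i, j, k⟩ := u
  obtain ⟨i', j', k'⟩ := v
  simp only [order27Div, Prod.mk_eq_zero, sub_eq_zero] at h
  obtain ⟨rfl, rfl, h⟩ := h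
  simp only [sub_self, mul_zero, add_zero, lt_self_iff_false, if_false, sub_eq_zero] at h
  rw [h]

theorem IsCayleyOnSubgroup.of_subgroup {G ι : Type*} [Group G] {Γ : SimpleGraph ι}
    {Q : Subgroup G} (h : IsCayleyOnSubgroup Q Γ) : IsCayleyOnSubgroup G Γ := by
  obtain ⟨H, e, S, hS⟩ := h
  refine ⟨H.map Q.subtype, e.trans (H.equivMapOfInjective _ Q.subtype_injective).toEquiv,
    Subtype.val '' S, fun u v => ?_⟩
  rw [hS, ← Subtype.val_injective.mem_set_image (s := S)]
  rfl

/-- The Hamming graph `H(3, 3)`. -/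
def hammingGraph : SimpleGraph (ZMod 3 × ZMod 3 × ZMod 3) :=
  addCayleyGraph {(1, 0, 0), (0, 1, 0), (0, 0, 1)}

/-- A Cayley graph of the Heisenberg group of order 27, cospectral to the Hamming graph. -/
def hammingMate : SimpleGraph (ZMod 3 × ZMod 3 × ZMod 3) where
  Adj u v := order27Div 1 0 u v ∈
    ({(0, 1, 0), (0, 2, 0), (1, 0, 0), (1, 1, 1), (2, 0, 0), (2, 2, 1)} : Finset _)
  symm := ⟨by decide +kernel⟩
  loopless := ⟨by decide +kernel⟩

instance : DecidableRel hammingGraph.Adj := inferInstanceAs (DecidableRel (addCayleyGraph _).Adj)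

instance : DecidableRel hammingMate.Adj :=
  fun _ _ => inferInstanceAs (Decidable (_ ∈ ({_, _, _, _, _, _} : Finset _)))

/-- The eigenvalues are 6, 3, 0 and -3, and the recurrence comes from x(x - 6)(x - 3)(x + 3). -/
def hammingGraph_walkCertificate : WalkCertificate hammingGraph 0 4
    (fun i => [0, -54, 9, 6].getD i 0) (fun i => [1, 0, 6, 6].getD i 0) where
  vec := tableVec (fun v => v.1.val * 9 + v.2.1.val * 3 + v.2.2.val)
    [[1, 0, 0, 0, 0, 0, 0, 0, 0, 0, 0, 0, 0, 0, 0, 0, 0, 0, 0, 0, 0, 0, 0, 0, 0, 0, 0],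
    [0, 1, 1, 1, 0, 0, 1, 0, 0, 1, 0, 0, 0, 0, 0, 0, 0, 0, 1, 0, 0, 0, 0, 0, 0, 0, 0],
    [6, 1, 1, 1, 2, 2, 1, 2, 2, 1, 2, 2, 2, 0, 0, 2, 0, 0, 1, 2, 2, 2, 0, 0, 2, 0, 0],
    [6, 15, 15, 15, 6, 6, 15, 6, 6, 15, 6, 6, 6, 6, 6, 6, 6, 6, 15, 6, 6, 6, 6, 6, 6, 6, 6],
    [90, 45, 45, 45, 54, 54, 45, 54, 54, 45, 54, 54, 54, 36, 36, 54, 36, 36, 45, 54, 54, 54, 36, 36,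
      54, 36, 36]]
  vec_zero := by decide +kernel
  vec_succ := by decide +kernel
  recurrence := by decide +kernel
  closed := by decide +kernel

def hammingMate_walkCertificate : WalkCertificate hammingMate 0 4
    (fun i => [0, -54, 9, 6].getD i 0) (fun i => [1, 0, 6, 6].getD i 0) where
  vec := tableVec (fun v => v.1.val * 9 + v.2.1.val * 3 + v.2.2.val)
    [[1, 0, 0, 0, 0, 0, 0, 0, 0, 0, 0, 0, 0, 0, 0, 0, 0, 0, 0, 0, 0, 0, 0, 0, 0, 0, 0],
    [0, 0, 0, 1, 0, 0, 1, 0, 0, 1, 0, 0, 0, 1, 0, 0, 0, 0, 1, 0, 0, 0, 0, 0, 0, 1, 0],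
    [6, 0, 0, 1, 1, 1, 1, 1, 1, 1, 1, 1, 1, 1, 1, 3, 3, 0, 1, 1, 1, 3, 3, 0, 1, 1, 1],
    [6, 6, 6, 15, 6, 6, 15, 6, 6, 15, 6, 6, 6, 15, 6, 6, 6, 6, 15, 6, 6, 6, 6, 6, 6, 15, 6],
    [90, 36, 36, 45, 45, 45, 45, 45, 45, 45, 45, 45, 45, 45, 45, 63, 63, 36, 45, 45, 45, 63, 63, 36,
      45, 45, 45]]
  vec_zero := by decide +kernel
  vec_succ := by decide +kernel
  recurrence := by decide +kernel
  closed := by decide +kernel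

/-- The translation along the first coordinate. -/
def heisenbergX : Equiv.Perm (ZMod 3 × ZMod 3) :=
  ⟨fun a => (a.1 + 1, a.2), fun a => (a.1 - 1, a.2), by decide +kernel, by decide +kernel⟩

/-- The shear that fixes the first coordinate. -/
def heisenbergY : Equiv.Perm (ZMod 3 × ZMod 3) :=
  ⟨fun a => (a.1, a.2 + a.1), fun a => (a.1, a.2 - a.1), by decide +kernel, by decide +kernel⟩

/-- The translation along the second coordinate. -/
def heisenbergZ : Equiv.Perm (ZMod 3 × ZMod 3) :=
  ⟨fun a => (a.1, a.2 - 1), fun a => (a.1, a.2 + 1), by decide +kernel, by decide +kernel⟩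

theorem heisenbergY_pow_three : heisenbergY ^ 3 = 1 := by decide +kernel

theorem heisenbergZ_pow_three : heisenbergZ ^ 3 = 1 := by decide +kernel

theorem isCayleyOnSubgroup_hammingMate :
    IsCayleyOnSubgroup (Equiv.Perm (ZMod 3 × ZMod 3)) hammingMate := by
  refine .of_order27 (x := heisenbergX) heisenbergY_pow_three heisenbergZ_pow_three
    (s := 1) (t := 0) ?_ ?_ (by decide +kernel) (by decide +kernel) (by decide +kernel) ?_
    (by decide +kernel) _ fun _ _ => Iff.rfl
  · change _ * _ = _ * _
    decide +kernel
  · change _ * _ = _ * _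
    decide +kernel
  intro h
  obtain ⟨i, hi⟩ := exists_zmodPow_eq 3 heisenbergZ_pow_three h
  revert i
  decide +kernel

theorem cospectral_hammingGraph_hammingMate : Cospectral hammingGraph hammingMate :=
  hammingGraph_walkCertificate.cospectral hammingMate_walkCertificate
    (IsCayleyOnSubgroup.addCayleyGraph_self _).isVertexTransitive
    isCayleyOnSubgroup_hammingMate.isVertexTransitive rfl

theorem not_nonempty_iso_hammingGraph_hammingMate : ¬Nonempty (hammingGraph ≃g hammingMate) := by
  rintro ⟨f⟩
  have h1 : CodegreeLT hammingGraph 3 := by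
    intro u v
    rw [Nat.card_eq_fintype_card]
    revert u v
    decide +kernel
  -- This pair has three common neighbours in `hammingMate`, one more than any pair in the Hamming
  -- graph.
  have h2 := h1.of_iso f.symm 0 (1, 2, 0) (by decide +kernel)
  rw [Nat.card_eq_fintype_card] at h2
  revert h2
  decide +kernel

theorem IsCayDSGroup.not_hammingGraph {G : Type*} [Group G] [Fintype G] (hG : IsCayDSGroup G) :
    ¬IsCayleyOnSubgroup G hammingGraph := fun h =>
  not_nonempty_iso_hammingGraph_hammingMate (hG.nonempty_iso h isCayleyOnSubgroup_hammingMate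
    (connected_of_walk_three (by decide +kernel)) cospectral_hammingGraph_hammingMate)

theorem IsCayDSGroup.not_hammingMate {G : Type*} [Group G] [Fintype G] (hG : IsCayDSGroup G) :
    ¬IsCayleyOnSubgroup G hammingMate := fun h =>
  not_nonempty_iso_hammingGraph_hammingMate ((hG.nonempty_iso h
    (IsCayleyOnSubgroup.addCayleyGraph_self _) (connected_of_walk_three (by decide +kernel))
    cospectral_hammingGraph_hammingMate.symm).map SimpleGraph.Iso.symm)

/-- Two cospectral Cayley graphs of `C₉ × C₃`: the first. -/
def nineThreeGraph : SimpleGraph (ZMod 9 × ZMod 3) :=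
  addCayleyGraph {(0, 1), (1, 0), (1, 1), (3, 1), (3, 2)}

/-- Two cospectral Cayley graphs of `C₉ × C₃`: the second. -/
def nineThreeMate : SimpleGraph (ZMod 9 × ZMod 3) :=
  addCayleyGraph {(1, 0), (1, 1), (1, 2), (2, 0), (4, 0)}

instance : DecidableRel nineThreeGraph.Adj := inferInstanceAs (DecidableRel (addCayleyGraph _).Adj)

instance : DecidableRel nineThreeMate.Adj := inferInstanceAs (DecidableRel (addCayleyGraph _).Adj)

/-- The eigenvalues given by the characters are 10, 4, -2, -5, and 2θ and -θ for the three roots θ =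
2cos(2πa/9) of x³ - 3x + 1. The recurrence is that of (x - 10)(x - 4)(x + 2)(x + 5)(x³ - 12x + 8)(x³
- 3x - 1). -/
def nineThreeGraph_walkCertificate : WalkCertificate nineThreeGraph 0 10
    (fun i => [3200, 5920, -13104, -8472, 6672, 2700, -1107, -252, 63, 7].getD i 0)
    (fun i => [1, 0, 10, 30, 462, 3510, 38786, 365190, 3741086, 36902410].getD i 0) where
  vec := tableVec (fun v => v.1.val * 3 + v.2.val)
    [[1, 0, 0, 0, 0, 0, 0, 0, 0, 0, 0, 0, 0, 0, 0, 0, 0, 0, 0, 0, 0, 0, 0, 0, 0, 0, 0],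
    [0, 1, 1, 1, 1, 0, 0, 0, 0, 0, 1, 1, 0, 0, 0, 0, 0, 0, 0, 1, 1, 0, 0, 0, 1, 0, 1],
    [10, 5, 5, 2, 2, 4, 3, 6, 3, 6, 3, 3, 2, 2, 4, 2, 4, 2, 6, 3, 3, 3, 3, 6, 2, 4, 2],
    [30, 45, 45, 45, 45, 30, 36, 24, 36, 32, 48, 48, 36, 36, 24, 36, 24, 36, 32, 48, 48, 36, 36, 24,
      45, 30, 45],
    [462, 385, 385, 330, 330, 396, 350, 420, 350, 426, 355, 355, 335, 335, 402, 335, 402, 335, 426,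
      355, 355, 350, 350, 420, 330, 396, 330],
    [3510, 3861, 3861, 3850, 3850, 3500, 3740, 3400, 3740, 3560, 3916, 3916, 3751, 3751, 3410, 3751,
      3410, 3751, 3560, 3916, 3916, 3740, 3740, 3400, 3850, 3500, 3850],
    [38786, 37023, 37023, 36162, 36162, 37884, 36477, 38214, 36477, 38368, 36624, 36624, 36288,
      36288, 38016, 36288, 38016, 36288, 38368, 36624, 36624, 36477, 36477, 38214, 36162, 37884,
      36162],
    [365190, 373885, 373885, 373541, 373541, 364854, 372079, 363426, 372079, 366072, 374788, 374788,
      372337, 372337, 363678, 372337, 363678, 372337, 366072, 374788, 374788, 372079, 372079,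
      363426, 373541, 364854, 373541],
    [3741086, 3697585, 3697585, 3684495, 3684495, 3727842, 3689170, 3732572, 3689170, 3735754,
      3692315, 3692315, 3686790, 3686790, 3730164, 3686790, 3730164, 3686790, 3735754, 3692315,
      3692315, 3689170, 3689170, 3732572, 3684495, 3727842, 3684495],
    [36902410, 37119483, 37119483, 37111446, 37111446, 36894420, 37091439, 36874530, 37091439,
      36916350, 37133505, 37133505, 37096056, 37096056, 36879120, 37096056, 36879120, 37096056,
      36916350, 37133505, 37133505, 37091439, 37091439, 36874530, 37111446, 36894420, 37111446],
    [371218770, 370133335, 370133335, 369934873, 369934873, 371019726, 370002732, 371087784,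
      370002732, 371147976, 370062748, 370062748, 369972042, 369972042, 371057004, 369972042,
      371057004, 369972042, 371147976, 370062748, 370062748, 370002732, 370002732, 371087784,
      369934873, 371019726, 369934873]]
  vec_zero := by decide +kernel
  vec_succ := by decide +kernel
  recurrence := by decide +kernel
  closed := by decide +kernel

def nineThreeMate_walkCertificate : WalkCertificate nineThreeMate 0 10
    (fun i => [3200, 5920, -13104, -8472, 6672, 2700, -1107, -252, 63, 7].getD i 0)
    (fun i => [1, 0, 10, 30, 462, 3510, 38786, 365190, 3741086, 36902410].getD i 0) where
  vec := tableVec (fun v => v.1.val * 3 + v.2.val)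
    [[1, 0, 0, 0, 0, 0, 0, 0, 0, 0, 0, 0, 0, 0, 0, 0, 0, 0, 0, 0, 0, 0, 0, 0, 0, 0, 0],
    [0, 0, 0, 1, 1, 1, 1, 0, 0, 0, 0, 0, 1, 0, 0, 1, 0, 0, 0, 0, 0, 1, 0, 0, 1, 1, 1],
    [10, 6, 6, 3, 2, 2, 5, 3, 3, 6, 4, 4, 3, 2, 2, 3, 2, 2, 6, 4, 4, 5, 3, 3, 3, 2, 2],
    [30, 24, 24, 51, 45, 45, 45, 36, 36, 32, 27, 27, 45, 36, 36, 45, 36, 36, 32, 27, 27, 45, 36, 36,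
      51, 45, 45],
    [462, 426, 426, 355, 330, 330, 379, 350, 350, 426, 396, 396, 361, 335, 335, 361, 335, 335, 426,
      396, 396, 379, 350, 350, 355, 330, 330],
    [3510, 3400, 3400, 3961, 3850, 3850, 3861, 3740, 3740, 3560, 3455, 3455, 3871, 3751, 3751, 3871,
      3751, 3751, 3560, 3455, 3455, 3861, 3740, 3740, 3961, 3850, 3850],
    [38786, 38304, 38304, 36603, 36162, 36162, 36933, 36477, 36477, 38368, 37905, 37905, 36735,
      36288, 36288, 36735, 36288, 36288, 38368, 37905, 37905, 36933, 36477, 36477, 36603, 36162,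
      36162],
    [365190, 363384, 363384, 375355, 373541, 373541, 373927, 372079, 372079, 366072, 364287, 364287,
      374179, 372337, 372337, 374179, 372337, 372337, 366072, 364287, 364287, 373927, 372079,
      372079, 375355, 373541, 373541],
    [3741086, 3733706, 3733706, 3691721, 3684495, 3684495, 3696451, 3689170, 3689170, 3735754,
      3728436, 3728436, 3694043, 3686790, 3686790, 3694043, 3686790, 3686790, 3735754, 3728436,
      3728436, 3696451, 3689170, 3689170, 3691721, 3684495, 3684495],
    [36902410, 36873342, 36873342, 37140561, 37111446, 37111446, 37120671, 37091439, 37091439,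
      36916350, 36887364, 36887364, 37125261, 37096056, 37096056, 37125261, 37096056, 37096056,
      36916350, 36887364, 36887364, 37120671, 37091439, 37091439, 37140561, 37111446, 37111446],
    [371218770, 371101896, 371101896, 370051165, 369934873, 369934873, 370119223, 370002732,
      370002732, 371147976, 371031309, 371031309, 370088443, 369972042, 369972042, 370088443,
      369972042, 369972042, 371147976, 371031309, 371031309, 370119223, 370002732, 370002732,
      370051165, 369934873, 369934873]]
  vec_zero := by decide +kernel
  vec_succ := by decide +kernel
  recurrence := by decide +kernel
  closed := by decide +kernel

theorem cospectral_nineThreeGraph_nineThreeMate : Cospectral nineThreeGraph nineThreeMate :=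
  nineThreeGraph_walkCertificate.cospectral nineThreeMate_walkCertificate
    (IsCayleyOnSubgroup.addCayleyGraph_self _).isVertexTransitive
    (IsCayleyOnSubgroup.addCayleyGraph_self _).isVertexTransitive rfl

/-- There is a triangle all of whose edges have exactly `n` common neighbours. -/
def HasTriangleOfCodegree {V : Type*} (Γ : SimpleGraph V) (n : ℕ) : Prop :=
  ∃ u : Fin 3 → V, ∀ i j, i ≠ j → Γ.Adj (u i) (u j) ∧
    Nat.card {w // Γ.Adj (u i) w ∧ Γ.Adj (u j) w} = n

theorem HasTriangleOfCodegree.of_iso {V W : Type*} {Γ : SimpleGraph V} {Δ : SimpleGraph W} {n : ℕ}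
    (h : HasTriangleOfCodegree Γ n) (f : Γ ≃g Δ) : HasTriangleOfCodegree Δ n := by
  obtain ⟨u, hu⟩ := h
  refine ⟨fun i => f (u i), fun i j hij => ⟨f.map_adj_iff.2 (hu i j hij).1, ?_⟩⟩
  rw [← (hu i j hij).2]
  exact (Nat.card_congr (f.toEquiv.subtypeEquiv (q := fun w =>
    Δ.Adj (f (u i)) w ∧ Δ.Adj (f (u j)) w)
    fun w => (and_congr f.map_adj_iff f.map_adj_iff).symm)).symm

/-- Consider edges whose ends have five common neighbours. In the first graph the subgroup 0 × C₃ is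
a triangle of such edges. In the second they change the first coordinate by ±2, and three changes of
±2 never add up to 0 modulo 9. -/
theorem not_nonempty_iso_nineThreeGraph_nineThreeMate :
    ¬Nonempty (nineThreeGraph ≃g nineThreeMate) := by
  rintro ⟨f⟩
  have h1 : HasTriangleOfCodegree nineThreeGraph 5 := by
    refine ⟨![(0, 0), (0, 1), (0, 2)], fun i j => ?_⟩
    rw [Nat.card_eq_fintype_card]
    revert i j
    decide +kernel
  obtain ⟨u, hu⟩ := h1.of_iso f
  have h2 : ∀ u v, nineThreeMate.Adj u v ∧
      Nat.card {w // nineThreeMate.Adj u w ∧ nineThreeMate.Adj v w} = 5 →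
      v.1 - u.1 = 2 ∨ v.1 - u.1 = 7 := by
    intro u v
    rw [Nat.card_eq_fintype_card]
    revert u v
    decide +kernel
  have h3 : ∀ a b c : ZMod 9, (a = 2 ∨ a = 7) → (b = 2 ∨ b = 7) → (c = 2 ∨ c = 7) →
      a + b + c ≠ 0 := by decide
  exact h3 _ _ _ (h2 _ _ (hu 0 1 (by decide))) (h2 _ _ (hu 1 2 (by decide)))
    (h2 _ _ (hu 2 0 (by decide))) (by ring)

theorem IsCayDSGroup.not_nineThreeGraph {G : Type*} [Group G] [Fintype G] (hG : IsCayDSGroup G) :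
    ¬IsCayleyOnSubgroup G nineThreeGraph := fun h =>
  not_nonempty_iso_nineThreeGraph_nineThreeMate (hG.nonempty_iso h
    (IsCayleyOnSubgroup.addCayleyGraph_self _)
    (connected_of_common_neighbor (by decide +kernel)) cospectral_nineThreeGraph_nineThreeMate)

/-- The homomorphism `(i, j) ↦ yⁱzʲ` for commuting `y, z` with `yⁿ = zⁿ = 1`. -/
def zmodPowProd {G : Type*} [Group G] (n : ℕ) [NeZero n] {y z : G} (hy : y ^ n = 1)
    (hz : z ^ n = 1) (h : Commute y z) :
    Multiplicative (ZMod n) × Multiplicative (ZMod n) →* G :=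
  (zmodPow n y hy).noncommCoprod (zmodPow n z hz) fun _ _ => h.pow_pow _ _

theorem zmodPowProd_apply {G : Type*} [Group G] (n : ℕ) [NeZero n] {y z : G} (hy : y ^ n = 1)
    (hz : z ^ n = 1) (h : Commute y z) (i j : Multiplicative (ZMod n)) :
    zmodPowProd n hy hz h (i, j) = zmodPow n y hy i * zmodPow n z hz j := rfl

theorem mem_zpowers_zmodPow {G : Type*} [Group G] (p : ℕ) [Fact p.Prime] {y : G} (hy : y ^ p = 1)
    {i : Multiplicative (ZMod p)} (hi : i ≠ 1) :
    y ∈ Subgroup.zpowers (zmodPow p y hy i) := by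
  by_cases hy1 : y = 1
  · simp [hy1]
  refine mem_zpowers_pow_iff.2 ?_
  rw [orderOf_eq_prime hy hy1]
  refine (Nat.coprime_of_lt_prime (fun h => hi ?_) (ZMod.val_lt _)
    (Fact.out : p.Prime)).symm
  exact Multiplicative.toAdd.injective ((ZMod.val_eq_zero _).1 h)

theorem zmodPowProd_injective {G : Type*} [Group G] (p : ℕ) [Fact p.Prime] {y z : G}
    (hy : y ^ p = 1) (hz : z ^ p = 1) (h : Commute y z) (hz1 : z ≠ 1)
    (hyz : y ∉ Subgroup.zpowers z) : Function.Injective (zmodPowProd p hy hz h) := by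
  have hy1 : y ≠ 1 := fun h => hyz (h ▸ one_mem _)
  refine (MonoidHom.noncommCoprod_injective _ _ _).2
    ⟨zmodPow_injective p y hy (orderOf_eq_prime hy hy1),
    zmodPow_injective p z hz (orderOf_eq_prime hz hz1), Subgroup.disjoint_def.2 ?_⟩
  rintro _ ⟨i, rfl⟩ ⟨j, hj⟩
  by_contra hi
  refine hyz ?_
  have h1 := mem_zpowers_zmodPow p hy (i := i) fun h => hi (by rw [h, map_one])
  rw [← hj] at h1
  exact Subgroup.zpowers_le.2 (zmodPow_mem_zpowers p z hz j) h1

/-- For t = 0 the group is the Heisenberg group, on which `hammingMate` is defined. For t ≠ 0 it is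
the nonabelian group of exponent 9, which acts regularly on the Hamming graph; the tables f list the
vertex that corresponds to each normal form. -/
theorem isCayleyOnSubgroup_of_order27 {G : Type*} [Group G] {x y z : G} (hy : y ^ 3 = 1)
    (hz : z ^ 3 = 1) (hyz : Commute y z) (hxz : Commute x z) {t : ZMod 3}
    (hxy : x * y * x⁻¹ = y * z) (hx : x ^ 3 = zmodPow 3 z hz (.ofAdd t))
    (hz1 : z ≠ 1) (hy1 : y ∉ Subgroup.zpowers z)
    (hx1 : ∀ j k, x ≠ zmodPow 3 y hy j * zmodPow 3 z hz k) :
    IsCayleyOnSubgroup G hammingGraph ∨ IsCayleyOnSubgroup G hammingMate := by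
  have key := fun Γ => IsCayleyOnSubgroup.of_order27 hy hz hyz hxz (s := 1)
    (by rw [zmodPow_one, hxy]) hx hz1 hy1 hx1 (Γ := Γ)
  have three : ∀ i : ZMod 3, i = 0 ∨ i = 1 ∨ i = 2 := by decide
  obtain rfl | rfl | rfl := three t
  · exact .inr (key _ _ fun _ _ => Iff.rfl)
  · let f : ZMod 3 × ZMod 3 × ZMod 3 → ZMod 3 × ZMod 3 × ZMod 3 := fun u =>
      [(0, 0, 0), (1, 1, 1), (2, 2, 2), (0, 1, 2), (1, 2, 0), (2, 0, 1), (0, 2, 1), (1, 0, 2),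
        (2, 1, 0), (0, 0, 1), (1, 1, 2), (2, 2, 0), (0, 1, 0), (1, 2, 1), (2, 0, 2), (0, 2, 2),
        (1, 0, 0), (2, 1, 1), (1, 0, 1), (2, 1, 2), (0, 2, 0), (1, 1, 0), (2, 2, 1), (0, 0, 2),
        (1, 2, 2), (2, 0, 0), (0, 1, 1)].getD (u.1.val * 9 + u.2.1.val * 3 + u.2.2.val) 0
    obtain ⟨g⟩ := nonempty_iso_comap hammingGraph f (by decide +kernel) rfl
    exact .inl (.of_iso (key (hammingGraph.comap f)
      {(1, 0, 0), (1, 1, 0), (1, 2, 1), (2, 0, 2), (2, 1, 2), (2, 2, 1)} (by decide +kernel)) g)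
  · let f : ZMod 3 × ZMod 3 × ZMod 3 → ZMod 3 × ZMod 3 × ZMod 3 := fun u =>
      [(0, 0, 0), (1, 2, 2), (2, 1, 1), (0, 1, 2), (1, 0, 1), (2, 2, 0), (0, 2, 1), (1, 1, 0),
        (2, 0, 2), (0, 0, 1), (1, 2, 0), (2, 1, 2), (0, 1, 0), (1, 0, 2), (2, 2, 1), (0, 2, 2),
        (1, 1, 1), (2, 0, 0), (0, 1, 1), (1, 0, 0), (2, 2, 2), (0, 2, 0), (1, 1, 2), (2, 0, 1),
        (0, 0, 2), (1, 2, 1), (2, 1, 0)].getD (u.1.val * 9 + u.2.1.val * 3 + u.2.2.val) 0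
    obtain ⟨g⟩ := nonempty_iso_comap hammingGraph f (by decide +kernel) rfl
    exact .inl (.of_iso (key (hammingGraph.comap f)
      {(1, 0, 0), (1, 1, 0), (1, 2, 2), (2, 0, 1), (2, 1, 0), (2, 2, 0)} (by decide +kernel)) g)

/-- The group is C₃³ if x³ = 1. If x³ = z it is C₉ × C₃, with xⁱyʲzᵏ corresponding to (i + 3k, j).
-/
theorem isCayleyOnSubgroup_of_order27_comm {G : Type*} [Group G] {x y z : G} (hy : y ^ 3 = 1)
    (hz : z ^ 3 = 1) (hyz : Commute y z) (hxz : Commute x z) (hxy : Commute x y)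
    (hx : x ^ 3 = 1 ∨ x ^ 3 = z)
    (hz1 : z ≠ 1) (hy1 : y ∉ Subgroup.zpowers z)
    (hx1 : ∀ j k, x ≠ zmodPow 3 y hy j * zmodPow 3 z hz k) :
    IsCayleyOnSubgroup G hammingGraph ∨ IsCayleyOnSubgroup G nineThreeGraph := by
  have key := fun Γ t ht => IsCayleyOnSubgroup.of_order27 hy hz hyz hxz (s := 0) (t := t)
    (by rw [ofAdd_zero, map_one, mul_one, hxy.eq, mul_inv_cancel_right]) ht hz1 hy1 hx1 (Γ := Γ)
  obtain hx | hx := hx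
  · exact .inl (key _ 0 (by rw [ofAdd_zero, map_one, hx])
      {(1, 0, 0), (2, 0, 0), (0, 1, 0), (0, 2, 0), (0, 0, 1), (0, 0, 2)} (by decide +kernel))
  · let f : ZMod 3 × ZMod 3 × ZMod 3 → ZMod 9 × ZMod 3 := fun u =>
      ((u.1.val + 3 * u.2.2.val : ℕ), u.2.1)
    obtain ⟨g⟩ := nonempty_iso_comap nineThreeGraph f (by decide +kernel) rfl
    exact .inr (.of_iso (key (nineThreeGraph.comap f) 1 (by rw [zmodPow_one, hx])
      {(0, 1, 0), (0, 1, 1), (0, 1, 2), (0, 2, 0), (0, 2, 1), (0, 2, 2), (1, 0, 0), (1, 1, 0),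
        (2, 0, 2), (2, 2, 2)}
      (by decide +kernel)) g)

theorem multiplicative_zmod_three_pow :
    ∀ i : Multiplicative (ZMod 3) × Multiplicative (ZMod 3), i ^ 3 = 1 := by decide

/-- The subgroup E = ⟨y, z⟩ has order 9 and index 3, so it is normal and contains all cubes. After
rechoosing y, z in E so that z commutes with some x outside E, the conjugation action of x on y and
the cube of x put the group into one of the presentations above. -/
theorem isCayleyOnSubgroup_of_card_eq {Q : Type*} [Group Q] [Finite Q] (hQ : Nat.card Q = 27)
    {y z : Q} (hy : y ^ 3 = 1) (hz : z ^ 3 = 1) (hyz : Commute y z) (hz1 : z ≠ 1)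
    (hy1 : y ∉ Subgroup.zpowers z) :
    IsCayleyOnSubgroup Q hammingGraph ∨ IsCayleyOnSubgroup Q hammingMate ∨
      IsCayleyOnSubgroup Q nineThreeGraph := by
  have three : ∀ i : Multiplicative (ZMod 3), i = 1 ∨ i = .ofAdd 1 ∨ i = .ofAdd (-1) := by decide
  have : Fact (Nat.Prime 3) := ⟨Nat.prime_three⟩
  have hP : IsPGroup 3 Q := IsPGroup.of_card (n := 3) hQ
  have hnt : Nontrivial Q := ⟨z, 1, hz1⟩
  obtain ⟨E, hE⟩ : ∃ E : Subgroup Q, E = (zmodPowProd 3 hy hz hyz).range := ⟨_, rfl⟩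
  have hEcard : Nat.card E = 9 := by
    rw [hE, ← Nat.card_congr ((zmodPowProd 3 hy hz hyz).ofInjective
      (zmodPowProd_injective 3 hy hz hyz hz1 hy1)).toEquiv]
    simp [Nat.card_eq_fintype_card]
  have hEcomm : ∀ a ∈ E, ∀ b ∈ E, Commute a b := by
    rw [hE]
    rintro _ ⟨a, rfl⟩ _ ⟨b, rfl⟩
    exact (Commute.all a b).map _
  have hE3 : ∀ a ∈ E, a ^ 3 = 1 := by
    rw [hE]
    rintro _ ⟨i, rfl⟩
    rw [← map_pow, multiplicative_zmod_three_pow, map_one]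
  have hspan : ∀ b ∈ E, ∀ c ∈ E, ∀ (hb : b ^ 3 = 1) (hc : c ^ 3 = 1), c ≠ 1 →
      b ∉ Subgroup.zpowers c → ∀ a ∈ E, ∃ j k, a = zmodPow 3 b hb j * zmodPow 3 c hc k := by
    intro b hbE c hcE hb hc hc1 hbc a ha
    have hle : (zmodPowProd 3 hb hc (hEcomm b hbE c hcE)).range ≤ E := by
      rintro _ ⟨⟨i, j⟩, rfl⟩
      exact mul_mem (pow_mem hbE _) (pow_mem hcE _)
    have heq := Subgroup.eq_of_le_of_card_ge hle (by
      rw [hEcard, ← Nat.card_congr ((zmodPowProd 3 hb hc (hEcomm b hbE c hcE)).ofInjective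
        (zmodPowProd_injective 3 hb hc _ hc1 hbc)).toEquiv]
      simp [Nat.card_eq_fintype_card])
    rw [← heq] at ha
    obtain ⟨⟨j, k⟩, rfl⟩ := ha
    exact ⟨j, k, rfl⟩
  have hindex : E.index = 3 := by
    have := E.card_mul_index
    rw [hEcard, hQ] at this
    omega
  have hnormal : E.Normal := Subgroup.normal_of_index_eq_minFac_card (by rw [hindex, hQ]; norm_num)
  have hcube : ∀ a, a ^ 3 ∈ E := fun a => hindex ▸ E.pow_index_mem a
  have hex : ∀ c ∈ E, ∃ b ∈ E, b ∉ Subgroup.zpowers c := by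
    intro c hc
    by_contra! h
    have h1 := Subgroup.card_le_of_le (show E ≤ Subgroup.zpowers c from h)
    rw [Nat.card_zpowers, hEcard] at h1
    have := orderOf_le_of_pow_eq_one (by norm_num) (hE3 c hc)
    omega
  -- A nontrivial central element serves as z if it lies in E, and as x otherwise.
  have hcent : ∃ x z, x ∉ E ∧ z ∈ E ∧ z ≠ 1 ∧ Commute x z := by
    have := hP.center_nontrivial
    obtain ⟨⟨c, hc⟩, hc1⟩ := exists_ne (1 : Subgroup.center Q)
    have hc1 : c ≠ 1 := fun h => hc1 (Subtype.ext h)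
    by_cases hcE : c ∈ E
    · obtain ⟨x, hx⟩ : ∃ x, x ∉ E := by
        by_contra! h
        rw [(Subgroup.eq_top_iff' E).2 h, Subgroup.card_top] at hEcard
        omega
      exact ⟨x, c, hx, hcE, hc1, Subgroup.mem_center_iff.1 hc x⟩
    · refine ⟨c, z, hcE, ?_, hz1, (Subgroup.mem_center_iff.1 hc z).symm⟩
      rw [hE]
      exact ⟨(1, .ofAdd 1), by rw [zmodPowProd_apply, map_one, one_mul, zmodPow_one]⟩
  clear hE hy1 hz1 hyz hz hy
  clear y z
  obtain ⟨x, z, hx, hzE, hz1, hxz⟩ := hcent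
  have hxE : ∀ b ∈ E, ∀ c ∈ E, ∀ (hb : b ^ 3 = 1) (hc : c ^ 3 = 1) j k,
      x ≠ zmodPow 3 b hb j * zmodPow 3 c hc k := by
    rintro b hb c hc _ _ _ _ rfl
    exact hx (mul_mem (pow_mem hb _) (pow_mem hc _))
  have hz := hE3 z hzE
  obtain ⟨y, hyE, hyz⟩ := hex z hzE
  have hy := hE3 y hyE
  by_cases hxy : Commute x y
  · rcases eq_or_ne (x ^ 3) 1 with hx3 | hx3
    · rcases isCayleyOnSubgroup_of_order27_comm hy hz (hEcomm y hyE z hzE) hxz hxy (.inl hx3) hz1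
        hyz (hxE y hyE z hzE hy hz) with h | h
      · exact .inl h
      · exact .inr (.inr h)
    -- The group is abelian and x³ ≠ 1, so x³ takes the role of z.
    · obtain ⟨b, hbE, hb⟩ := hex _ (hcube x)
      have hxb : Commute x b := by
        obtain ⟨j, k, rfl⟩ := hspan y hyE z hzE hy hz hz1 hyz b hbE
        exact (hxy.pow_right _).mul_right (hxz.pow_right _)
      rcases isCayleyOnSubgroup_of_order27_comm (hE3 b hbE) (hE3 _ (hcube x))
        (hEcomm b hbE _ (hcube x)) (Commute.self_pow x 3) hxb (.inr rfl) hx3 hb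
        (hxE b hbE _ (hcube x) _ _) with h | h
      · exact .inl h
      · exact .inr (.inr h)
  · obtain ⟨i, s, his⟩ := hspan y hyE z hzE hy hz hz1 hyz _ (hnormal.conj_mem y hyE x)
    set c := zmodPow 3 z hz s with hc
    have hcz : c ∈ Subgroup.zpowers z := zmodPow_mem_zpowers 3 z hz s
    have hcE : c ∈ E := pow_mem hzE _
    have hxc : Commute x c := hxz.pow_right _
    have hyc : Commute y c := hEcomm y hyE c hcE
    rcases three i with rfl | rfl | rfl
    · rw [map_one, one_mul, mul_inv_eq_iff_eq_mul, hxc.symm.eq] at his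
      exact absurd (mul_left_cancel his ▸ hcz) hyz
    · rw [zmodPow_one] at his
      have hc1 : c ≠ 1 := by
        rintro h
        rw [h, mul_one, mul_inv_eq_iff_eq_mul] at his
        exact hxy his
      have hyc1 : y ∉ Subgroup.zpowers c := fun h => hyz (Subgroup.zpowers_le.2 hcz h)
      obtain ⟨j, t, hjt⟩ := hspan y hyE c hcE hy (hE3 c hcE) hc1 hyc1 _ (hcube x)
      -- In multiplicative notation this says that the exponent of y in x³ is zero: otherwise x,
      -- which commutes with x³ and c, would commute with y.
      have hj : j = 1 := by
        by_contra hj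
        obtain ⟨n, hn⟩ := (mem_powers_iff_mem_zpowers).2 (mem_zpowers_zmodPow 3 hy hj)
        have h1 : Commute x (zmodPow 3 y hy j) := by
          rw [← mul_inv_eq_iff_eq_mul] at hjt
          rw [← hjt]
          exact (Commute.self_pow x 3).mul_right (hxc.pow_right _).inv_right
        refine hxy ?_
        rw [← hn]
        exact h1.pow_right n
      rw [hj, map_one, one_mul] at hjt
      rcases isCayleyOnSubgroup_of_order27 hy (hE3 c hcE) hyc hxc his (t := t.toAdd) hjt hc1 hyc1
        (hxE y hyE c hcE _ _) with h | h
      · exact .inl h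
      · exact .inr (.inl h)
    -- If x inverted y modulo ⟨z⟩, then x² would centralize y; so does x³ ∈ E, and hence x would as
    -- well.
    · rw [ofAdd_neg, map_inv, zmodPow_one] at his
      have h2 : x * (x * y * x⁻¹) * x⁻¹ = y := by
        conv_lhs => rw [his]
        have h3 : x * (y⁻¹ * c) * x⁻¹ = (x * y * x⁻¹)⁻¹ * (x * c * x⁻¹) := by group
        rw [h3, his, hxc.eq, mul_inv_cancel_right, mul_inv_rev, inv_inv, ← hyc.inv_right.eq,
          inv_mul_cancel_right]
      have h3 : x ^ 3 * y = y * x ^ 3 := hEcomm _ (hcube x) y hyE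
      have h4 : x * (x * (x * y * x⁻¹) * x⁻¹) * x⁻¹ = y := by
        rw [← mul_inv_eq_iff_eq_mul] at h3
        refine Eq.trans ?_ h3
        simp only [pow_succ, pow_zero, one_mul, mul_inv_rev, mul_assoc]
      rw [h2, mul_inv_eq_iff_eq_mul] at h4
      exact absurd h4 hxy

/-! ### Noncyclic p-groups for odd p -/

theorem conj_pow_zpow {G : Type*} [Group G] {a x : G} {r : ℤ} (h : x * a * x⁻¹ = a ^ r) (i : ℤ) :
    x * a ^ i = a ^ (r * i) * x := by
  rw [← mul_inv_eq_iff_eq_mul, ← conj_zpow, h, zpow_mul]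

theorem pow_mul_eq_zpow_mul {G : Type*} [Group G] {a x : G} {r : ℤ} (h : x * a * x⁻¹ = a ^ r)
    (n : ℕ) : x ^ n * a = a ^ (r ^ n) * x ^ n := by
  induction n with
  | zero => simp
  | succ n ih =>
    rw [pow_succ', mul_assoc, ih, ← mul_assoc, conj_pow_zpow h, mul_assoc, ← pow_succ' r]

theorem zpow_mul_pow {G : Type*} [Group G] {a x : G} {r : ℤ} (h : x * a * x⁻¹ = a ^ r) (i : ℤ)
    (n : ℕ) : (a ^ i * x) ^ n = a ^ (i * ∑ j ∈ Finset.range n, r ^ j) * x ^ n := by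
  induction n with
  | zero => simp
  | succ n ih =>
    rw [pow_succ', ih, geom_sum_succ, mul_assoc, ← mul_assoc x, conj_pow_zpow h, pow_succ' x,
      mul_assoc, ← mul_assoc, ← zpow_add]
    congr 2
    ring

/-- A maximal cyclic subgroup of a noncyclic `p`-group, for odd `p`, has a complement of
order `p`. -/
theorem exists_pow_eq_one_of_index_prime {G : Type*} [Group G] [Finite G] {p m : ℕ}
    [hp : Fact p.Prime] (hp2 : p ≠ 2) (hG : ¬IsCyclic G) {a : G} (ha : orderOf a = p ^ (m + 1))
    (hcard : Nat.card G = p ^ (m + 2)) :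
    ∃ y : G, y ^ p = 1 ∧ y ∉ Subgroup.zpowers a ∧ Commute y (a ^ (p ^ m)) := by
  have hodd := hp.out.odd_of_ne_two hp2
  have hindex : (Subgroup.zpowers a).index = p := by
    have := (Subgroup.zpowers a).card_mul_index
    rw [Nat.card_zpowers, ha, hcard, pow_succ _ (m + 1)] at this
    exact Nat.eq_of_mul_eq_mul_left (pow_pos hp.out.pos _) this
  have hnormal : (Subgroup.zpowers a).Normal :=
    Subgroup.normal_of_index_eq_minFac_card (by
      rw [hindex, hcard, Nat.Prime.pow_minFac hp.out (by omega)])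
  obtain ⟨x, hx⟩ : ∃ x, x ∉ Subgroup.zpowers a := by
    by_contra! h
    exact hG ⟨a, h⟩
  obtain ⟨r, hr⟩ := hnormal.conj_mem a (Subgroup.mem_zpowers a) x
  obtain ⟨k, hk⟩ := hindex ▸ (Subgroup.zpowers a).pow_index_mem x
  replace hr : x * a * x⁻¹ = a ^ r := hr.symm
  replace hk : x ^ p = a ^ k := hk.symm
  have hpa : (p : ℤ) ∣ orderOf a := by
    rw [ha, pow_succ]; push_cast; exact Dvd.intro_left _ rfl
  -- The element x^p lies in ⟨a⟩ and centralizes a, so r^p ≡ 1 modulo p; Fermat gives r ≡ 1.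
  have hr1 : (p : ℤ) ∣ r - 1 := by
    have h1 := pow_mul_eq_zpow_mul hr p
    rw [hk, (Commute.self_zpow a k).symm.eq] at h1
    have h2 : a ^ (r ^ p - 1) = 1 := by
      rw [zpow_sub, zpow_one, ← mul_right_cancel h1, mul_inv_cancel]
    have h3 := hpa.trans (orderOf_dvd_iff_zpow_eq_one.2 h2)
    rw [← ZMod.intCast_zmod_eq_zero_iff_dvd] at h3 ⊢
    push_cast at h3 ⊢
    rwa [ZMod.pow_card] at h3
  -- Otherwise x^p generates ⟨a⟩, so ⟨a⟩ ≤ ⟨x⟩; then ⟨x⟩ is the whole group or equals ⟨a⟩, and both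
  -- are excluded.
  obtain ⟨k', rfl⟩ : (p : ℤ) ∣ k := by
    by_contra hpk
    have h1 : a ∈ Subgroup.zpowers (a ^ k) := by
      rw [mem_zpowers_zpow_iff, ha, Int.gcd_comm]
      refine Int.isCoprime_iff_gcd_eq_one.1 ?_
      push_cast
      exact ((Nat.prime_iff_prime_int.1 hp.out).coprime_iff_not_dvd.2 hpk).pow_left
    have hle : Subgroup.zpowers a ≤ Subgroup.zpowers x := by
      rw [Subgroup.zpowers_le]
      rw [← hk] at h1
      exact Subgroup.zpowers_le.2 (Subgroup.npow_mem_zpowers x p) h1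
    have h2 : (Subgroup.zpowers x).index ∣ p := hindex ▸ Subgroup.index_dvd_of_le hle
    rcases (Nat.dvd_prime hp.out).1 h2 with h3 | h3
    · exact hG (isCyclic_iff_exists_zpowers_eq_top.2 ⟨x, Subgroup.index_eq_one.1 h3⟩)
    · refine hx ((Subgroup.eq_of_le_of_card_ge hle ?_).symm ▸ Subgroup.mem_zpowers x)
      have h4 := (Subgroup.zpowers x).card_mul_index
      rw [← (Subgroup.zpowers a).card_mul_index, h3, hindex] at h4
      exact (Nat.eq_of_mul_eq_mul_right hp.out.pos h4).le
  -- For odd p and r ≡ 1 modulo p, the sum 1 + r + ⋯ + r^(p-1) is p modulo p². This fails for p = 2.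
  obtain ⟨u, hu, hup⟩ : ∃ u : ℤ, ∑ j ∈ Finset.range p, r ^ j = p * u ∧ ¬(p : ℤ) ∣ u := by
    obtain ⟨b, hb⟩ := hr1
    obtain ⟨q, hq⟩ := odd_sq_dvd_geom_sum₂_sub (R := ℤ) (a := 1) (b := b) hodd
    have h2 : 1 + p * b = r := by rw [← hb]; ring
    simp only [h2, one_pow, mul_one] at hq
    refine ⟨1 + p * q, by linear_combination hq, fun h => ?_⟩
    have := (Int.dvd_add_left (Dvd.intro _ rfl)).1 h
    exact hp.out.one_lt.ne' (by exact_mod_cast Int.eq_one_of_dvd_one (by positivity) this)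
  obtain ⟨s, t, hst⟩ : IsCoprime u (orderOf a : ℤ) := by
    rw [ha]
    push_cast
    exact ((Nat.prime_iff_prime_int.1 hp.out).coprime_iff_not_dvd.2 hup).symm.pow_right
  -- The p-th power of aⁱx is a to the power p(iu + k'); the choice i = -k's, with s inverse to u
  -- modulo the order of a, makes it trivial.
  refine ⟨a ^ (-k' * s) * x, ?_, fun h => hx ?_, ?_⟩
  · rw [zpow_mul_pow hr, hu, hk, ← zpow_add, ← orderOf_dvd_iff_zpow_eq_one]
    exact ⟨p * k' * t, by linear_combination -p * k' * hst⟩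
  · exact (Subgroup.mul_mem_cancel_left _ (Subgroup.zpow_mem_zpowers _ _)).1 h
  · refine Commute.mul_left ((Commute.refl a).pow_right _ |>.zpow_left _) ?_
    have h1 := conj_pow_zpow hr (p ^ m : ℕ)
    rw [zpow_natCast] at h1
    refine h1.trans ?_
    congr 1
    rw [← zpow_natCast a (p ^ m), zpow_eq_zpow_iff_modEq, ha]
    obtain ⟨b, hb⟩ := hr1
    refine (Int.modEq_iff_dvd.2 ⟨b, ?_⟩).symm
    push_cast
    linear_combination (p : ℤ) ^ m * hb

/-- Induct on the order through a subgroup M of index p. If M is not cyclic it already contains the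
pair. If M = ⟨a⟩, combine its subgroup of order p with the element of
`exists_pow_eq_one_of_index_prime`. -/
theorem IsPGroup.exists_commute_of_not_isCyclic {p : ℕ} [hp : Fact p.Prime] (hp2 : p ≠ 2)
    {G : Type*} [Group G] [Finite G] (hP : IsPGroup p G) (hG : ¬IsCyclic G) :
    ∃ y z : G, y ^ p = 1 ∧ z ^ p = 1 ∧ Commute y z ∧ z ≠ 1 ∧ y ∉ Subgroup.zpowers z := by
  obtain ⟨n, hn⟩ := IsPGroup.iff_card.1 hP
  induction n generalizing G with
  | zero =>
    have := (Nat.card_eq_one_iff_unique.1 (hn.trans (pow_zero p))).1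
    exact absurd isCyclic_of_subsingleton hG
  | succ n ih =>
    obtain ⟨M, hM⟩ := Sylow.exists_subgroup_card_pow_prime (G := G) p (n := n)
      (hn ▸ pow_dvd_pow p n.le_succ)
    by_cases hMc : IsCyclic M
    · obtain _ | m := n
      · exact absurd (isCyclic_of_prime_card (hn.trans (pow_one p))) hG
      obtain ⟨a, ha⟩ := Subgroup.isCyclic_iff_exists_zpowers_eq_top M |>.1 hMc
      have ho : orderOf a = p ^ (m + 1) := by rw [← Nat.card_zpowers, ha, hM]
      obtain ⟨y, hy, hya, hcomm⟩ := exists_pow_eq_one_of_index_prime hp2 hG ho hn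
      refine ⟨y, a ^ p ^ m, hy, ?_, hcomm, fun h => ?_, fun h => hya ?_⟩
      · rw [← pow_mul, ← pow_succ, ← ho, pow_orderOf_eq_one]
      · have := Nat.le_of_dvd (pow_pos hp.out.pos _) (orderOf_dvd_of_pow_eq_one h)
        rw [ho] at this
        exact absurd this (not_le.2 (Nat.pow_lt_pow_right hp.out.one_lt m.lt_succ_self))
      · exact Subgroup.zpowers_le.2 (Subgroup.npow_mem_zpowers _ _) h
    · obtain ⟨y, z, hy, hz, hyz, hz1, hyz1⟩ := ih (hP.to_subgroup M) hMc hM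
      refine ⟨y, z, congrArg Subtype.val hy, congrArg Subtype.val hz,
        congrArg Subtype.val hyz, fun h => hz1 (Subtype.ext h), fun ⟨i, hi⟩ => hyz1 ⟨i, ?_⟩⟩
      exact Subtype.ext hi

/-! ### Nets and their collinearity graphs -/

/-- A net on `V`: a family of partitions of `V`, the fibres of the maps `ℓ i : V → K`, such that
parts of different partitions meet in exactly one point. -/
def IsNet {ι V K : Type*} (ℓ : ι → V → K) : Prop :=
  ∀ i j, i ≠ j → Function.Bijective fun v => (ℓ i v, ℓ j v)

/-- The collinearity graph of a net. -/
def netGraph {ι V K : Type*} (ℓ : ι → V → K) : SimpleGraph V where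
  Adj u v := u ≠ v ∧ ∃ i, ℓ i u = ℓ i v
  symm := ⟨fun _ _ h => ⟨h.1.symm, h.2.imp fun _ => Eq.symm⟩⟩
  loopless := ⟨fun _ h => h.1 rfl⟩

theorem IsNet.eq_of_eq {ι V K : Type*} {ℓ : ι → V → K} (hℓ : IsNet ℓ) {i j : ι} {u v : V}
    (hi : ℓ i u = ℓ i v) (hj : ℓ j u = ℓ j v) (huv : u ≠ v) : i = j := by
  by_contra hij
  exact huv ((hℓ i j hij).1 (Prod.ext hi hj))

theorem IsNet.exists_eq {ι V K : Type*} {ℓ : ι → V → K} (hℓ : IsNet ℓ) {i j : ι} (hij : i ≠ j)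
    (a b : K) : ∃ v, ℓ i v = a ∧ ℓ j v = b := by
  obtain ⟨v, hv⟩ := (hℓ i j hij).2 (a, b)
  exact ⟨v, congrArg Prod.fst hv, congrArg Prod.snd hv⟩

/-- Distinct points agree in at most one partition, so among three there are two, i and j, in which
they differ. The i-part of u meets the j-part of v in a common neighbour. -/
theorem IsNet.connected {ι V K : Type*} {ℓ : ι → V → K} (hℓ : IsNet ℓ) {i j k : ι} (hij : i ≠ j)
    (hik : i ≠ k) (hjk : j ≠ k) [Nonempty V] [Nontrivial K] : (netGraph ℓ).Connected := by
  refine connected_of_common_neighbor fun u v => ?_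
  have key : ∀ i j, i ≠ j → ℓ i u ≠ ℓ i v → ℓ j u ≠ ℓ j v →
      ∃ w, (netGraph ℓ).Adj u w ∧ (netGraph ℓ).Adj w v := by
    intro i j hij hi hj
    obtain ⟨w, hwi, hwj⟩ := hℓ.exists_eq hij (ℓ i u) (ℓ j v)
    refine ⟨w, ⟨?_, i, hwi.symm⟩, ?_, j, hwj⟩
    · rintro rfl
      exact hj hwj
    · rintro rfl
      exact hi hwi.symm
  by_cases huv : u = v
  · subst huv
    obtain ⟨a, ha⟩ := exists_ne (ℓ j u)
    obtain ⟨w, hwi, hwj⟩ := hℓ.exists_eq hij (ℓ i u) a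
    have huw : u ≠ w := by
      rintro rfl
      exact ha hwj.symm
    exact ⟨w, ⟨huw, i, hwi.symm⟩, huw.symm, i, hwi⟩
  by_cases hi : ℓ i u = ℓ i v
  · exact key j k hjk (fun h => hij (hℓ.eq_of_eq hi h huv)) fun h => hik (hℓ.eq_of_eq hi h huv)
  by_cases hj : ℓ j u = ℓ j v
  · exact key i k hik hi fun h => hjk (hℓ.eq_of_eq hj h huv)
  · exact key i j hij hi hj

section Matrix

set_option linter.unusedSectionVars false

variable {ι V K : Type*} [Fintype ι] [Nontrivial ι] [DecidableEq ι] [Fintype V] [DecidableEq V]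
  [Fintype K] [DecidableEq K] {ℓ : ι → V → K}

theorem IsNet.card_eq (hℓ : IsNet ℓ) : Fintype.card V = Fintype.card K ^ 2 := by
  obtain ⟨i, j, hij⟩ := exists_pair_ne ι
  rw [Fintype.card_of_bijective (hℓ i j hij), Fintype.card_prod, sq]

theorem IsNet.card_fiber (hℓ : IsNet ℓ) (i : ι) (a : K) :
    (Finset.univ.filter fun v => ℓ i v = a).card = Fintype.card K := by
  obtain ⟨j, hij⟩ := exists_ne i
  rw [← Finset.card_univ]
  refine Finset.card_bij (fun v _ => ℓ j v) (by simp) ?_ fun b _ => ?_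
  · intro u hu v hv huv
    simp only [Finset.mem_filter, Finset.mem_univ, true_and] at hu hv
    exact (hℓ j i hij).1 (Prod.ext huv (hu.trans hv.symm))
  · obtain ⟨v, hv⟩ := hℓ.exists_eq hij b a
    exact ⟨v, by simp [hv.2], hv.1⟩

/-- The matrix of the equivalence relation given by one partition of a net. -/
def netMatrix (ℓ : ι → V → K) (i : ι) : Matrix V V ℝ :=
  Matrix.of fun u v => if ℓ i u = ℓ i v then 1 else 0

theorem IsNet.netMatrix_mul_self (hℓ : IsNet ℓ) (i : ι) :
    netMatrix ℓ i * netMatrix ℓ i = (Fintype.card K : ℝ) • netMatrix ℓ i := by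
  ext u v
  simp only [netMatrix, Matrix.mul_apply, Matrix.of_apply, Matrix.smul_apply, mul_ite, mul_one,
    mul_zero, smul_eq_mul, ← ite_and]
  split_ifs with h
  · rw [Finset.sum_boole, ← hℓ.card_fiber i (ℓ i v)]
    congr! 4 with w
    rw [h]
    exact ⟨fun h => h.1, fun h => ⟨h, h.symm⟩⟩
  · refine Finset.sum_eq_zero fun w _ => if_neg fun h' => h (h'.2.trans h'.1)

theorem IsNet.netMatrix_mul (hℓ : IsNet ℓ) {i j : ι} (hij : i ≠ j) :
    netMatrix ℓ i * netMatrix ℓ j = Matrix.of fun _ _ => 1 := by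
  ext u v
  simp only [netMatrix, Matrix.mul_apply, Matrix.of_apply, mul_ite, mul_one, mul_zero, ← ite_and]
  obtain ⟨w, hwi, hwj⟩ := hℓ.exists_eq hij (ℓ i u) (ℓ j v)
  rw [Finset.sum_eq_single w, if_pos ⟨hwj, hwi.symm⟩]
  · intro w' _ hw'
    exact if_neg fun h => hw' ((hℓ i j hij).1 (Prod.ext (h.2.symm.trans hwi.symm)
      (h.1.trans hwj.symm)))
  · simp

theorem IsNet.netMatrix_mul_ones (hℓ : IsNet ℓ) (i : ι) :
    netMatrix ℓ i * (Matrix.of fun _ _ => 1 : Matrix V V ℝ) =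
      (Fintype.card K : ℝ) • Matrix.of fun _ _ => 1 := by
  ext u v
  simp only [netMatrix, Matrix.mul_apply, Matrix.of_apply, mul_one, Finset.sum_boole,
    Matrix.smul_apply, smul_eq_mul]
  rw [← hℓ.card_fiber i (ℓ i u)]
  congr! 3
  exact eq_comm

theorem IsNet.adjMatrix_netGraph (hℓ : IsNet ℓ) [DecidableRel (netGraph ℓ).Adj] :
    (netGraph ℓ).adjMatrix ℝ = ∑ i, netMatrix ℓ i - (Fintype.card ι : ℝ) • 1 := by
  ext u v
  simp only [SimpleGraph.adjMatrix_apply, Matrix.sub_apply, Matrix.sum_apply, netMatrix,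
    Matrix.of_apply, Matrix.smul_apply, Matrix.one_apply, smul_eq_mul]
  by_cases huv : u = v
  · subst huv
    simp
  rw [if_neg huv, mul_zero, sub_zero]
  split_ifs with h
  · obtain ⟨-, i, hi⟩ := h
    rw [Finset.sum_eq_single i, if_pos hi]
    · exact fun j _ hj => if_neg fun h => hj (hℓ.eq_of_eq h hi huv)
    · simp
  · exact (Finset.sum_eq_zero fun i _ => if_neg fun hi => h ⟨huv, i, hi⟩).symm

theorem IsNet.sum_netMatrix_mul_self (hℓ : IsNet ℓ) :
    (∑ i, netMatrix ℓ i) * ∑ i, netMatrix ℓ i =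
      (Fintype.card K : ℝ) • ∑ i, netMatrix ℓ i +
        ((Fintype.card ι : ℝ) * (Fintype.card ι - 1)) • Matrix.of fun _ _ => 1 := by
  have h1 : ∀ i, netMatrix ℓ i * ∑ j, netMatrix ℓ j =
      (Fintype.card K : ℝ) • netMatrix ℓ i +
        ((Fintype.card ι : ℝ) - 1) • Matrix.of fun _ _ => 1 := by
    intro i
    rw [← Finset.add_sum_erase _ _ (Finset.mem_univ i), mul_add, hℓ.netMatrix_mul_self,
      Finset.mul_sum, Finset.sum_congr rfl fun j hj =>
        hℓ.netMatrix_mul (Finset.ne_of_mem_erase hj).symm, Finset.sum_const,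
      Finset.card_erase_of_mem (Finset.mem_univ i), Finset.card_univ, ← Nat.cast_smul_eq_nsmul ℝ,
      Nat.cast_sub Fintype.card_pos, Nat.cast_one]
  rw [Finset.sum_mul, Finset.sum_congr rfl fun i _ => h1 i, Finset.sum_add_distrib,
    ← Finset.smul_sum, Finset.sum_const, Finset.card_univ, ← Nat.cast_smul_eq_nsmul ℝ, smul_smul]

theorem IsNet.adjMatrix_mul_self (hℓ : IsNet ℓ) [DecidableRel (netGraph ℓ).Adj] :
    (netGraph ℓ).adjMatrix ℝ * (netGraph ℓ).adjMatrix ℝ =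
      ((Fintype.card K : ℝ) - 2 * Fintype.card ι) • (netGraph ℓ).adjMatrix ℝ +
        ((Fintype.card K : ℝ) * Fintype.card ι - Fintype.card ι ^ 2) • 1 +
        ((Fintype.card ι : ℝ) * (Fintype.card ι - 1)) • Matrix.of fun _ _ => 1 := by
  rw [hℓ.adjMatrix_netGraph, sub_mul, mul_sub, mul_sub, hℓ.sum_netMatrix_mul_self]
  simp only [Matrix.mul_smul, Matrix.smul_mul, mul_one, one_mul]
  module

theorem IsNet.adjMatrix_mul_ones (hℓ : IsNet ℓ) [DecidableRel (netGraph ℓ).Adj] :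
    (netGraph ℓ).adjMatrix ℝ * (Matrix.of fun _ _ => 1 : Matrix V V ℝ) =
      ((Fintype.card ι : ℝ) * (Fintype.card K - 1)) • Matrix.of fun _ _ => 1 := by
  rw [hℓ.adjMatrix_netGraph, sub_mul, Finset.sum_mul,
    Finset.sum_congr rfl fun i _ => hℓ.netMatrix_mul_ones i, Finset.sum_const, Finset.card_univ,
    ← Nat.cast_smul_eq_nsmul ℝ]
  simp only [Matrix.smul_mul, one_mul]
  module

end Matrix

/-- With q = |K| and k partitions, Nᵢ² = qNᵢ, NᵢNⱼ = J for i ≠ j, and A = ΣNᵢ - k. The resulting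
quadratic equation for A modulo J involves only q and k. -/
theorem IsNet.cospectral {ι V W K : Type*} [Finite ι] [Nontrivial ι] [Fintype V] [Fintype W]
    [Finite K] {ℓ : ι → V → K} {m : ι → W → K} (hℓ : IsNet ℓ) (hm : IsNet m) :
    Cospectral (netGraph ℓ) (netGraph m) := by
  classical
  cases nonempty_fintype ι
  cases nonempty_fintype K
  exact cospectral_of_quadratic (hℓ.card_eq.trans hm.card_eq.symm) hℓ.adjMatrix_mul_self
    hm.adjMatrix_mul_self hℓ.adjMatrix_mul_ones hm.adjMatrix_mul_ones

/-- The parallel classes of lines of the affine plane with the given directions, as a family of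
linear forms. -/
def lineForm {ι K : Type*} [CommRing K] (e : ι → ℤ × ℤ) (i : ι) (v : K × K) : K :=
  (e i).2 * v.1 - (e i).1 * v.2

theorem lineForm_sub {ι K : Type*} [CommRing K] (e : ι → ℤ × ℤ) (i : ι) (u v : K × K) :
    lineForm e i (u - v) = lineForm e i u - lineForm e i v := by
  simp only [lineForm, Prod.fst_sub, Prod.snd_sub]
  ring

/-- The determinant of two directions. -/
def directionDet {ι : Type*} (e : ι → ℤ × ℤ) (i j : ι) : ℤ :=
  (e i).2 * (e j).1 - (e i).1 * (e j).2

theorem isNet_lineForm {ι K : Type*} [Field K] [Finite K] (e : ι → ℤ × ℤ)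
    (he : ∀ i j, i ≠ j → (directionDet e i j : K) ≠ 0) : IsNet (lineForm (K := K) e) := by
  intro i j hij
  refine Finite.injective_iff_bijective.1 fun u v huv => ?_
  have h := he i j hij
  simp only [lineForm, Prod.mk.injEq, directionDet] at huv h
  push_cast at h
  refine Prod.ext (mul_left_cancel₀ h ?_) (mul_left_cancel₀ h ?_)
  · linear_combination (e j).1 * huv.1 - (e i).1 * huv.2
  · linear_combination (e j).2 * huv.1 - (e i).2 * huv.2

theorem IsCayleyOnSubgroup.netGraph_lineForm {G ι K : Type*} [Group G] [CommRing K]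
    (e : ι → ℤ × ℤ) (φ : Multiplicative K × Multiplicative K →* G) (hφ : Function.Injective φ) :
    IsCayleyOnSubgroup G (netGraph (lineForm (K := K) e)) :=
  .of_coordinates (fun a => φ (.ofAdd a.1, .ofAdd a.2)) (fun a b h => hφ.eq_iff.1 h)
    (fun a b => a - b) (fun u v => by
      rw [← map_inv, ← map_mul, ← div_eq_mul_inv]; rfl)
    {x | x ≠ 0 ∧ ∃ i, lineForm e i x = 0} fun a b => by
      simp [netGraph, lineForm_sub, sub_eq_zero]

/-! ### Four directions in the affine plane of order p > 5 -/

/-- Every 4-clique contains a triangle that is completely joined to another triangle. -/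
def HasJoinedTriangles {V : Type*} (Γ : SimpleGraph V) : Prop :=
  ∀ u : Fin 4 → V, (∀ i j, i ≠ j → Γ.Adj (u i) (u j)) →
    ∃ i, ∃ w : Fin 3 → V, (∀ a b, a ≠ b → Γ.Adj (w a) (w b)) ∧ ∀ j, j ≠ i → ∀ a, Γ.Adj (u j) (w a)

theorem HasJoinedTriangles.of_iso {V W : Type*} {Γ : SimpleGraph V} {Δ : SimpleGraph W}
    (h : HasJoinedTriangles Δ) (f : Γ ≃g Δ) : HasJoinedTriangles Γ := by
  intro u hu
  obtain ⟨i, w, hw, hij⟩ := h (f ∘ u) fun i j hij => f.map_adj_iff.2 (hu i j hij)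
  refine ⟨i, f.symm ∘ w, fun a b hab => f.symm.map_adj_iff.2 (hw a b hab), fun j hj a => ?_⟩
  rw [← f.map_adj_iff]
  simpa using hij j hj a

/-- Four directions in harmonic position. -/
def harmonicDirections : Fin 4 → ℤ × ℤ := ![(1, 0), (0, 1), (1, 1), (1, -1)]

/-- Four directions no two pairs of which are in harmonic position. -/
def anharmonicDirections : Fin 4 → ℤ × ℤ := ![(1, 0), (0, 1), (1, 1), (1, 3)]

/-- As 720 = 2⁴·3²·5, this one bound covers all the determinants and cross-ratio expressions that
must not vanish modulo p. -/
theorem intCast_ne_zero_of_dvd {p : ℕ} (hp : p.Prime) (hp5 : 5 < p) {d : ℤ} (hd : d ∣ 720) :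
    (d : ZMod p) ≠ 0 := by
  intro h
  have h1 : p ∣ 2 ^ 4 * 3 ^ 2 * 5 := by
    exact_mod_cast ((ZMod.intCast_zmod_eq_zero_iff_dvd d p).1 h).trans hd
  rw [hp.dvd_mul, hp.dvd_mul] at h1
  rcases h1 with (h1 | h1) | h1
  · have := Nat.le_of_dvd (by norm_num) (hp.dvd_of_dvd_pow h1); omega
  · have := Nat.le_of_dvd (by norm_num) (hp.dvd_of_dvd_pow h1); omega
  · have := Nat.le_of_dvd (by norm_num) h1; omega

theorem harmonic_adj_iff {K : Type*} [Field K] (u v : K × K) :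
    (netGraph (lineForm (K := K) harmonicDirections)).Adj u v ↔ u ≠ v ∧
      (u.2 = v.2 ∨ u.1 = v.1 ∨ u.1 - u.2 = v.1 - v.2 ∨ u.1 + u.2 = v.1 + v.2) := by
  simp only [netGraph, lineForm, harmonicDirections, Fin.exists_fin_succ]
  simp only [Matrix.cons_val_zero, Matrix.cons_val_succ, Int.cast_zero, Int.cast_one, zero_mul,
    one_mul, zero_sub, sub_zero, neg_inj, Int.cast_neg, IsEmpty.exists_iff, or_false]
  refine and_congr_right fun _ => or_congr_right (or_congr_right (or_congr_right ?_))
  constructor <;> intro h <;> linear_combination -h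

/-- The common neighbours of three corners of a square. -/
theorem harmonic_corner {K : Type*} [Field K] (h3 : (3 : K) ≠ 0) {s t x y : K}
    (hs : s ≠ 0) (ht : t ≠ 0) (hst : s = t ∨ s = -t) (n0 : ¬(x = 0 ∧ y = 0))
    (n1 : ¬(x = s ∧ y = 0)) (n2 : ¬(x = 0 ∧ y = t))
    (h0 : y = 0 ∨ x = 0 ∨ x = y ∨ x = -y)
    (hx : y = 0 ∨ x = s ∨ x - s = y ∨ x - s = -y)
    (hy : y = t ∨ x = 0 ∨ x = y - t ∨ x = t - y) :
    (x = s ∧ y = t) ∨ (2 * x = s ∧ 2 * y = t) ∨ (x = -s ∧ y = 0) ∨ (x = 0 ∧ y = -t) := by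
  rcases h0 with rfl | rfl | rfl | rfl
  · grind
  · grind
  · grind
  · grind

/-- By `harmonic_corner`, three corners of a square have four possible common neighbours: the fourth
corner, the centre and two outer points. The only possible edges among these join the fourth corner
to the centre and the outer points to each other, which leaves no triangle. -/
theorem harmonic_not_joined {K : Type*} [Field K] (h2 : (2 : K) ≠ 0) (h3 : (3 : K) ≠ 0)
    {c : K × K} {s t : K} (hs : s = 1 ∨ s = -1) (ht : t = 1 ∨ t = -1) {w : Fin 3 → K × K}
    (hw : ∀ a b, a ≠ b → (netGraph (lineForm (K := K) harmonicDirections)).Adj (w a) (w b))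
    (hc : ∀ a, (netGraph (lineForm (K := K) harmonicDirections)).Adj c (w a))
    (hcs : ∀ a, (netGraph (lineForm (K := K) harmonicDirections)).Adj (c.1 + s, c.2) (w a))
    (hct : ∀ a, (netGraph (lineForm (K := K) harmonicDirections)).Adj (c.1, c.2 + t) (w a)) :
    False := by
  have hs0 : s ≠ 0 := by rcases hs with rfl | rfl <;> simp
  have ht0 : t ≠ 0 := by rcases ht with rfl | rfl <;> simp
  let pt : Fin 4 → K × K := ![(s, t), (s / 2, t / 2), (-s, 0), (0, -t)]
  have key : ∀ a, ∃ i, w a = c + pt i := by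
    intro a
    obtain ⟨n0, h0⟩ := (harmonic_adj_iff _ _).1 (hc a)
    obtain ⟨n1, h1⟩ := (harmonic_adj_iff _ _).1 (hcs a)
    obtain ⟨n2, h2'⟩ := (harmonic_adj_iff _ _).1 (hct a)
    simp only [ne_eq, Prod.ext_iff] at n0 n1 n2
    rcases harmonic_corner h3 (s := s) (t := t) (x := (w a).1 - c.1) (y := (w a).2 - c.2) hs0 ht0
      (by grind) (by grind) (by grind) (by grind) (by grind) (by grind) (by grind)
      with h | h | h | h
    · exact ⟨0, Prod.ext (by simp [pt, ← h.1]) (by simp [pt, ← h.2])⟩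
    · exact ⟨1, Prod.ext (by simp [pt, ← h.1, h2]) (by simp [pt, ← h.2, h2])⟩
    · exact ⟨2, Prod.ext (by simp [pt, ← h.1]) (by simp [pt, ← h.2])⟩
    · exact ⟨3, Prod.ext (by simp [pt, ← h.1]) (by simp [pt, ← h.2])⟩
  choose f hf using key
  have hadj : ∀ i j, (netGraph (lineForm (K := K) harmonicDirections)).Adj (c + pt i) (c + pt j) →
      i ≠ j ∧ (i.val < 2 ↔ j.val < 2) := by
    intro i j hij
    refine ⟨fun h => hij.1 (h ▸ rfl), ?_⟩
    rw [harmonic_adj_iff] at hij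
    have hij := hij.2
    by_contra hne
    have hss : s / 2 + s / 2 = s := by field_simp; ring
    have htt : t / 2 + t / 2 = t := by field_simp; ring
    fin_cases i <;> fin_cases j <;> simp [pt] at hij hne <;> grind
  have h := fun a b hab => hadj (f a) (f b) (by rw [← hf, ← hf]; exact hw a b hab)
  clear hadj hf
  revert f
  decide

/-- The unit square is a 4-clique because its sides and its diagonals have the four directions. Each
three of its corners are excluded by `harmonic_not_joined`. -/
theorem not_hasJoinedTriangles_harmonic {K : Type*} [Field K] (h2 : (2 : K) ≠ 0)
    (h3 : (3 : K) ≠ 0) :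
    ¬HasJoinedTriangles (netGraph (lineForm (K := K) harmonicDirections)) := by
  intro h
  obtain ⟨i, w, hw, hi⟩ := h ![(0, 0), (1, 0), (0, 1), (1, 1)] (by
    intro i j hij
    rw [harmonic_adj_iff]
    fin_cases i <;> fin_cases j <;> simp at hij ⊢)
  fin_cases i
  · exact harmonic_not_joined h2 h3 (c := (1, 1)) (s := -1) (t := -1) (.inr rfl) (.inr rfl) hw
      (hi 3 (by decide)) (by simpa using hi 2 (by decide)) (by simpa using hi 1 (by decide))
  · exact harmonic_not_joined h2 h3 (c := (0, 1)) (s := 1) (t := -1) (.inl rfl) (.inr rfl) hw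
      (hi 2 (by decide)) (by simpa using hi 3 (by decide)) (by simpa using hi 0 (by decide))
  · exact harmonic_not_joined h2 h3 (c := (1, 0)) (s := -1) (t := 1) (.inr rfl) (.inl rfl) hw
      (hi 1 (by decide)) (by simpa using hi 0 (by decide)) (by simpa using hi 3 (by decide))
  · exact harmonic_not_joined h2 h3 (c := (0, 0)) (s := 1) (t := 1) (.inl rfl) (.inl rfl) hw
      (hi 0 (by decide)) (by simpa using hi 1 (by decide)) (by simpa using hi 2 (by decide))

theorem eq_mul_direction {K : Type*} [Field K] {i : Fin 4} {a : K × K}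
    (h : lineForm anharmonicDirections i a = 0) :
    ∃ x : K, a.1 = x * (anharmonicDirections i).1 ∧ a.2 = x * (anharmonicDirections i).2 := by
  fin_cases i <;> simp [lineForm, anharmonicDirections] at h ⊢ <;> grind

theorem lineForm_mul_direction {ι K : Type*} [CommRing K] (e : ι → ℤ × ℤ) {i j : ι} {x : K}
    {a : K × K} (h1 : a.1 = x * (e j).1) (h2 : a.2 = x * (e j).2) :
    lineForm e i a = x * directionDet e i j := by
  rw [lineForm, h1, h2, directionDet]
  push_cast
  ring

/-- The expression vanishes in K exactly when the sum and the difference of suitable nonzero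
multiples of the directions α and β can have directions γ and δ, that is, for the diagonals of a
parallelogram. -/
theorem anharmonic_crossRatio : ∀ α β γ δ, α ≠ β → γ ≠ α → γ ≠ β → δ ≠ α → δ ≠ β →
    directionDet anharmonicDirections γ α * directionDet anharmonicDirections δ β +
      directionDet anharmonicDirections γ β * directionDet anharmonicDirections δ α ∣ 720 := by
  decide +kernel

theorem isNet_anharmonicDirections {p : ℕ} [hp : Fact p.Prime] (hp5 : 5 < p) :
    IsNet (lineForm (K := ZMod p) anharmonicDirections) :=
  isNet_lineForm _ fun i j hij => intCast_ne_zero_of_dvd hp.out hp5 <|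
    (show ∀ i j, i ≠ j → directionDet anharmonicDirections i j ∣ 720 by decide +kernel) i j hij

theorem isNet_harmonicDirections {p : ℕ} [hp : Fact p.Prime] (hp5 : 5 < p) :
    IsNet (lineForm (K := ZMod p) harmonicDirections) :=
  isNet_lineForm _ fun i j hij => intCast_ne_zero_of_dvd hp.out hp5 <|
    (show ∀ i j, i ≠ j → directionDet harmonicDirections i j ∣ 720 by decide +kernel) i j hij

/-- The sides of a parallelogram and its diagonals are never in harmonic position. -/
theorem anharmonic_no_parallelogram {p : ℕ} [hp : Fact p.Prime] (hp5 : 5 < p)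
    {u₀ u₁ u₂ u₃ : ZMod p × ZMod p} {α β γ δ : Fin 4} (hαβ : α ≠ β) (hγα : γ ≠ α) (hγβ : γ ≠ β)
    (hδα : δ ≠ α) (hδβ : δ ≠ β)
    (h₀₁ : lineForm anharmonicDirections α u₀ = lineForm anharmonicDirections α u₁)
    (h₂₃ : lineForm anharmonicDirections α u₂ = lineForm anharmonicDirections α u₃)
    (h₀₂ : lineForm anharmonicDirections β u₀ = lineForm anharmonicDirections β u₂)
    (h₁₃ : lineForm anharmonicDirections β u₁ = lineForm anharmonicDirections β u₃)
    (h₀₃ : lineForm anharmonicDirections γ u₀ = lineForm anharmonicDirections γ u₃)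
    (h₁₂ : lineForm anharmonicDirections δ u₁ = lineForm anharmonicDirections δ u₂) : u₀ = u₁ := by
  -- The difference of the two sides is parallel to both α and β, so it vanishes.
  have h4 : u₂ - u₀ = u₃ - u₁ := by
    by_contra h
    refine hαβ ((isNet_anharmonicDirections hp5).eq_of_eq ?_ ?_ h)
    · rw [lineForm_sub, lineForm_sub, h₀₁, h₂₃]
    · rw [lineForm_sub, lineForm_sub, h₀₂, h₁₃, sub_self, sub_self]
  obtain ⟨x, hx1, hx2⟩ := eq_mul_direction (i := α) (a := u₁ - u₀)
    (by rw [lineForm_sub, h₀₁, sub_self])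
  obtain ⟨y, hy1, hy2⟩ := eq_mul_direction (i := β) (a := u₂ - u₀)
    (by rw [lineForm_sub, h₀₂, sub_self])
  have h5 := fun i => lineForm_mul_direction anharmonicDirections (i := i) hx1 hx2
  have h6 := fun i => lineForm_mul_direction anharmonicDirections (i := i) hy1 hy2
  have h7 := congrArg (lineForm anharmonicDirections γ) h4
  have h8 := intCast_ne_zero_of_dvd hp.out hp5 (anharmonic_crossRatio α β γ δ hαβ hγα hγβ hδα hδβ)
  have h9 := h5 γ
  have h10 := h6 γ
  have h11 := h5 δ
  have h12 := h6 δ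
  rw [lineForm_sub] at h9 h10 h11 h12
  rw [lineForm_sub, lineForm_sub] at h7
  push_cast at h8
  -- The diagonals are the sum and the difference of x times direction α and y times direction β.
  -- Being parallel to γ and δ they give two linear equations in x and y, from which y is
  -- eliminated.
  have hx : x = 0 := by
    refine (mul_eq_zero.1 ?_).resolve_right h8
    linear_combination
      -(directionDet anharmonicDirections δ β : ZMod p) * (h9 + h10 - h7 + h₀₃) -
        directionDet anharmonicDirections γ β * (h11 - h12 - h₁₂)
  rw [hx, zero_mul] at hx1 hx2
  exact (sub_eq_zero.1 (Prod.ext hx1 hx2 : u₁ - u₀ = 0)).symm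

/-- The colourings of the edges of the complete graph on four vertices. -/
theorem exists_monochromatic_pairs : ∀ c₀₁ c₀₂ c₀₃ c₁₂ c₁₃ c₂₃ : Fin 4, c₀₁ ≠ c₀₂ → c₀₁ ≠ c₀₃ →
    c₀₂ ≠ c₀₃ → c₀₁ ≠ c₁₂ → c₀₁ ≠ c₁₃ → c₁₂ ≠ c₁₃ → c₀₂ ≠ c₁₂ → c₀₂ ≠ c₂₃ → c₁₂ ≠ c₂₃ →
    c₀₃ ≠ c₁₃ → c₀₃ ≠ c₂₃ → c₁₃ ≠ c₂₃ →
    (c₀₁ = c₂₃ ∧ c₀₂ = c₁₃) ∨ (c₀₁ = c₂₃ ∧ c₀₃ = c₁₂) ∨ (c₀₂ = c₁₃ ∧ c₀₃ = c₁₂) := by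
  decide +kernel

/-- Colour the six edges of the clique by direction. If no three points share a line of the net, the
colouring is proper; as there are only four colours, two of the three pairs of opposite edges are
monochromatic. These bound a parallelogram with diagonals in the net. -/
theorem anharmonic_exists_collinear {p : ℕ} [hp : Fact p.Prime] (hp5 : 5 < p)
    {u : Fin 4 → ZMod p × ZMod p}
    (hu : ∀ i j, i ≠ j → (netGraph (lineForm anharmonicDirections)).Adj (u i) (u j)) :
    ∃ i c a, ∀ j, j ≠ i → lineForm anharmonicDirections c (u j) = a := by
  by_contra! hne
  have key : ∀ x y z i : Fin 4, (∀ j, j ≠ i → j = x ∨ j = y ∨ j = z) → ∀ c d,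
      lineForm anharmonicDirections c (u x) = lineForm anharmonicDirections c (u y) →
      lineForm anharmonicDirections d (u x) = lineForm anharmonicDirections d (u z) → c ≠ d := by
    rintro x y z i h c _ h1 h2 rfl
    obtain ⟨j, hj, hj'⟩ := hne i c (lineForm anharmonicDirections c (u x))
    rcases h j hj with rfl | rfl | rfl
    · exact hj' rfl
    · exact hj' h1.symm
    · exact hj' h2.symm
  obtain ⟨n₀₁, c₀₁, h₀₁⟩ := hu 0 1 (by decide)
  obtain ⟨n₀₂, c₀₂, h₀₂⟩ := hu 0 2 (by decide)
  obtain ⟨n₀₃, c₀₃, h₀₃⟩ := hu 0 3 (by decide)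
  obtain ⟨-, c₁₂, h₁₂⟩ := hu 1 2 (by decide)
  obtain ⟨-, c₁₃, h₁₃⟩ := hu 1 3 (by decide)
  obtain ⟨-, c₂₃, h₂₃⟩ := hu 2 3 (by decide)
  have k₁ := key 0 1 2 3 (by decide) _ _ h₀₁ h₀₂
  have k₂ := key 0 1 3 2 (by decide) _ _ h₀₁ h₀₃
  have k₃ := key 0 2 3 1 (by decide) _ _ h₀₂ h₀₃
  have k₄ := key 1 0 2 3 (by decide) _ _ h₀₁.symm h₁₂
  have k₅ := key 1 0 3 2 (by decide) _ _ h₀₁.symm h₁₃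
  have k₆ := key 1 2 3 0 (by decide) _ _ h₁₂ h₁₃
  have k₇ := key 2 0 1 3 (by decide) _ _ h₀₂.symm h₁₂.symm
  have k₈ := key 2 0 3 1 (by decide) _ _ h₀₂.symm h₂₃
  have k₉ := key 2 1 3 0 (by decide) _ _ h₁₂.symm h₂₃
  have k₁₀ := key 3 0 1 2 (by decide) _ _ h₀₃.symm h₁₃.symm
  have k₁₁ := key 3 0 2 1 (by decide) _ _ h₀₃.symm h₂₃.symm
  have k₁₂ := key 3 1 2 0 (by decide) _ _ h₁₃.symm h₂₃.symm
  rcases exists_monochromatic_pairs c₀₁ c₀₂ c₀₃ c₁₂ c₁₃ c₂₃ k₁ k₂ k₃ k₄ k₅ k₆ k₇ k₈ k₉ k₁₀ k₁₁ k₁₂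
    with ⟨rfl, rfl⟩ | ⟨rfl, rfl⟩ | ⟨rfl, rfl⟩
  · exact n₀₁ (anharmonic_no_parallelogram hp5 k₁ k₂.symm k₃.symm k₄.symm k₇.symm h₀₁ h₂₃ h₀₂ h₁₃
      h₀₃ h₁₂)
  · exact n₀₁ (anharmonic_no_parallelogram hp5 k₂ k₁.symm k₃ k₅.symm k₁₀.symm h₀₁ h₂₃.symm h₀₃ h₁₂
      h₀₂ h₁₃)
  · exact n₀₂ (anharmonic_no_parallelogram hp5 k₃ k₁ k₂ k₈.symm k₁₁.symm h₀₂ h₁₃.symm h₀₃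
      h₁₂.symm h₀₁ h₂₃)

/-- Three points of the clique lie on a line, and this line has p > 5 points, hence at least three
more. -/
theorem hasJoinedTriangles_anharmonic {p : ℕ} [hp : Fact p.Prime] (hp5 : 5 < p) :
    HasJoinedTriangles (netGraph (lineForm (K := ZMod p) anharmonicDirections)) := by
  intro u hu
  obtain ⟨i, c, a, hi⟩ := anharmonic_exists_collinear hp5 hu
  have hcard := (isNet_anharmonicDirections hp5).card_fiber c a
  rw [ZMod.card] at hcard
  set s := Finset.univ.filter fun v : ZMod p × ZMod p => lineForm anharmonicDirections c v = a
  set t := (Finset.univ.erase i).image u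
  have ht : t.card ≤ 3 := Finset.card_image_le.trans
    (by rw [Finset.card_erase_of_mem (Finset.mem_univ i), Finset.card_fin])
  have hst : Fintype.card (Fin 3) ≤ Fintype.card ↥(s \ t) := by
    have := Finset.le_card_sdiff t s
    rw [Fintype.card_coe, Fintype.card_fin]
    omega
  obtain ⟨w⟩ := Function.Embedding.nonempty_of_card_le hst
  have hw : ∀ b, lineForm anharmonicDirections c (w b).1 = a := fun b =>
    (Finset.mem_filter.1 (Finset.mem_sdiff.1 (w b).2).1).2
  refine ⟨i, fun b => (w b).1, fun b d hbd => ⟨fun h => hbd (w.injective (Subtype.ext h)), c, ?_⟩,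
    fun j hj b => ⟨fun h => (Finset.mem_sdiff.1 (w b).2).2 ?_, c, ?_⟩⟩
  · rw [hw, hw]
  · change u j = (w b).1 at h
    rw [← h]
    exact Finset.mem_image_of_mem u (Finset.mem_erase.2 ⟨hj, Finset.mem_univ j⟩)
  · rw [hw, hi j hj]

theorem not_isCayDSGroup_of_injective {G : Type*} [Group G] [Fintype G] {p : ℕ}
    [hp : Fact p.Prime] (hp5 : 5 < p) (φ : Multiplicative (ZMod p) × Multiplicative (ZMod p) →* G)
    (hφ : Function.Injective φ) : ¬IsCayDSGroup G := by
  intro hG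
  obtain ⟨f⟩ := hG.nonempty_iso (.netGraph_lineForm harmonicDirections φ hφ)
    (.netGraph_lineForm anharmonicDirections (MonoidHom.id (_ × _)) Function.injective_id)
    ((isNet_harmonicDirections hp5).connected (i := 0) (j := 1) (k := 2) (by decide) (by decide)
      (by decide))
    ((isNet_harmonicDirections hp5).cospectral (isNet_anharmonicDirections hp5))
  refine not_hasJoinedTriangles_harmonic ?_ ?_ ((hasJoinedTriangles_anharmonic hp5).of_iso f)
  · exact_mod_cast intCast_ne_zero_of_dvd hp.out hp5 (d := 2) (by norm_num)
  · exact_mod_cast intCast_ne_zero_of_dvd hp.out hp5 (d := 3) (by norm_num)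

/-! ### Latin squares of order five -/

instance {ι V K : Type*} [Fintype ι] [DecidableEq V] [DecidableEq K] (ℓ : ι → V → K) :
    DecidableRel (netGraph ℓ).Adj :=
  fun u v => inferInstanceAs (Decidable (u ≠ v ∧ ∃ i, ℓ i u = ℓ i v))

/-- Every 4-clique is contained in a 5-clique. -/
def CliquesExtend {V : Type*} (Γ : SimpleGraph V) : Prop :=
  ∀ a b c d, Γ.Adj a b → Γ.Adj a c → Γ.Adj b c → Γ.Adj a d → Γ.Adj b d → Γ.Adj c d →
    ∃ e, Γ.Adj a e ∧ Γ.Adj b e ∧ Γ.Adj c e ∧ Γ.Adj d e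

theorem CliquesExtend.of_iso {V W : Type*} {Γ : SimpleGraph V} {Δ : SimpleGraph W}
    (h : CliquesExtend Γ) (f : Γ ≃g Δ) : CliquesExtend Δ := by
  intro a b c d
  obtain ⟨a, rfl⟩ := f.surjective a
  obtain ⟨b, rfl⟩ := f.surjective b
  obtain ⟨c, rfl⟩ := f.surjective c
  obtain ⟨d, rfl⟩ := f.surjective d
  simp only [f.map_adj_iff]
  intro h1 h2 h3 h4 h5 h6
  obtain ⟨e, he⟩ := h a b c d h1 h2 h3 h4 h5 h6
  exact ⟨f e, by simpa only [f.map_adj_iff] using he⟩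

/-- Three directions in the affine plane. -/
def triangleDirections : Fin 3 → ℤ × ℤ := ![(1, 0), (0, 1), (1, 1)]

/-- The net of a Latin square of order five that contains a Latin subsquare of order two. -/
def latinSquareNet : Fin 3 → ZMod 5 × ZMod 5 → ZMod 5 :=
  ![Prod.fst, Prod.snd, fun v => [0, 1, 2, 3, 4, 1, 0, 3, 4, 2, 2, 3, 4, 0, 1, 3, 4, 1, 2, 0,
    4, 2, 0, 1, 3].getD (v.1.val * 5 + v.2.val) 0]

theorem isNet_latinSquareNet : IsNet latinSquareNet := by
  intro i j hij
  refine Finite.injective_iff_bijective.1 ?_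
  revert i j
  decide +kernel

theorem isNet_triangleDirections : IsNet (lineForm (K := ZMod 5) triangleDirections) := by
  have h : ∀ i j, i ≠ j → (directionDet triangleDirections i j : ZMod 5) ≠ 0 := by decide +kernel
  have : Fact (Nat.Prime 5) := ⟨Nat.prime_five⟩
  exact isNet_lineForm _ h

/-- The collinearity graph of the net given by three parallel classes of the affine plane of
order five. -/
def triangleGraph : SimpleGraph (ZMod 5 × ZMod 5) :=
  netGraph (lineForm (K := ZMod 5) triangleDirections)

instance : DecidableRel triangleGraph.Adj := inferInstanceAs (DecidableRel (netGraph _).Adj)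

/-- The addition table of ℤ/5 has no subsquare of order two, so 4-cliques lie on lines, which have
five points. Translations reduce the finite check to cliques through 0. -/
theorem cliquesExtend_triangleDirections :
    CliquesExtend triangleGraph := by
  have trans : ∀ t u v, triangleGraph.Adj u v ↔
      triangleGraph.Adj (u - t) (v - t) := by
    intro t u v
    simp [triangleGraph, netGraph, lineForm_sub]
  have key : ∀ b, triangleGraph.Adj 0 b →
      ∀ c, triangleGraph.Adj 0 c →
      triangleGraph.Adj b c →
      ∀ d, triangleGraph.Adj 0 d →
      triangleGraph.Adj b d →
      triangleGraph.Adj c d →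
      ∃ e, triangleGraph.Adj 0 e ∧
        triangleGraph.Adj b e ∧
        triangleGraph.Adj c e ∧
        triangleGraph.Adj d e := by
    decide +kernel
  intro a b c d h1 h2 h3 h4 h5 h6
  rw [trans a] at h1 h2 h3 h4 h5 h6
  rw [sub_self] at h1 h2 h4
  obtain ⟨e, he⟩ := key _ h1 _ h2 h3 _ h4 h5 h6
  refine ⟨e + a, ?_⟩
  simp only [trans a _ (e + a), add_sub_cancel_right, sub_self]
  exact he

/-- The four cells of the subsquare of order two form a 4-clique with no common neighbour. -/
theorem not_cliquesExtend_latinSquareNet : ¬CliquesExtend (netGraph latinSquareNet) := by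
  intro h
  have := h (0, 0) (0, 1) (1, 0) (1, 1) (by decide) (by decide) (by decide) (by decide)
    (by decide) (by decide)
  revert this
  decide +kernel

theorem not_isDSGroup_of_injective {G : Type*} [Group G] [Fintype G]
    (φ : Multiplicative (ZMod 5) × Multiplicative (ZMod 5) →* G)
    (hφ : Function.Injective φ) : ¬IsDSGroup G := by
  intro hG
  have : Fact (Nat.Prime 5) := ⟨Nat.prime_five⟩
  obtain ⟨f⟩ := hG.nonempty_iso (Γ := triangleGraph) (.netGraph_lineForm _ φ hφ)
    (isNet_triangleDirections.connected (i := 0) (j := 1) (k := 2) (by decide) (by decide)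
      (by decide))
    (isNet_triangleDirections.cospectral isNet_latinSquareNet)
  exact not_cliquesExtend_latinSquareNet (cliquesExtend_triangleDirections.of_iso f)

/-! ### Conclusions for Sylow subgroups -/

theorem IsPGroup.exists_injective_of_not_isCyclic {p : ℕ} [Fact p.Prime] (hp2 : p ≠ 2)
    {P : Type*} [Group P] [Finite P] (h : IsPGroup p P) (hP : ¬IsCyclic P) :
    ∃ y z : P, ∃ (hy : y ^ p = 1) (hz : z ^ p = 1) (hyz : Commute y z), z ≠ 1 ∧
      y ∉ Subgroup.zpowers z ∧ Function.Injective (zmodPowProd p hy hz hyz) := by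
  obtain ⟨y, z, hy, hz, hyz, hz1, hy1⟩ := h.exists_commute_of_not_isCyclic hp2 hP
  exact ⟨y, z, hy, hz, hyz, hz1, hy1, zmodPowProd_injective p hy hz hyz hz1 hy1⟩

theorem IsCayDSGroup.card_ne_twentySeven {G : Type*} [Group G] [Fintype G] (hG : IsCayDSGroup G)
    {Q : Subgroup G} (hQ : Nat.card Q = 27) {y z : Q} (hy : y ^ 3 = 1) (hz : z ^ 3 = 1)
    (hyz : Commute y z) (hz1 : z ≠ 1) (hy1 : y ∉ Subgroup.zpowers z) : False := by
  rcases isCayleyOnSubgroup_of_card_eq hQ hy hz hyz hz1 hy1 with h | h | h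
  · exact hG.not_hammingGraph h.of_subgroup
  · exact hG.not_hammingMate h.of_subgroup
  · exact hG.not_nineThreeGraph h.of_subgroup

theorem IsCayDSGroup.isCyclic_or_of_isPGroup_three {G : Type*} [Group G] [Fintype G]
    (hG : IsCayDSGroup G) {P : Subgroup G} (h3 : IsPGroup 3 P) : IsCyclic P ∨
      Nonempty (P ≃* Multiplicative (ZMod 3) × Multiplicative (ZMod 3)) := by
  have : Fact (Nat.Prime 3) := ⟨Nat.prime_three⟩
  by_cases hP : IsCyclic P
  · exact .inl hP
  right
  obtain ⟨y, z, hy, hz, hyz, hz1, hy1, hinj⟩ :=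
    IsPGroup.exists_injective_of_not_isCyclic (by norm_num) h3 hP
  obtain ⟨n, hn⟩ := IsPGroup.iff_card.1 h3
  have hrange : Nat.card (zmodPowProd 3 hy hz hyz).range = 3 ^ 2 := by
    rw [← Nat.card_congr ((zmodPowProd 3 hy hz hyz).ofInjective hinj).toEquiv]
    simp [Nat.card_eq_fintype_card]
  have hle := Subgroup.card_le_card_group (zmodPowProd 3 hy hz hyz).range
  rw [hrange] at hle
  replace hle := hle.trans_eq hn
  rcases (Nat.pow_le_pow_iff_right (by norm_num)).1 hle |>.eq_or_lt with h | h
  · refine ⟨(MulEquiv.ofBijective (zmodPowProd 3 hy hz hyz) ⟨hinj, ?_⟩).symm⟩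
    rw [← MonoidHom.range_eq_top]
    exact Subgroup.eq_top_of_card_eq _ (by rw [hrange, hn, h])
  · exfalso
    -- If P is larger than its subgroup C₃ × C₃, that subgroup lies in one of order 27, which is
    -- excluded.
    obtain ⟨Q, hQ, hle⟩ := Sylow.exists_subgroup_card_pow_succ (p := 3) (n := 2)
      (hn ▸ pow_dvd_pow 3 h) hrange
    have hmem : ∀ i j, zmodPow 3 y hy i * zmodPow 3 z hz j ∈ Q := fun i j => hle ⟨(i, j), rfl⟩
    have hyQ : y ∈ Q := by simpa [zmodPow_one] using hmem (.ofAdd 1) 1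
    have hzQ : z ∈ Q := by simpa [zmodPow_one] using hmem 1 (.ofAdd 1)
    have hinj' : Function.Injective P.subtype := P.subtype_injective
    refine hG.card_ne_twentySeven (Q := Q.map P.subtype) (y := ⟨y, ⟨y, hyQ, rfl⟩⟩)
      (z := ⟨z, ⟨z, hzQ, rfl⟩⟩) ?_ ?_ ?_ ?_ ?_ ?_
    · rw [Subgroup.card_map_of_injective hinj', hQ]; rfl
    · have := congrArg Subtype.val hy
      exact Subtype.ext this
    · have := congrArg Subtype.val hz
      exact Subtype.ext this
    · have := congrArg Subtype.val hyz
      exact Subtype.ext this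
    · intro h
      have := congrArg Subtype.val h
      exact hz1 (Subtype.ext this)
    · rintro ⟨i, hi⟩
      have := congrArg Subtype.val hi
      exact hy1 ⟨i, Subtype.ext this⟩

theorem theorem1p1 (G : Type*) [Group G] [Fintype G] :
    (IsCayDSGroup G →
      (∀ p : ℕ, p.Prime → 5 < p → ∀ P : Sylow p G, IsCyclic P) ∧
      (∀ P : Sylow 2 G, Nat.card P ≤ 16) ∧
      (∀ P : Sylow 3 G, IsCyclic P ∨
        Nonempty (P ≃* Multiplicative (ZMod 3) × Multiplicative (ZMod 3)))) ∧
    (IsDSGroup G → ∀ P : Sylow 5 G, IsCyclic P) := by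
  refine ⟨fun hG => ⟨fun p hp hp5 P => ?_, fun P => ?_,
    fun P => hG.isCyclic_or_of_isPGroup_three P.2⟩, fun hG P => ?_⟩
  · have : Fact p.Prime := ⟨hp⟩
    by_contra hP
    obtain ⟨y, z, hy, hz, hyz, -, -, hinj⟩ := IsPGroup.exists_injective_of_not_isCyclic
      (by omega) P.2 hP
    exact not_isCayDSGroup_of_injective hp5 (P.1.subtype.comp (zmodPowProd p hy hz hyz))
      (P.1.subtype_injective.comp hinj) hG
  · have : Fact (Nat.Prime 2) := ⟨Nat.prime_two⟩
    obtain ⟨n, hn⟩ := IsPGroup.iff_card.1 P.2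
    change Nat.card P = 2 ^ n at hn
    rw [hn]
    by_contra! h
    have h4 : 4 < n := (Nat.pow_lt_pow_iff_right (a := 2) (by norm_num)).1 h
    refine hG.not_thirtyTwo_dvd ((pow_dvd_pow 2 h4).trans ?_)
    rw [← hn]
    exact P.1.card_subgroup_dvd_card
  · have : Fact (Nat.Prime 5) := ⟨Nat.prime_five⟩
    by_contra hP
    obtain ⟨y, z, hy, hz, hyz, -, -, hinj⟩ := IsPGroup.exists_injective_of_not_isCyclic
      (by norm_num) P.2 hP
    exact not_isDSGroup_of_injective (P.1.subtype.comp (zmodPowProd 5 hy hz hyz))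
      (P.1.subtype_injective.comp hinj) hG
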